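/- Let $a\in\mathbb C\setminus\{0\}$, let $U\subset\mathbb C^2$ be an open neighbourhood of $0$ with coordinates $(z^1,z^2)=(u,v)$, let $g=(g_{i\bar j})$ be a smooth Kähler metric on $U$, and let $$\tilde X=\tilde X^1\partial_u+\tilde X^2\partial_v=u(a+v)\,\partial_u-v^2\,\partial_v .$$ Write $|\tilde X|_g^2=\sum_{i,j} g_{i\bar j}\tilde X^i\overline{\tilde X^j}$ and let $\eta$ be the $(1,0)$-form $$\eta=\frac{g(\,\cdot\,,\overline{\tilde X})}{g(\tilde X,\overline{\tilde X})}=\frac{1}{|\tilde X|_g^2}\sum_{i,j}g_{i\bar j}\,\overline{\tilde X^j}\,dz^i$$ on $U\setminus\{0\}$. Fix a compact neighbourhood $K\subset U$ of $0$ and, for $r>0$, let $B_r=\{z\in K: |\tilde X|_g^2(z)\le r^4\}$ (a "distorted ball" around $0$). Then for every smooth function $\varphi:U\to\mathbb C$, the integral of $\varphi\,\eta\wedge\bar\partial\eta$ over $\partial B_r$, with its boundary orientation (outward vector first, with respect to the complex orientation of $\mathbb C^2$), is well defined for all sufficiently small $r>0$, and $$\lim_{r\to0^+}\int_{\partial B_r}\varphi\,\eta\wedge\bar\partial\eta=\frac{4\pi^2}{a}\,\frac{\partial\varphi}{\partial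 v}(0)-\frac{4\pi^2}{a^2}\,\varphi(0).$$ -/

import Mathlib

open scoped ContDiff Topology ComplexOrder

noncomputable section

namespace DegenerateResidue

/-! ### Complex calculus on `ℂ²`

Points of `ℂ²` are functions `Fin 2 → ℂ`; the coordinates are `u = z 0` and `v = z 1`.
Differential forms are evaluated on (real) tangent vectors, which are again elements of `ℂ²`. -/

/-- The Wirtinger derivative `∂f/∂z^k = (∂f/∂x^k - i ∂f/∂y^k) / 2`. -/
def wirtinger (k : Fin 2) (f : (Fin 2 → ℂ) → ℂ) (z : Fin 2 → ℂ) : ℂ :=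
  (fderiv ℝ f z (Pi.single k 1) - Complex.I * fderiv ℝ f z (Pi.single k Complex.I)) / 2

/-- The `(1,1)`-form `∂̄η` of a `(1,0)`-form `η`. For `η = ∑ η_j dz^j` this is
`∑ ∂̄η_j ∧ dz^j`, where `∂̄f(h) = (Df(h) + i Df(i h)) / 2` and
`(α ∧ β)(h, k) = α(h) β(k) - α(k) β(h)`. -/
def dbar (η : (Fin 2 → ℂ) → ((Fin 2 → ℂ) →L[ℂ] ℂ)) (z h k : Fin 2 → ℂ) : ℂ :=
  (fderiv ℝ η z h + Complex.I • fderiv ℝ η z (Complex.I • h)) k / 2 -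
    (fderiv ℝ η z k + Complex.I • fderiv ℝ η z (Complex.I • k)) h / 2

/-- The wedge product of a `1`-form and a `2`-form at a point,
normalised so that `(dx ∧ dy ∧ dz)(∂x, ∂y, ∂z) = 1`. -/
def wedge (α : (Fin 2 → ℂ) → ℂ) (β : (Fin 2 → ℂ) → (Fin 2 → ℂ) → ℂ)
    (h : Fin 3 → Fin 2 → ℂ) : ℂ :=
  α (h 0) * β (h 1) (h 2) - α (h 1) * β (h 0) (h 2) + α (h 2) * β (h 0) (h 1)

/-! ### Kähler metrics -/

/-- `g = (g_{i j̄})` is a smooth Kähler metric on the open set `U`: it is smooth, Hermitian and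
positive definite, and its form `∑ g_{i j̄} dz^i ∧ dz̄^j` is closed. -/
structure IsKahlerMetricOn (g : (Fin 2 → ℂ) → Matrix (Fin 2) (Fin 2) ℂ)
    (U : Set (Fin 2 → ℂ)) : Prop where
  smooth : ∀ i j, ContDiffOn ℝ ∞ (fun z => g z i j) U
  posDef : ∀ z ∈ U, (g z).PosDef
  closed : ∀ z ∈ U, ∀ i j k,
    wirtinger k (fun w => g w i j) z = wirtinger i (fun w => g w k j) z

/-! ### The vector field, the form `η` and the distorted balls -/

/-- The components of the vector field `X = u (a + v) ∂_u - v² ∂_v`. -/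
def field (a : ℂ) (z : Fin 2 → ℂ) : Fin 2 → ℂ :=
  ![z 0 * (a + z 1), -(z 1) ^ 2]

/-- `|X|²_g = ∑ g_{i j̄} X^i X̄^j` (a real number, as `g` is Hermitian). -/
def fieldNormSq (a : ℂ) (g : (Fin 2 → ℂ) → Matrix (Fin 2) (Fin 2) ℂ) (z : Fin 2 → ℂ) : ℝ :=
  (∑ i, ∑ j, g z i j * field a z i * star (field a z j)).re

/-- The `(1,0)`-form `η(Y) = g(Y, X̄) / g(X, X̄)`. -/
def eta (a : ℂ) (g : (Fin 2 → ℂ) → Matrix (Fin 2) (Fin 2) ℂ) (z : Fin 2 → ℂ) :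
    (Fin 2 → ℂ) →L[ℂ] ℂ :=
  ∑ i, ((∑ j, g z i j * star (field a z j)) / (fieldNormSq a g z : ℂ)) •
    (ContinuousLinearMap.proj i : (Fin 2 → ℂ) →L[ℂ] ℂ)

/-- The `3`-form `φ η ∧ ∂̄η`. -/
def residueForm (a : ℂ) (g : (Fin 2 → ℂ) → Matrix (Fin 2) (Fin 2) ℂ)
    (φ : (Fin 2 → ℂ) → ℂ) (z : Fin 2 → ℂ) (h : Fin 3 → Fin 2 → ℂ) : ℂ :=
  φ z * wedge (eta a g z) (dbar (eta a g) z) h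

/-- The distorted ball `{|X|²_g ≤ r⁴}` around `0`, inside a fixed neighbourhood `K` of `0`. -/
def distortedBall (a : ℂ) (g : (Fin 2 → ℂ) → Matrix (Fin 2) (Fin 2) ℂ)
    (K : Set (Fin 2 → ℂ)) (r : ℝ) : Set (Fin 2 → ℂ) :=
  {z ∈ K | fieldNormSq a g z ≤ r ^ 4}

/-! ### Integration of `3`-forms over the oriented boundary of a domain in `ℂ²` -/

/-- The real coordinates `(Re u, Im u, Re v, Im v)`; they fix the orientation of `ℂ²`. -/
def realCoords (w : Fin 2 → ℂ) : Fin 4 → ℝ :=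
  ![(w 0).re, (w 0).im, (w 1).re, (w 1).im]

/-- The vector `n` at the boundary point `p` of `B` points out of `B`. -/
def IsOutward (B : Set (Fin 2 → ℂ)) (p n : Fin 2 → ℂ) : Prop :=
  ∀ᶠ t : ℝ in 𝓝[>] 0, p + t • n ∉ B ∧ p - t • n ∈ interior B

/-- The coordinate tangent vectors `∂ψ/∂y_0, ∂ψ/∂y_1, ∂ψ/∂y_2`. -/
def tangentFrame (ψ : (Fin 3 → ℝ) → Fin 2 → ℂ) (y : Fin 3 → ℝ) : Fin 3 → Fin 2 → ℂ :=
  fun k => fderiv ℝ ψ y (Pi.single k 1)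

/-- `ψ : V → ∂B` is a smooth local parametrisation of the boundary of `B` (an injective
immersion of an open set `V ⊆ ℝ³`), positively oriented for the boundary orientation: an outward
vector followed by the coordinate tangent vectors is a positive basis of `ℂ² = ℝ⁴`. -/
structure IsOrientedParam (B : Set (Fin 2 → ℂ)) (V : Set (Fin 3 → ℝ))
    (ψ : (Fin 3 → ℝ) → Fin 2 → ℂ) : Prop where
  isOpen : IsOpen V
  smooth : ContDiffOn ℝ ∞ ψ V
  injOn : Set.InjOn ψ V
  mapsTo : Set.MapsTo ψ V (frontier B)
  oriented : ∀ y ∈ V, ∃ n, IsOutward B (ψ y) n ∧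
    0 < (Matrix.of ![realCoords n, realCoords (tangentFrame ψ y 0),
      realCoords (tangentFrame ψ y 1), realCoords (tangentFrame ψ y 2)]).det

/-- `J = ∫_{∂B} Θ`, by the usual definition of the integral of a form over a compact oriented
manifold: `J = ∑_i ∫_{V_i} ψ_i^*(χ_i Θ)` for finitely many positively oriented parametrisations
`ψ_i : V_i → ∂B` and a smooth partition of unity `χ_i` on `∂B`, where the support of `χ_i` in
`∂B` lies in the image of a compact subset `C_i` of `V_i`. -/
def IsBoundaryIntegral (B : Set (Fin 2 → ℂ))
    (Θ : (Fin 2 → ℂ) → (Fin 3 → Fin 2 → ℂ) → ℂ) (J : ℂ) : Prop :=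
  ∃ (N : ℕ) (V C : Fin N → Set (Fin 3 → ℝ)) (ψ : Fin N → (Fin 3 → ℝ) → Fin 2 → ℂ)
    (χ : Fin N → (Fin 2 → ℂ) → ℝ),
    (∀ i, IsOrientedParam B (V i) (ψ i)) ∧
    (∀ i, IsCompact (C i) ∧ C i ⊆ V i) ∧
    (∀ i, ContDiff ℝ ∞ (χ i) ∧ ∀ p, 0 ≤ χ i p) ∧
    (∀ i, ∀ p ∈ frontier B, χ i p ≠ 0 → p ∈ ψ i '' C i) ∧
    (∀ p ∈ frontier B, ∑ i, χ i p = 1) ∧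
    J = ∑ i, ∫ y in V i, (χ i (ψ i y) : ℂ) * Θ (ψ i y) (tangentFrame (ψ i) y)

end DegenerateResidue

end

noncomputable section

open MeasureTheory Filter Set

namespace DegenerateResidue

/-! ### Weighted dilations of `ℂ²` -/

/-! The proof is a blow-up by the weighted dilations (u, v) ↦ (r²u, rv). At the dilated point both
coefficients of X are r² times those of X_r = u(a + rv)∂_u − v²∂_v (`sfield`). Let η_r be the form
with coefficients `sform`, so that η_r(X_r) = 1. The distorted sphere of radius r becomes a
hypersurface {m_r = 1} lying in a fixed annulus and depending smoothly on r up to r = 0 (`gaugeOf`,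
`contDiffAt_gaugeOf`), and the form pulls back to r⁻¹ φ(r²u, rv) η_r ∧ ∂̄η_r
(`wedgeCoeff_etaCoeff_dil`). Because of the factor r⁻¹, φ is expanded to first order, φ(0) + r φ_v v
+ r φ_v̄ v̄ + o(r); the u-derivatives only enter at order r².

The part φ(0) + r φ_v v is integrated exactly for each r (`levelIntegral_affine`). In dimension two,
forms dual to the same nonvanishing holomorphic field have η ∧ ∂̄η equal up to a ∂̄-exact term
(`wedgeCoeff_eq_add_dbr`), and multiplying by a holomorphic function of v keeps that term exact. The
metric can thus be traded for `modelForm`, which gives ω / (a + rv) with ω a closed kernel of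
Bochner–Martinelli type. Division by a + rv leaves multiples of ω, of vω and of v²ω / (a + rv). The
last is exact, ω integrates to 0 and vω to 4π² (`levelIntegral_model_zero`,
`levelIntegral_model_one`), so the result is r · 4π²(φ_v/a − φ(0)/a²) and the factor r cancels r⁻¹.

The φ_v̄ v̄ part is treated in the limit r → 0 by dominated convergence (`tendsto_remainder`). There
the metric is frozen at the origin and the symmetry (u, v) ↦ (−u, iv) makes the integral vanish.

Integrals over {m = 1} are handled as integrals over ℂ²: the form is pulled back along the dilations
and wedged with χ(m) dm for a bump χ of mass one (`levelIntegral`). Stokes' formula then becomes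
integration by parts for compactly supported functions. That every atlas and partition of unity
gives this number is `boundaryIntegral_eq`, a change of variables in the cone over each chart; eight
explicit charts give existence (`exists_boundaryIntegral`). -/

/-- The space `ℂ²`. -/
abbrev C2 := Fin 2 → ℂ

/-- The weighted dilation `(u, v) ↦ (t² u, t v)`. -/
def dil (t : ℝ) : C2 →L[ℝ] C2 :=
  ContinuousLinearMap.pi ![((t ^ 2 : ℝ) • (ContinuousLinearMap.proj 0 : C2 →L[ℝ] ℂ)),
    (t • (ContinuousLinearMap.proj 1 : C2 →L[ℝ] ℂ))]

@[simp] lemma dil_apply_zero (t : ℝ) (w : C2) : dil t w 0 = (t : ℂ) ^ 2 * w 0 := by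
  simp [dil]

@[simp] lemma dil_apply_one (t : ℝ) (w : C2) : dil t w 1 = (t : ℂ) * w 1 := by
  simp [dil]

attribute [irreducible] dil

lemma C2_ext {z w : C2} (h0 : z 0 = w 0) (h1 : z 1 = w 1) : z = w := by
  funext i; fin_cases i
  · exact h0
  · exact h1

lemma dil_dil (s t : ℝ) (w : C2) : dil s (dil t w) = dil (s * t) w := by
  apply C2_ext <;> simp <;> ring

@[simp] lemma dil_one (w : C2) : dil 1 w = w := by
  apply C2_ext <;> simp

lemma dil_inv_dil {t : ℝ} (ht : t ≠ 0) (w : C2) : dil t⁻¹ (dil t w) = w := by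
  rw [dil_dil, inv_mul_cancel₀ ht, dil_one]

lemma dil_ne_zero {t : ℝ} (ht : t ≠ 0) {w : C2} (hw : w ≠ 0) : dil t w ≠ 0 := by
  intro h
  apply hw
  rw [← dil_inv_dil ht w, h, map_zero]

/-- The generator of the weighted dilations. -/
def euler (w : C2) : C2 := ![2 * w 0, w 1]

@[simp] lemma euler_zero (w : C2) : euler w 0 = 2 * w 0 := rfl
@[simp] lemma euler_one (w : C2) : euler w 1 = w 1 := rfl

lemma hasDerivAt_dil {t : ℝ} (ht : t ≠ 0) (w : C2) :
    HasDerivAt (fun s : ℝ => dil s w) (t⁻¹ • dil t (euler w)) t := by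
  rw [hasDerivAt_pi]
  have h1 : HasDerivAt (fun s : ℝ => (s : ℂ)) 1 t := Complex.ofRealCLM.hasDerivAt
  have ht' : (t : ℂ) ≠ 0 := by exact_mod_cast ht
  intro i
  fin_cases i
  · simp only [Fin.zero_eta, dil_apply_zero, Pi.smul_apply, euler_zero]
    convert! (h1.pow 2).mul_const (w 0) using 1
    simp only [Complex.real_smul, Complex.ofReal_inv]
    field_simp
    simp
    ring
  · simp only [Fin.mk_one, dil_apply_one, Pi.smul_apply, euler_one]
    convert! h1.mul_const (w 1) using 1
    simp only [Complex.real_smul, Complex.ofReal_inv]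
    field_simp

lemma contDiff_dil : ContDiff ℝ ∞ (fun q : ℝ × C2 => dil q.1 q.2) := by
  rw [contDiff_pi]
  have h1 : ContDiff ℝ ∞ (fun q : ℝ × C2 => (q.1 : ℂ)) :=
    Complex.ofRealCLM.contDiff.comp contDiff_fst
  have h2 : ∀ i, ContDiff ℝ ∞ (fun q : ℝ × C2 => q.2 i) := fun i =>
    (contDiff_apply ℝ ℂ i).comp contDiff_snd
  intro i
  fin_cases i
  · simpa using (h1.pow 2).mul (h2 0)
  · simpa using h1.mul (h2 1)

lemma _root_.ContDiffAt.dil {X : Type*} [NormedAddCommGroup X] [NormedSpace ℝ X] {s : X → ℝ}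
    {f : X → C2} {x : X} (hs : ContDiffAt ℝ ∞ s x) (hf : ContDiffAt ℝ ∞ f x) :
    ContDiffAt ℝ ∞ (fun y => dil (s y) (f y)) x :=
  ContDiffAt.comp (g := fun q : ℝ × C2 => DegenerateResidue.dil q.1 q.2) x
    contDiff_dil.contDiffAt (hs.prodMk hf)

/-- The gauge `|u|² + |v|⁴`, homogeneous of degree `4`. -/
def quasi (w : C2) : ℝ := Complex.normSq (w 0) + Complex.normSq (w 1) ^ 2

lemma quasi_nonneg (w : C2) : 0 ≤ quasi w := by
  unfold quasi
  have := Complex.normSq_nonneg (w 0)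
  positivity

lemma quasi_pos {w : C2} (hw : w ≠ 0) : 0 < quasi w := by
  refine lt_of_le_of_ne (quasi_nonneg w) fun h => hw ?_
  have h0 := Complex.normSq_nonneg (w 0)
  have h1 := Complex.normSq_nonneg (w 1)
  unfold quasi at h
  have e0 : Complex.normSq (w 0) = 0 := by nlinarith [sq_nonneg (Complex.normSq (w 1))]
  have e1 : Complex.normSq (w 1) = 0 := by
    have : Complex.normSq (w 1) ^ 2 = 0 := by nlinarith
    exact pow_eq_zero_iff (two_ne_zero) |>.1 this
  exact C2_ext (by simpa using e0) (by simpa using e1)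

@[simp] lemma quasi_zero : quasi 0 = 0 := by simp [quasi]

lemma quasi_dil (t : ℝ) (w : C2) : quasi (dil t w) = t ^ 4 * quasi w := by
  simp [quasi, Complex.normSq_ofReal]; ring

lemma contDiff_coord (i : Fin 2) : ContDiff ℝ ∞ (fun w : C2 => w i) := contDiff_apply ℝ ℂ i

lemma contDiff_conj_coord (i : Fin 2) :
    ContDiff ℝ ∞ (fun w : C2 => (starRingEnd ℂ) (w i)) :=
  Complex.conjCLE.contDiff.comp (contDiff_coord i)

lemma quasi_eq (w : C2) : (quasi w : ℂ) =
    w 0 * (starRingEnd ℂ) (w 0) + (w 1 * (starRingEnd ℂ) (w 1)) ^ 2 := by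
  simp [quasi, Complex.mul_conj]

lemma contDiff_quasi_ofReal : ContDiff ℝ ∞ (fun w : C2 => (quasi w : ℂ)) := by
  simp only [quasi_eq]
  exact ((contDiff_coord 0).mul (contDiff_conj_coord 0)).add
    (((contDiff_coord 1).mul (contDiff_conj_coord 1)).pow 2)

lemma contDiff_quasi : ContDiff ℝ ∞ quasi := by
  have := Complex.reCLM.contDiff.comp contDiff_quasi_ofReal
  exact this

lemma continuous_quasi : Continuous quasi := contDiff_quasi.continuous

lemma norm_le_of_quasi {w : C2} {c : ℝ} (hc : 0 ≤ c) (h : quasi w ≤ c ^ 4) :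
    ‖w 0‖ ≤ c ^ 2 ∧ ‖w 1‖ ≤ c := by
  unfold quasi at h
  rw [Complex.normSq_eq_norm_sq, Complex.normSq_eq_norm_sq] at h
  constructor
  · apply le_of_sq_le_sq _ (by positivity)
    nlinarith [sq_nonneg (‖w 1‖ ^ 2)]
  · by_contra! hh
    have : c ^ 4 < ‖w 1‖ ^ 4 := pow_lt_pow_left₀ hh hc (by norm_num)
    nlinarith [sq_nonneg (‖w 0‖)]

lemma isCompact_quasi_Icc (a b : ℝ) : IsCompact {w : C2 | quasi w ∈ Icc a b} := by
  refine Metric.isCompact_of_isClosed_isBounded (isClosed_Icc.preimage continuous_quasi) ?_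
  rw [isBounded_iff_forall_norm_le]
  refine ⟨(1 + |b|) ^ 2, fun w hw => ?_⟩
  have hb := abs_nonneg b
  have h : quasi w ≤ (1 + |b|) ^ 4 := by
    refine hw.2.trans ?_
    have := le_abs_self b
    nlinarith [one_le_pow₀ (n := 3) (show 1 ≤ 1 + |b| by linarith)]
  obtain ⟨h0, h1⟩ := norm_le_of_quasi (by positivity) h
  rw [pi_norm_le_iff_of_nonneg (by positivity)]
  intro i
  fin_cases i
  · exact h0
  · refine h1.trans ?_
    nlinarith

/-! ### The antiholomorphic derivatives -/

/-- The `k`-th antiholomorphic component of a real-linear functional. -/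
def barPart (k : Fin 2) (l : C2 →L[ℝ] ℂ) : ℂ :=
  (l (Pi.single k 1) + Complex.I * l (Pi.single k Complex.I)) / 2

/-- The derivative `∂f/∂z̄^k`. -/
def dbr (k : Fin 2) (f : C2 → ℂ) (z : C2) : ℂ := barPart k (fderiv ℝ f z)

lemma dbr_congr {k : Fin 2} {f g : C2 → ℂ} {z : C2} (h : f =ᶠ[𝓝 z] g) :
    dbr k f z = dbr k g z := by
  rw [dbr, dbr, h.fderiv_eq]

lemma dbr_const (k : Fin 2) (c : ℂ) (z : C2) : dbr k (fun _ => c) z = 0 := by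
  simp [dbr, barPart]

lemma dbr_add {k : Fin 2} {f g : C2 → ℂ} {z : C2} (hf : DifferentiableAt ℝ f z)
    (hg : DifferentiableAt ℝ g z) :
    dbr k (fun w => f w + g w) z = dbr k f z + dbr k g z := by
  simp only [dbr, barPart, fderiv_fun_add hf hg, add_apply]; ring

lemma dbr_sub {k : Fin 2} {f g : C2 → ℂ} {z : C2} (hf : DifferentiableAt ℝ f z)
    (hg : DifferentiableAt ℝ g z) :
    dbr k (fun w => f w - g w) z = dbr k f z - dbr k g z := by
  simp only [dbr, barPart, fderiv_fun_sub hf hg, sub_apply]; ring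

lemma dbr_neg {k : Fin 2} {f : C2 → ℂ} {z : C2} :
    dbr k (fun w => - f w) z = - dbr k f z := by
  simp only [dbr, barPart, fderiv_fun_neg, neg_apply]; ring

lemma dbr_mul {k : Fin 2} {f g : C2 → ℂ} {z : C2} (hf : DifferentiableAt ℝ f z)
    (hg : DifferentiableAt ℝ g z) :
    dbr k (fun w => f w * g w) z = dbr k f z * g z + f z * dbr k g z := by
  simp only [dbr, barPart, fderiv_fun_mul hf hg, add_apply,
    smul_apply, smul_eq_mul]; ring

lemma dbr_comp {k : Fin 2} {f : C2 → ℂ} {h : ℂ → ℂ} {h' : ℂ} {z : C2}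
    (hf : DifferentiableAt ℝ f z) (hh : HasDerivAt h h' (f z)) :
    dbr k (fun w => h (f w)) z = h' * dbr k f z := by
  have h1 := hh.hasFDerivAt.restrictScalars ℝ |>.comp z hf.hasFDerivAt
  have h2 : fderiv ℝ (fun w => h (f w)) z = _ := h1.fderiv
  simp only [dbr, barPart, h2, ContinuousLinearMap.comp_apply,
    ContinuousLinearMap.coe_restrictScalars', ContinuousLinearMap.toSpanSingleton_apply,
    smul_eq_mul]
  ring

lemma dbr_inv {k : Fin 2} {f : C2 → ℂ} {z : C2} (hf : DifferentiableAt ℝ f z) (h0 : f z ≠ 0) :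
    dbr k (fun w => (f w)⁻¹) z = - dbr k f z / f z ^ 2 := by
  rw [dbr_comp (h := fun x => x⁻¹) hf (hasDerivAt_inv h0)]; ring

lemma dbr_comp_real {k : Fin 2} {m : C2 → ℝ} {h : ℝ → ℝ} {h' : ℝ} {z : C2}
    (hm : DifferentiableAt ℝ m z) (hh : HasDerivAt h h' (m z)) :
    dbr k (fun w => (h (m w) : ℂ)) z = h' * dbr k (fun w => (m w : ℂ)) z := by
  have h1 := Complex.ofRealCLM.hasFDerivAt.comp z (hh.hasFDerivAt.comp z hm.hasFDerivAt)
  have h2 := Complex.ofRealCLM.hasFDerivAt.comp z hm.hasFDerivAt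
  have e1 : fderiv ℝ (fun w => (h (m w) : ℂ)) z = _ := h1.fderiv
  have e2 : fderiv ℝ (fun w => (m w : ℂ)) z = _ := h2.fderiv
  simp only [dbr, barPart, e1, e2]
  simp
  ring

lemma dbr_coord (k i : Fin 2) (z : C2) : dbr k (fun w => w i) z = 0 := by
  have : fderiv ℝ (fun w : C2 => w i) z = ContinuousLinearMap.proj i :=
    (ContinuousLinearMap.proj (R := ℝ) (φ := fun _ : Fin 2 => ℂ) i).hasFDerivAt.fderiv
  rw [dbr, barPart, this]
  by_cases h : k = i
  · subst h; simp
  · simp [Ne.symm h]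

lemma dbr_conj_coord (k i : Fin 2) (z : C2) :
    dbr k (fun w => (starRingEnd ℂ) (w i)) z = if k = i then 1 else 0 := by
  have : fderiv ℝ (fun w : C2 => (starRingEnd ℂ) (w i)) z =
      (Complex.conjCLE : ℂ →L[ℝ] ℂ).comp (ContinuousLinearMap.proj i) :=
    ((Complex.conjCLE : ℂ →L[ℝ] ℂ).comp
      (ContinuousLinearMap.proj (R := ℝ) (φ := fun _ : Fin 2 => ℂ) i)).hasFDerivAt.fderiv
  rw [dbr, barPart, this]
  by_cases h : k = i
  · subst h; simp
  · simp [Ne.symm h, h]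

lemma dil_single_zero (t : ℝ) (c : ℂ) :
    dil t (Pi.single 0 c) = (t ^ 2) • (Pi.single 0 c : C2) := by
  apply C2_ext <;> simp

lemma dil_single_one (t : ℝ) (c : ℂ) :
    dil t (Pi.single 1 c) = t • (Pi.single 1 c : C2) := by
  apply C2_ext <;> simp

lemma barPart_comp_dil_zero (t : ℝ) (l : C2 →L[ℝ] ℂ) :
    barPart 0 (l.comp (dil t)) = (t : ℂ) ^ 2 * barPart 0 l := by
  simp only [barPart, ContinuousLinearMap.comp_apply, dil_single_zero, map_smul,
    Complex.real_smul]
  push_cast; ring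

lemma barPart_comp_dil_one (t : ℝ) (l : C2 →L[ℝ] ℂ) :
    barPart 1 (l.comp (dil t)) = (t : ℂ) * barPart 1 l := by
  simp only [barPart, ContinuousLinearMap.comp_apply, dil_single_one, map_smul,
    Complex.real_smul]
  ring

lemma dbr_comp_dil {t : ℝ} {f : C2 → ℂ} {z : C2} (hf : DifferentiableAt ℝ f (dil t z)) :
    dbr 0 (fun w => f (dil t w)) z = (t : ℂ) ^ 2 * dbr 0 f (dil t z) ∧
      dbr 1 (fun w => f (dil t w)) z = (t : ℂ) * dbr 1 f (dil t z) := by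
  have h : fderiv ℝ (fun w => f (dil t w)) z = (fderiv ℝ f (dil t z)).comp (dil t) :=
    (hf.hasFDerivAt.comp z (dil t).hasFDerivAt).fderiv
  exact ⟨by rw [dbr, dbr, h, barPart_comp_dil_zero], by rw [dbr, dbr, h, barPart_comp_dil_one]⟩

lemma continuousAt_dbr {f : C2 → ℂ} {z : C2} (hf : ContDiffAt ℝ ∞ f z) (k : Fin 2) :
    ContinuousAt (dbr k f) z := by
  have h : ContinuousAt (fderiv ℝ f) z := (hf.fderiv_right (m := 0) (by simp)).continuousAt
  unfold dbr barPart
  exact ((h.clm_apply continuousAt_const).add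
    (continuousAt_const.mul (h.clm_apply continuousAt_const))).div_const 2

lemma contDiffAt_dbr {f : C2 → ℂ} {z : C2} (hf : ContDiffAt ℝ ∞ f z) (k : Fin 2) :
    ContDiffAt ℝ ∞ (dbr k f) z := by
  have h : ContDiffAt ℝ ∞ (fderiv ℝ f) z := hf.fderiv_right (m := ∞) (by simp)
  unfold dbr barPart
  exact ((h.clm_apply contDiffAt_const).add
    (contDiffAt_const.mul (h.clm_apply contDiffAt_const))).div_const 2

lemma dbr_dbr_comm {f : C2 → ℂ} {z : C2} (hf : ContDiffAt ℝ ∞ f z) :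
    dbr 0 (dbr 1 f) z = dbr 1 (dbr 0 f) z := by
  have hs : IsSymmSndFDerivAt ℝ f z :=
    hf.isSymmSndFDerivAt (by
      simp only [minSmoothness_of_isRCLikeNormedField]; exact WithTop.coe_le_coe.2 (le_top : (2 : ℕ∞) ≤ ⊤))
  have hd : DifferentiableAt ℝ (fderiv ℝ f) z :=
    (hf.fderiv_right (m := ∞) (by simp)).differentiableAt (by simp)
  have key : ∀ k : Fin 2, ∀ h : C2, fderiv ℝ (dbr k f) z h =
      (fderiv ℝ (fderiv ℝ f) z h (Pi.single k 1) +
        Complex.I * fderiv ℝ (fderiv ℝ f) z h (Pi.single k Complex.I)) / 2 := by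
    intro k h
    have e : ∀ v : C2, HasFDerivAt (fun w => fderiv ℝ f w v)
        ((ContinuousLinearMap.apply ℝ ℂ v).comp (fderiv ℝ (fderiv ℝ f) z)) z := fun v =>
      (ContinuousLinearMap.apply ℝ ℂ v).hasFDerivAt.comp z hd.hasFDerivAt
    have e2 := (((e (Pi.single k 1)).add ((e (Pi.single k Complex.I)).const_mul Complex.I)).mul_const
      (2 : ℂ)⁻¹)
    have e3 : dbr k f = (fun y => ((fun w => fderiv ℝ f w (Pi.single k 1)) +
        fun w => Complex.I * fderiv ℝ f w (Pi.single k Complex.I)) y * (2 : ℂ)⁻¹) := by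
      funext y; simp [dbr, barPart, div_eq_mul_inv]
    rw [e3, e2.fderiv]
    simp
    ring
  have s := fun x y => hs.eq x y
  rw [dbr, barPart, key, key, dbr, barPart, key, key]
  rw [s (Pi.single 0 1) (Pi.single 1 1), s (Pi.single 0 1) (Pi.single 1 Complex.I),
    s (Pi.single 0 Complex.I) (Pi.single 1 1), s (Pi.single 0 Complex.I) (Pi.single 1 Complex.I)]
  ring

/-! ### Integrals of functions supported in an annulus -/

/-- All objects of the proof are singular at the origin only, so a factor that vanishes near the
origin restores regularity everywhere. -/
lemma contDiff_of_annulus {f : C2 → ℂ} {lo : ℝ} (hs : ∀ w ≠ 0, ContDiffAt ℝ ∞ f w)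
    (hlo : 0 < lo) (h0 : ∀ w, quasi w < lo → f w = 0) : ContDiff ℝ ∞ f := by
  rw [contDiff_iff_contDiffAt]
  intro w
  by_cases hw : w = 0
  · subst hw
    have : f =ᶠ[𝓝 0] fun _ => 0 := by
      have : ∀ᶠ w in 𝓝 (0 : C2), quasi w < lo :=
        continuous_quasi.continuousAt.eventually_lt continuousAt_const (by simpa using hlo)
      filter_upwards [this] with w hw using h0 w hw
    exact contDiffAt_const.congr_of_eventuallyEq this
  · exact hs w hw

lemma continuous_of_annulus {f : C2 → ℂ} {lo : ℝ} (hs : ∀ w ≠ 0, ContinuousAt f w)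
    (hlo : 0 < lo) (h0 : ∀ w, quasi w < lo → f w = 0) : Continuous f := by
  rw [continuous_iff_continuousAt]
  intro w
  by_cases hw : w = 0
  · subst hw
    have : f =ᶠ[𝓝 0] fun _ => 0 := by
      have : ∀ᶠ w in 𝓝 (0 : C2), quasi w < lo :=
        continuous_quasi.continuousAt.eventually_lt continuousAt_const (by simpa using hlo)
      filter_upwards [this] with w hw using h0 w hw
    exact continuousAt_const.congr this.symm
  · exact hs w hw

lemma hasCompactSupport_of_annulus {f : C2 → ℂ} {hi : ℝ}
    (h1 : ∀ w, hi < quasi w → f w = 0) : HasCompactSupport f := by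
  refine HasCompactSupport.intro (isCompact_quasi_Icc 0 hi) fun w hw => h1 w ?_
  by_contra! h
  exact hw ⟨quasi_nonneg w, h⟩

lemma integrable_of_annulus {f : C2 → ℂ} {lo hi : ℝ} (hs : ∀ w ≠ 0, ContinuousAt f w)
    (hlo : 0 < lo) (h0 : ∀ w, quasi w < lo → f w = 0)
    (h1 : ∀ w, hi < quasi w → f w = 0) : Integrable f :=
  (continuous_of_annulus hs hlo h0).integrable_of_hasCompactSupport
    (hasCompactSupport_of_annulus h1)

lemma integral_fderiv_apply_eq_zero {f : C2 → ℂ} (hf : ContDiff ℝ ∞ f)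
    (hc : HasCompactSupport f) (v : C2) :
    Integrable (fun w => fderiv ℝ f w v) ∧ ∫ w, fderiv ℝ f w v = 0 := by
  have hd : Continuous (fderiv ℝ f) := hf.continuous_fderiv (by simp)
  have hi : Integrable (fun w => fderiv ℝ f w v) := by
    refine (hd.clm_apply continuous_const).integrable_of_hasCompactSupport ?_
    exact (hc.fderiv ℝ).comp_left (g := fun l : C2 →L[ℝ] ℂ => l v) rfl
  refine ⟨hi, ?_⟩
  have hi' : Integrable f := hf.continuous.integrable_of_hasCompactSupport hc
  -- Integration by parts against the constant function 1.
  have := integral_smul_fderiv_eq_neg_fderiv_smul_of_integrable (μ := (volume : Measure C2))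
    (f := fun _ : C2 => (1 : ℂ)) (g := f) (v := v) (by simp) (by simpa using hi)
    (by simpa using hi') (fun _ _ => differentiableAt_const _)
    (fun x _ => (hf.differentiable (by simp)).differentiableAt)
  simpa using this

lemma integral_dbr_eq_zero {f : C2 → ℂ} (hf : ContDiff ℝ ∞ f)
    (hc : HasCompactSupport f) (k : Fin 2) :
    Integrable (dbr k f) ∧ ∫ w, dbr k f w = 0 := by
  obtain ⟨i1, e1⟩ := integral_fderiv_apply_eq_zero hf hc (Pi.single k 1)
  obtain ⟨i2, e2⟩ := integral_fderiv_apply_eq_zero hf hc (Pi.single k Complex.I)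
  unfold dbr barPart
  refine ⟨(i1.add (i2.const_mul _)).div_const 2, ?_⟩
  rw [integral_div, integral_add i1 (i2.const_mul _), integral_const_mul, e1, e2]
  simp

/-- Stokes' formula for a closed form `(P dū + Q dv̄) ∧ du ∧ dv` on `ℂ² \ {0}` and a cutoff. -/
lemma integral_closed_wedge_eq_zero {P Q S : C2 → ℂ} {lo hi : ℝ}
    (hP : ∀ w ≠ 0, ContDiffAt ℝ ∞ P w) (hQ : ∀ w ≠ 0, ContDiffAt ℝ ∞ Q w)
    (hPQ : ∀ w ≠ 0, dbr 1 P w = dbr 0 Q w) (hS : ∀ w ≠ 0, ContDiffAt ℝ ∞ S w)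
    (hlo : 0 < lo) (h0 : ∀ w, quasi w < lo → S w = 0) (h1 : ∀ w, hi < quasi w → S w = 0) :
    ∫ w, (P w * dbr 1 S w - Q w * dbr 0 S w) = 0 := by
  have key : ∀ T : C2 → ℂ, (∀ w ≠ 0, ContDiffAt ℝ ∞ T w) → ∀ k,
      Integrable (dbr k fun w => T w * S w) ∧ ∫ w, dbr k (fun w => T w * S w) w = 0 :=
    fun T hT k => integral_dbr_eq_zero
      (contDiff_of_annulus (fun w hw => (hT w hw).mul (hS w hw)) hlo
        (fun w hw => by rw [h0 w hw, mul_zero]))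
      (hasCompactSupport_of_annulus fun w hw => by rw [h1 w hw, mul_zero]) k
  obtain ⟨iP, eP⟩ := key P hP 1
  obtain ⟨iQ, eQ⟩ := key Q hQ 0
  -- By the Leibniz rule the integrand is ∂(PS)/∂v̄ − ∂(QS)/∂ū: closedness cancels the terms in
  -- which S is not differentiated. The origin, where P and Q may be singular, is a null set.
  have : ∫ w, (dbr 1 (fun w => P w * S w) w - dbr 0 (fun w => Q w * S w) w) = 0 := by
    rw [integral_sub iP iQ, eP, eQ, sub_zero]
  rw [← this]
  refine integral_congr_ae ?_
  have hne : ∀ᵐ w : C2, w ≠ 0 := by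
    simp [ae_iff]
  filter_upwards [hne] with w hw
  have d : ∀ {T : C2 → ℂ}, ContDiffAt ℝ ∞ T w → DifferentiableAt ℝ T w := fun h =>
    h.differentiableAt (by simp)
  rw [dbr_mul (d (hP w hw)) (d (hS w hw)), dbr_mul (d (hQ w hw)) (d (hS w hw)), hPQ w hw]
  ring

/-! ### The cutoff function -/

/-- A bump function on the line, supported in `[1, 3]`. -/
def cutoffBump : ContDiffBump (2 : ℝ) := ⟨1 / 2, 1, by norm_num, by norm_num⟩

/-- A smooth function supported in `[1, 3]` with integral `1`. -/
def cutoff : ℝ → ℝ := cutoffBump.normed volume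

lemma contDiff_cutoff : ContDiff ℝ ∞ cutoff := cutoffBump.contDiff_normed

lemma integral_cutoff : ∫ x, cutoff x = 1 := cutoffBump.integral_normed

lemma cutoff_eq_zero {x : ℝ} (hx : x ∉ Ioo (1 : ℝ) 3) : cutoff x = 0 := by
  by_contra h
  have : x ∈ Function.support cutoff := h
  rw [cutoff, ContDiffBump.support_normed_eq, Real.ball_eq_Ioo] at this
  apply hx
  simp only [cutoffBump] at this
  norm_num at this
  exact this

/-! ### Gauges -/

/-- A gauge: a smooth positive function on `ℂ² \ {0}`, homogeneous for the weighted dilations. -/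
structure IsGauge (m : C2 → ℝ) (c C : ℝ) : Prop where
  c_pos : 0 < c
  C_pos : 0 < C
  zero : m 0 = 0
  pos : ∀ w ≠ 0, 0 < m w
  smooth : ∀ w ≠ 0, ContDiffAt ℝ ∞ m w
  hom : ∀ t > 0, ∀ w, m (dil t w) = t * m w
  lower : ∀ w, c * quasi w ≤ m w ^ 4
  upper : ∀ w, m w ^ 4 ≤ C * quasi w

namespace IsGauge

variable {m : C2 → ℝ} {c C : ℝ}

lemma nonneg (hm : IsGauge m c C) (w : C2) : 0 ≤ m w := by
  by_cases hw : w = 0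
  · rw [hw, hm.zero]
  · exact (hm.pos w hw).le

/-- With `three_lt`, this confines the support of `cutoff ∘ m` to an annulus of `quasi` that depends
on c and C only, hence serves a whole family of gauges at once. -/
lemma lt_one (hm : IsGauge m c C) {w : C2} (hw : quasi w < 1 / C) : m w < 1 := by
  have h1 : m w ^ 4 < 1 := by
    refine (hm.upper w).trans_lt ?_
    rw [lt_div_iff₀ hm.C_pos] at hw
    linarith
  by_contra! h
  have := one_le_pow₀ (n := 4) h
  linarith

lemma three_lt (hm : IsGauge m c C) {w : C2} (hw : 81 / c < quasi w) : 3 < m w := by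
  have h1 : 81 < m w ^ 4 := by
    refine lt_of_lt_of_le ?_ (hm.lower w)
    rw [div_lt_iff₀ hm.c_pos] at hw
    linarith
  by_contra! h
  have := pow_le_pow_left₀ (hm.nonneg w) h 4
  linarith

lemma smooth_ofReal (hm : IsGauge m c C) {w : C2} (hw : w ≠ 0) :
    ContDiffAt ℝ ∞ (fun z => (m z : ℂ)) w :=
  Complex.ofRealCLM.contDiff.contDiffAt.comp w (hm.smooth w hw)

lemma diff_ofReal (hm : IsGauge m c C) {w : C2} (hw : w ≠ 0) :
    DifferentiableAt ℝ (fun z => (m z : ℂ)) w :=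
  (hm.smooth_ofReal hw).differentiableAt (by simp)

lemma diff (hm : IsGauge m c C) {w : C2} (hw : w ≠ 0) : DifferentiableAt ℝ m w :=
  (hm.smooth w hw).differentiableAt (by simp)

end IsGauge

/-- The projection to the level set `{m = 1}` along the dilations. -/
def gproj (m : C2 → ℝ) (w : C2) : C2 := dil (m w)⁻¹ w

namespace IsGauge

variable {m : C2 → ℝ} {c C : ℝ}

lemma gproj_ne_zero (hm : IsGauge m c C) {w : C2} (hw : w ≠ 0) : gproj m w ≠ 0 :=
  dil_ne_zero (inv_ne_zero (hm.pos w hw).ne') hw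

lemma gproj_eq_one (hm : IsGauge m c C) {w : C2} (hw : w ≠ 0) : m (gproj m w) = 1 := by
  rw [gproj, hm.hom _ (inv_pos.2 (hm.pos w hw)), inv_mul_cancel₀ (hm.pos w hw).ne']

lemma contDiffAt_gproj (hm : IsGauge m c C) {w : C2} (hw : w ≠ 0) :
    ContDiffAt ℝ ∞ (gproj m) w :=
  ((hm.smooth w hw).inv (hm.pos w hw).ne').dil contDiffAt_id

/-- The dilation factor 1/m also varies with w, and this contributes a rank-one term that is a
multiple of dm. The vector e is left unnamed because the term disappears after wedging with dm. -/
lemma hasFDerivAt_gproj (hm : IsGauge m c C) {w : C2} (hw : w ≠ 0) :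
    ∃ e : C2, HasFDerivAt (gproj m)
      (dil (m w)⁻¹ + (fderiv ℝ m w).smulRight e) w := by
  set t := (m w)⁻¹ with ht
  have hd : DifferentiableAt ℝ (fun q : ℝ × C2 => dil q.1 q.2) (t, w) :=
    contDiff_dil.contDiffAt.differentiableAt (by simp)
  set D := fderiv ℝ (fun q : ℝ × C2 => dil q.1 q.2) (t, w) with hD
  have h1 : HasFDerivAt (fun z => (m z)⁻¹) (-((m w) ^ 2)⁻¹ • fderiv ℝ m w) w :=
    (hasDerivAt_inv (hm.pos w hw).ne').comp_hasFDerivAt w (hm.diff hw).hasFDerivAt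
  have h2 := HasFDerivAt.comp (g := fun q : ℝ × C2 => dil q.1 q.2)
    (f := fun z => ((m z)⁻¹, id z)) w hd.hasFDerivAt (h1.prodMk (hasFDerivAt_id w))
  have e0 : ∀ h, D (0, h) = dil t h := by
    intro h
    have a := HasFDerivAt.comp (g := fun q : ℝ × C2 => dil q.1 q.2)
      (f := fun z => (t, id z)) w hd.hasFDerivAt ((hasFDerivAt_const t w).prodMk (hasFDerivAt_id w))
    have b := a.unique (dil t).hasFDerivAt
    have := congrArg (fun l : C2 →L[ℝ] C2 => l h) b
    simpa using this
  refine ⟨-((m w) ^ 2)⁻¹ • D (1, 0), ?_⟩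
  refine h2.congr_fderiv ?_
  ext1 h
  have e1 : ∀ x : ℝ, ∀ h : C2, D (x, h) = x • D (1, 0) + dil t h := by
    intro x h
    rw [← e0, ← map_smul, ← map_add]
    simp
  simp only [ContinuousLinearMap.comp_apply, ContinuousLinearMap.prod_apply,
    ContinuousLinearMap.coe_id', id, add_apply, ContinuousLinearMap.smulRight_apply]
  rw [← hD, e1, add_comm, smul_smul]
  congr 2
  simp
  ring

/-- The pullback by the projection, up to multiples of the differential of the gauge. -/
lemma dbr_comp_gproj (hm : IsGauge m c C) {w : C2} (hw : w ≠ 0) {f : C2 → ℂ}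
    (hf : DifferentiableAt ℝ f (gproj m w)) :
    ∃ Z : ℂ, dbr 0 (fun z => f (gproj m z)) w =
        ((m w : ℂ)⁻¹) ^ 2 * dbr 0 f (gproj m w) + Z * dbr 0 (fun z => (m z : ℂ)) w ∧
      dbr 1 (fun z => f (gproj m z)) w =
        (m w : ℂ)⁻¹ * dbr 1 f (gproj m w) + Z * dbr 1 (fun z => (m z : ℂ)) w := by
  obtain ⟨e, he⟩ := hm.hasFDerivAt_gproj hw
  refine ⟨fderiv ℝ f (gproj m w) e, ?_⟩
  have h1 : fderiv ℝ (fun z => f (gproj m z)) w = _ := (hf.hasFDerivAt.comp w he).fderiv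
  have h2 : fderiv ℝ (fun z => (m z : ℂ)) w = _ :=
    (Complex.ofRealCLM.hasFDerivAt.comp w (hm.diff hw).hasFDerivAt).fderiv
  have h3 : ∀ k, dbr k (fun z => f (gproj m z)) w =
      barPart k ((fderiv ℝ f (gproj m w)).comp (dil (m w)⁻¹)) +
        fderiv ℝ f (gproj m w) e * dbr k (fun z => (m z : ℂ)) w := by
    intro k
    rw [dbr, dbr, h1, h2]
    simp only [barPart, ContinuousLinearMap.comp_apply, add_apply, map_add,
      ContinuousLinearMap.smulRight_apply, map_smul, Complex.real_smul,
      Complex.ofRealCLM_apply]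
    ring
  rw [h3, h3, barPart_comp_dil_zero, barPart_comp_dil_one]
  simp [dbr]

end IsGauge

/-! ### The integral of a `(2,1)`-form over the level set of a gauge -/

/-- The density whose integral is the integral of `(P dū + Q dv̄) ∧ du ∧ dv`
over the level set `{m = 1}`. -/
def levelDensity (m : C2 → ℝ) (P Q : C2 → ℂ) (w : C2) : ℂ :=
  -- Coefficient of cutoff(m) dm ∧ π*Θ with π = `gproj m`. Modulo dm, π is the dilation by 1/m, so
  -- dū ∧ du ∧ dv acquires m⁻⁵ (weights 2, 2, 1) and dv̄ ∧ du ∧ dv acquires m⁻⁴. The factor −4 in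
  -- `levelIntegral` is the one of `form21_mul_apply`.
  (cutoff (m w) : ℂ) * ((m w : ℂ)⁻¹) ^ 5 *
    (P (gproj m w) * dbr 1 (fun z => (m z : ℂ)) w -
      m w * Q (gproj m w) * dbr 0 (fun z => (m z : ℂ)) w)

/-- The integral of `(P dū + Q dv̄) ∧ du ∧ dv` over the level set `{m = 1}`. -/
def levelIntegral (m : C2 → ℝ) (P Q : C2 → ℂ) : ℂ := -4 * ∫ w, levelDensity m P Q w

namespace IsGauge

variable {m : C2 → ℝ} {c C : ℝ}

lemma levelDensity_eq_zero_of_lt (hm : IsGauge m c C) (P Q : C2 → ℂ) {w : C2}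
    (hw : quasi w < 1 / C) : levelDensity m P Q w = 0 := by
  have := hm.lt_one hw
  rw [levelDensity, cutoff_eq_zero (fun h => absurd h.1 (by linarith))]
  simp

lemma levelDensity_eq_zero_of_gt (hm : IsGauge m c C) (P Q : C2 → ℂ) {w : C2}
    (hw : 81 / c < quasi w) : levelDensity m P Q w = 0 := by
  have := hm.three_lt hw
  rw [levelDensity, cutoff_eq_zero (fun h => absurd h.2 (by linarith))]
  simp

lemma continuousAt_levelDensity (hm : IsGauge m c C) {P Q : C2 → ℂ} {w : C2} (hw : w ≠ 0)
    (hP : ContinuousAt P (gproj m w)) (hQ : ContinuousAt Q (gproj m w)) :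
    ContinuousAt (levelDensity m P Q) w := by
  have h1 := (hm.smooth_ofReal hw).continuousAt
  have h2 : ContinuousAt (fun z => (cutoff (m z) : ℂ)) w :=
    (Complex.continuous_ofReal.comp contDiff_cutoff.continuous).continuousAt.comp
      (hm.smooth w hw).continuousAt
  have h3 := (hm.contDiffAt_gproj hw).continuousAt
  have h4 : ContinuousAt (fun z => P (gproj m z)) w := ContinuousAt.comp hP h3
  have h5 : ContinuousAt (fun z => Q (gproj m z)) w := ContinuousAt.comp hQ h3
  have hne : (m w : ℂ) ≠ 0 := by exact_mod_cast (hm.pos w hw).ne'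
  exact (h2.mul ((h1.inv₀ hne).pow 5)).mul
    ((h4.mul (continuousAt_dbr (hm.smooth_ofReal hw) 1)).sub
      ((h1.mul h5).mul (continuousAt_dbr (hm.smooth_ofReal hw) 0)))

lemma integrable_levelDensity (hm : IsGauge m c C) {P Q : C2 → ℂ}
    (hP : ∀ p ≠ 0, m p = 1 → ContinuousAt P p) (hQ : ∀ p ≠ 0, m p = 1 → ContinuousAt Q p) :
    Integrable (levelDensity m P Q) :=
  integrable_of_annulus
    (fun _ hw => hm.continuousAt_levelDensity hw (hP _ (hm.gproj_ne_zero hw) (hm.gproj_eq_one hw))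
      (hQ _ (hm.gproj_ne_zero hw) (hm.gproj_eq_one hw)))
    (one_div_pos.2 hm.C_pos) (fun _ => hm.levelDensity_eq_zero_of_lt P Q)
    (fun _ => hm.levelDensity_eq_zero_of_gt P Q)

lemma levelIntegral_congr (hm : IsGauge m c C) {P Q P' Q' : C2 → ℂ}
    (hP : ∀ p ≠ 0, m p = 1 → P p = P' p) (hQ : ∀ p ≠ 0, m p = 1 → Q p = Q' p) :
    levelIntegral m P Q = levelIntegral m P' Q' := by
  have hne : ∀ᵐ w : C2, w ≠ 0 := by simp [ae_iff]
  rw [levelIntegral, levelIntegral]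
  congr 1
  refine integral_congr_ae ?_
  filter_upwards [hne] with w hw
  rw [levelDensity, levelDensity, hP _ (hm.gproj_ne_zero hw) (hm.gproj_eq_one hw),
    hQ _ (hm.gproj_ne_zero hw) (hm.gproj_eq_one hw)]

lemma levelIntegral_add (hm : IsGauge m c C) {P Q P' Q' : C2 → ℂ}
    (hP : ∀ p ≠ 0, m p = 1 → ContinuousAt P p) (hQ : ∀ p ≠ 0, m p = 1 → ContinuousAt Q p)
    (hP' : ∀ p ≠ 0, m p = 1 → ContinuousAt P' p) (hQ' : ∀ p ≠ 0, m p = 1 → ContinuousAt Q' p) :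
    levelIntegral m (fun w => P w + P' w) (fun w => Q w + Q' w) =
      levelIntegral m P Q + levelIntegral m P' Q' := by
  rw [levelIntegral, levelIntegral, levelIntegral, ← mul_add,
    ← integral_add (hm.integrable_levelDensity hP hQ) (hm.integrable_levelDensity hP' hQ')]
  congr 2
  funext w
  simp only [levelDensity]
  ring

end IsGauge

lemma levelIntegral_const_mul (m : C2 → ℝ) (a : ℂ) (P Q : C2 → ℂ) :
    levelIntegral m (fun w => a * P w) (fun w => a * Q w) = a * levelIntegral m P Q := by
  have h : levelDensity m (fun w => a * P w) (fun w => a * Q w) =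
      fun w => a * levelDensity m P Q w := by
    funext w
    simp only [levelDensity]
    ring
  rw [levelIntegral, levelIntegral, h, integral_const_mul]
  ring

namespace IsGauge

variable {m : C2 → ℝ} {c C : ℝ}

/-- Stokes' formula on the level set: the integral of `∂̄f ∧ du ∧ dv` vanishes. -/
lemma levelIntegral_dbr (hm : IsGauge m c C) {f : C2 → ℂ}
    (hf : ∀ p ≠ 0, m p = 1 → ContDiffAt ℝ ∞ f p) :
    levelIntegral m (dbr 0 f) (dbr 1 f) = 0 := by
  -- The exponent 3 is the weight 2 + 1 of du ∧ dv.
  set h : ℝ → ℝ := fun x => cutoff x * (x⁻¹) ^ 3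
  have hh : ∀ x : ℝ, 0 < x → ContDiffAt ℝ ∞ h x := fun x hx =>
    contDiff_cutoff.contDiffAt.mul ((contDiffAt_id.inv hx.ne').pow 3)
  set b : C2 → ℂ := fun w => (h (m w) : ℂ) * f (gproj m w)
  have hfg : ∀ w ≠ 0, ContDiffAt ℝ ∞ (fun z => f (gproj m z)) w := fun w hw =>
    ContDiffAt.comp w (hf _ (hm.gproj_ne_zero hw) (hm.gproj_eq_one hw)) (hm.contDiffAt_gproj hw)
  have hhm : ∀ w ≠ 0, ContDiffAt ℝ ∞ (fun z => (h (m z) : ℂ)) w := fun w hw =>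
    Complex.ofRealCLM.contDiff.contDiffAt.comp w
      (ContDiffAt.comp w (hh _ (hm.pos w hw)) (hm.smooth w hw))
  -- The closed form is ∂̄m itself. In ∂̄m ∧ ∂̄(h(m) · f∘π) every multiple of ∂̄m drops out, and
  -- what remains is minus the level density of ∂̄f.
  have key := integral_closed_wedge_eq_zero (P := dbr 0 (fun z => (m z : ℂ)))
    (Q := dbr 1 (fun z => (m z : ℂ))) (S := b) (lo := 1 / C) (hi := 81 / c)
    (fun w hw => contDiffAt_dbr (hm.smooth_ofReal hw) 0)
    (fun w hw => contDiffAt_dbr (hm.smooth_ofReal hw) 1)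
    (fun w hw => (dbr_dbr_comm (hm.smooth_ofReal hw)).symm)
    (fun w hw => (hhm w hw).mul (hfg w hw)) (one_div_pos.2 hm.C_pos)
    (fun w hw => by
      have := hm.lt_one hw
      simp [b, h, cutoff_eq_zero (x := m w) (fun h => absurd h.1 (by linarith))])
    (fun w hw => by
      have := hm.three_lt hw
      simp [b, h, cutoff_eq_zero (x := m w) (fun h => absurd h.2 (by linarith))])
  have hne : ∀ᵐ w : C2, w ≠ 0 := by simp [ae_iff]
  rw [levelIntegral, mul_eq_zero]
  right
  rw [← neg_eq_zero, ← integral_neg, ← key]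
  refine integral_congr_ae ?_
  filter_upwards [hne] with w hw
  obtain ⟨Z, z0, z1⟩ := hm.dbr_comp_gproj hw (f := f)
    ((hf _ (hm.gproj_ne_zero hw) (hm.gproj_eq_one hw)).differentiableAt (by simp))
  have d1 := (hhm w hw).differentiableAt (n := ∞) (by simp)
  have d2 := (hfg w hw).differentiableAt (n := ∞) (by simp)
  have d3 : HasDerivAt h (deriv h (m w)) (m w) :=
    ((hh _ (hm.pos w hw)).differentiableAt (by simp)).hasDerivAt
  have hne' : (m w : ℂ) ≠ 0 := by exact_mod_cast (hm.pos w hw).ne'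
  simp only [b]
  rw [dbr_mul d1 d2, dbr_mul d1 d2, dbr_comp_real (hm.diff hw) d3, dbr_comp_real (hm.diff hw) d3,
    z0, z1]
  simp only [levelDensity, h]
  push_cast
  field_simp
  ring

end IsGauge

/-! ### Primitives of cutoff functions -/

section Primitive

variable {γ : ℝ → ℝ}

lemma hasDerivAt_primitive (hγ : Continuous γ) (x : ℝ) :
    HasDerivAt (fun x => ∫ t in (0 : ℝ)..x, γ t) (γ x) x :=
  intervalIntegral.integral_hasDerivAt_right (hγ.intervalIntegrable _ _)
    hγ.stronglyMeasurable.stronglyMeasurableAtFilter hγ.continuousAt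

lemma contDiff_primitive (hγ : ContDiff ℝ ∞ γ) :
    ContDiff ℝ ∞ (fun x => ∫ t in (0 : ℝ)..x, γ t) := by
  rw [contDiff_infty_iff_deriv]
  refine ⟨fun x => (hasDerivAt_primitive hγ.continuous x).differentiableAt, ?_⟩
  have : deriv (fun x => ∫ t in (0 : ℝ)..x, γ t) = γ :=
    funext fun x => (hasDerivAt_primitive hγ.continuous x).deriv
  rwa [this]

lemma primitive_eq_zero (h0 : ∀ x ∉ Ioo (1 : ℝ) 3, γ x = 0) {x : ℝ} (hx : x ≤ 1) :
    ∫ t in (0 : ℝ)..x, γ t = 0 := by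
  apply intervalIntegral.integral_zero_ae
  refine Eventually.of_forall fun t ht => h0 t fun h => ?_
  have : t ≤ max 0 x := ht.2
  have : t ≤ 1 := this.trans (max_le (by norm_num) hx)
  linarith [h.1]

lemma primitive_eq_const (h0 : ∀ x ∉ Ioo (1 : ℝ) 3, γ x = 0) {x : ℝ} (hx : 3 ≤ x) :
    ∫ t in (0 : ℝ)..x, γ t = ∫ t, γ t := by
  apply intervalIntegral.integral_eq_integral_of_support_subset
  intro t ht
  by_contra h
  exact ht (h0 t fun h' => h ⟨by linarith [h'.1], by linarith [h'.2]⟩)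

end Primitive

/-- The integral of a closed form against the differential of a cutoff does not depend on the
gauge. -/
lemma IsGauge.integral_closed_eq {m : C2 → ℝ} {c C : ℝ} (hm : IsGauge m c C) {γ : ℝ → ℝ}
    (hγ : ContDiff ℝ ∞ γ) (h0 : ∀ x ∉ Ioo (1 : ℝ) 3, γ x = 0) {P Q : C2 → ℂ}
    (hP : ∀ w ≠ 0, ContDiffAt ℝ ∞ P w) (hQ : ∀ w ≠ 0, ContDiffAt ℝ ∞ Q w)
    (hPQ : ∀ w ≠ 0, dbr 1 P w = dbr 0 Q w) :
    ∫ w, (γ (m w) : ℂ) * (P w * dbr 1 (fun z => (m z : ℂ)) w -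
        Q w * dbr 0 (fun z => (m z : ℂ)) w) =
      ∫ w, (γ (quasi w) : ℂ) * (P w * dbr 1 (fun z => (quasi z : ℂ)) w -
        Q w * dbr 0 (fun z => (quasi z : ℂ)) w) := by
  set R : ℝ → ℝ := fun x => ∫ t in (0 : ℝ)..x, γ t with hR
  have dR : ∀ x, HasDerivAt R (γ x) x := hasDerivAt_primitive hγ.continuous
  have sR : ContDiff ℝ ∞ R := contDiff_primitive hγ
  have s1 : ∀ w ≠ 0, ContDiffAt ℝ ∞ (fun z => (R (m z) : ℂ)) w := fun w hw =>
    Complex.ofRealCLM.contDiff.contDiffAt.comp w (sR.contDiffAt.comp w (hm.smooth w hw))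
  have s2 : ContDiff ℝ ∞ (fun z => (R (quasi z) : ℂ)) :=
    Complex.ofRealCLM.contDiff.comp (sR.comp contDiff_quasi)
  -- ∂̄ of R(m) − R(quasi) is the difference of the two integrands' differentials. It is an
  -- admissible cutoff: both primitives are 0 where m and `quasi` are at most 1, and both equal the
  -- total integral of γ where these are at least 3.
  have key := integral_closed_wedge_eq_zero (S := fun w => (R (m w) : ℂ) - R (quasi w))
    (lo := min (1 / C) 1) (hi := max (81 / c) 3) hP hQ hPQ
    (fun w hw => (s1 w hw).sub s2.contDiffAt) (lt_min (one_div_pos.2 hm.C_pos) one_pos)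
    (fun w hw => by
      have h1 := hm.lt_one (hw.trans_le (min_le_left _ _))
      have h2 : quasi w < 1 := hw.trans_le (min_le_right _ _)
      simp only [hR, primitive_eq_zero h0 h1.le, primitive_eq_zero h0 h2.le, sub_self])
    (fun w hw => by
      have h1 := hm.three_lt ((le_max_left _ _).trans_lt hw)
      have h2 : 3 < quasi w := (le_max_right _ _).trans_lt hw
      simp only [hR, primitive_eq_const h0 h1.le, primitive_eq_const h0 h2.le, sub_self])
  rw [← sub_eq_zero, ← integral_sub, ← key]
  · refine integral_congr_ae ?_
    have hne : ∀ᵐ w : C2, w ≠ 0 := by simp [ae_iff]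
    filter_upwards [hne] with w hw
    have dq : DifferentiableAt ℝ quasi w := contDiff_quasi.contDiffAt.differentiableAt (by simp)
    have e : ∀ k, dbr k (fun z => (R (m z) : ℂ) - R (quasi z)) w =
        γ (m w) * dbr k (fun z => (m z : ℂ)) w -
          γ (quasi w) * dbr k (fun z => (quasi z : ℂ)) w := fun k => by
      rw [dbr_sub ((s1 w hw).differentiableAt (by simp))
        (s2.contDiffAt.differentiableAt (by simp)), dbr_comp_real (hm.diff hw) (dR _),
        dbr_comp_real dq (dR _)]
    rw [e, e]
    ring
  · have cγ : ∀ w ≠ 0, ContinuousAt (fun z => (γ (m z) : ℂ)) w := fun w hw =>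
      (Complex.continuous_ofReal.comp hγ.continuous).continuousAt.comp
        (hm.smooth w hw).continuousAt
    refine integrable_of_annulus (lo := 1 / C) (hi := 81 / c) (fun w hw => (cγ w hw).mul
      (((hP w hw).continuousAt.mul (continuousAt_dbr (hm.smooth_ofReal hw) 1)).sub
        ((hQ w hw).continuousAt.mul (continuousAt_dbr (hm.smooth_ofReal hw) 0))))
      (one_div_pos.2 hm.C_pos) (fun w hw => ?_) (fun w hw => ?_)
    · have := hm.lt_one hw
      simp [h0 (m w) (fun h => absurd h.1 (by linarith))]
    · have := hm.three_lt hw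
      simp [h0 (m w) (fun h => absurd h.2 (by linarith))]
  · have cγ : Continuous (fun z => (γ (quasi z) : ℂ)) :=
      Complex.continuous_ofReal.comp (hγ.continuous.comp continuous_quasi)
    refine integrable_of_annulus (lo := 1) (hi := 3) (fun w hw => cγ.continuousAt.mul
      (((hP w hw).continuousAt.mul (continuousAt_dbr contDiff_quasi_ofReal.contDiffAt 1)).sub
        ((hQ w hw).continuousAt.mul (continuousAt_dbr contDiff_quasi_ofReal.contDiffAt 0))))
      one_pos (fun w hw => ?_) (fun w hw => ?_)
    · simp [h0 (quasi w) (fun h => absurd h.1 (by linarith))]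
    · simp [h0 (quasi w) (fun h => absurd h.2 (by linarith))]

/-! ### The model form -/

/-- The `dū`-coefficient of the model form `(-v̄² dū + 2 ū v̄ dv̄) ∧ du ∧ dv / (|u|² + |v|⁴)²`. -/
def modelP (w : C2) : ℂ := -((starRingEnd ℂ) (w 1)) ^ 2 / (quasi w : ℂ) ^ 2

/-- The `dv̄`-coefficient of the model form. -/
def modelQ (w : C2) : ℂ :=
  2 * (starRingEnd ℂ) (w 0) * (starRingEnd ℂ) (w 1) / (quasi w : ℂ) ^ 2

lemma contDiffAt_div {X : Type*} [NormedAddCommGroup X] [NormedSpace ℝ X] {f g : X → ℂ} {x : X}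
    (hf : ContDiffAt ℝ ∞ f x) (hg : ContDiffAt ℝ ∞ g x) (h0 : g x ≠ 0) :
    ContDiffAt ℝ ∞ (fun y => f y / g y) x := by
  simp only [div_eq_mul_inv]
  exact hf.mul (hg.inv h0)

lemma quasi_ofReal_ne_zero {w : C2} (hw : w ≠ 0) : (quasi w : ℂ) ≠ 0 := by
  exact_mod_cast (quasi_pos hw).ne'

lemma contDiffAt_modelP {w : C2} (hw : w ≠ 0) : ContDiffAt ℝ ∞ modelP w :=
  contDiffAt_div ((contDiff_conj_coord 1).contDiffAt.pow 2).neg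
    (contDiff_quasi_ofReal.contDiffAt.pow 2) (pow_ne_zero 2 (quasi_ofReal_ne_zero hw))

lemma contDiffAt_modelQ {w : C2} (hw : w ≠ 0) : ContDiffAt ℝ ∞ modelQ w :=
  contDiffAt_div ((contDiff_const.mul (contDiff_conj_coord 0)).mul
    (contDiff_conj_coord 1)).contDiffAt (contDiff_quasi_ofReal.contDiffAt.pow 2) (pow_ne_zero 2 (quasi_ofReal_ne_zero hw))

lemma differentiableAt_coord (i : Fin 2) (w : C2) : DifferentiableAt ℝ (fun z : C2 => z i) w :=
  (contDiff_coord i).contDiffAt.differentiableAt (by simp)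

lemma differentiableAt_conj_coord (i : Fin 2) (w : C2) :
    DifferentiableAt ℝ (fun z : C2 => (starRingEnd ℂ) (z i)) w :=
  (contDiff_conj_coord i).contDiffAt.differentiableAt (by simp)

lemma differentiableAt_quasi_ofReal (w : C2) :
    DifferentiableAt ℝ (fun z : C2 => (quasi z : ℂ)) w :=
  contDiff_quasi_ofReal.contDiffAt.differentiableAt (by simp)

lemma dbr_pow {k : Fin 2} {f : C2 → ℂ} {z : C2} (n : ℕ) (hf : DifferentiableAt ℝ f z) :
    dbr k (fun w => f w ^ n) z = n * f z ^ (n - 1) * dbr k f z :=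
  dbr_comp (h := fun x => x ^ n) hf (hasDerivAt_pow n (f z))

lemma dbr_div {k : Fin 2} {f g : C2 → ℂ} {z : C2} (hf : DifferentiableAt ℝ f z)
    (hg : DifferentiableAt ℝ g z) (h0 : g z ≠ 0) :
    dbr k (fun w => f w / g w) z = (dbr k f z * g z - f z * dbr k g z) / g z ^ 2 := by
  simp only [div_eq_mul_inv]
  rw [dbr_mul hf (hg.fun_inv h0), dbr_inv hg h0]
  field_simp
  ring

lemma dbr_quasi (w : C2) : dbr 0 (fun z => (quasi z : ℂ)) w = w 0 ∧
    dbr 1 (fun z => (quasi z : ℂ)) w = 2 * w 1 ^ 2 * (starRingEnd ℂ) (w 1) := by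
  have d0 := (differentiableAt_coord 0 w).fun_mul (differentiableAt_conj_coord 0 w)
  have d1 := (differentiableAt_coord 1 w).fun_mul (differentiableAt_conj_coord 1 w)
  simp only [quasi_eq]
  constructor
  · rw [dbr_add d0 (d1.fun_pow 2), dbr_pow 2 d1, dbr_mul (differentiableAt_coord 0 w)
      (differentiableAt_conj_coord 0 w), dbr_mul (differentiableAt_coord 1 w)
      (differentiableAt_conj_coord 1 w)]
    simp [dbr_coord, dbr_conj_coord]
  · rw [dbr_add d0 (d1.fun_pow 2), dbr_pow 2 d1, dbr_mul (differentiableAt_coord 0 w)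
      (differentiableAt_conj_coord 0 w), dbr_mul (differentiableAt_coord 1 w)
      (differentiableAt_conj_coord 1 w)]
    simp [dbr_coord, dbr_conj_coord]
    ring

/-- Where v ≠ 0 the model form is −v⁻² ∂̄(ū/`quasi`) ∧ du ∧ dv, which explains its closedness; the
direct computation also covers v = 0. -/
lemma dbr_model {w : C2} (hw : w ≠ 0) : dbr 1 modelP w = dbr 0 modelQ w := by
  have hN := quasi_ofReal_ne_zero hw
  have dN := differentiableAt_quasi_ofReal w
  have c0 := differentiableAt_conj_coord 0 w
  have c1 := differentiableAt_conj_coord 1 w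
  have cc : DifferentiableAt ℝ
    (fun z : C2 => 2 * (starRingEnd ℂ) (z 0)) w := c0.const_mul 2
  unfold modelP modelQ
  rw [dbr_div (f := fun z : C2 => -((starRingEnd ℂ) (z 1)) ^ 2) (c1.fun_pow 2).fun_neg (dN.fun_pow 2)
    (pow_ne_zero 2 hN), dbr_div (cc.fun_mul c1) (dN.fun_pow 2)
    (pow_ne_zero 2 hN), dbr_neg, dbr_pow 2 dN, dbr_pow 2 dN, dbr_pow 2 c1,
    dbr_mul cc c1, dbr_mul (differentiableAt_const _) c0, dbr_const, (dbr_quasi w).1,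
    (dbr_quasi w).2]
  simp [dbr_conj_coord]
  field_simp
  rw [quasi_eq]
  ring

/-! ### The symmetry of order four -/

/-- The rotation `(u, v) ↦ (-u, i v)`. -/
def rot : C2 →L[ℝ] C2 :=
  ContinuousLinearMap.pi ![-(ContinuousLinearMap.proj 0 : C2 →L[ℝ] ℂ),
    (Complex.I • (ContinuousLinearMap.proj 1 : C2 →L[ℝ] ℂ))]

@[simp] lemma rot_apply_zero (w : C2) : rot w 0 = -w 0 := by simp [rot]

@[simp] lemma rot_apply_one (w : C2) : rot w 1 = Complex.I * w 1 := by simp [rot]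

attribute [irreducible] rot

lemma quasi_rot (w : C2) : quasi (rot w) = quasi w := by simp [quasi]

lemma measurePreserving_rot : MeasurePreserving rot := by
  have h : ∀ i : Fin 2, MeasurePreserving
      ((![rotation (-1), rotation ⟨Complex.I, by simp [Submonoid.unitSphere]⟩] :
        Fin 2 → (ℂ ≃ₗᵢ[ℝ] ℂ)) i) := fun i => LinearIsometryEquiv.measurePreserving _
  have := volume_preserving_pi h
  convert! this using 1
  funext w
  apply C2_ext
  · simp
  · simp
    rfl

lemma integral_comp_rot (f : C2 → ℂ) : ∫ w, f (rot w) = ∫ w, f w := by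
  refine measurePreserving_rot.integral_comp
    (rot.continuous.measurableEmbedding fun z w h => ?_) f
  have h0 := congrFun h 0
  have h1 := congrFun h 1
  simp at h0 h1
  exact C2_ext h0 h1

lemma rot_ne_zero {w : C2} (hw : w ≠ 0) : rot w ≠ 0 := by
  intro h
  apply hw
  have h0 := congrFun h 0
  have h1 := congrFun h 1
  simp at h0 h1
  exact C2_ext h0 h1

/-! ### An explicit integral -/

lemma integral_Ioi_deriv {A a : ℝ → ℝ} {T : ℝ} (ha : Continuous a) (hA : Continuous A)
    (hd : ∀ x > 0, HasDerivAt A (a x) x) (h0 : ∀ x > T, a x = 0) {L : ℝ}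
    (hL : ∀ x > T, A x = L) : ∫ x in Ioi (0 : ℝ), a x = L - A 0 := by
  refine integral_Ioi_of_hasDerivAt_of_tendsto hA.continuousWithinAt hd ?_ ?_
  · have h1 : IntegrableOn a (Icc 0 (max T 0)) := ha.continuousOn.integrableOn_Icc
    refine (h1.of_forall_sdiff_eq_zero (t := Ioi 0) measurableSet_Ioi fun x hx => ?_)
    refine h0 x ?_
    by_contra! h
    exact hx.2 ⟨le_of_lt hx.1, h.trans (le_max_left _ _)⟩
  · refine tendsto_const_nhds.congr' ?_
    filter_upwards [eventually_gt_atTop T] with x hx using (hL x hx).symm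

lemma integral_radial (f : ℝ → ℝ) :
    ∫ z : ℂ, f ‖z‖ = 2 * Real.pi * ∫ y in Ioi (0 : ℝ), y * f y := by
  have h := integral_fun_norm_addHaar (μ := (volume : Measure ℂ)) f
  rw [h]
  simp [Complex.finrank_real_complex, Measure.real]
  ring

/-- Polar coordinates in u and then in v reduce the integral to π² ∫ K(x) dx over x > 0, where K' =
−cutoff(x)/x and K vanishes beyond 3. Integration by parts turns this into π² ∫ cutoff. -/
lemma integral_model :
    ∫ w : C2, cutoff (quasi w) * (quasi w)⁻¹ * (2 * Complex.normSq (w 1)) = Real.pi ^ 2 := by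
  set h : ℝ → ℝ := fun x => cutoff x * x⁻¹ with hdef
  have h0 : ∀ x ∉ Ioo (1 : ℝ) 3, h x = 0 := fun x hx => by simp [hdef, cutoff_eq_zero hx]
  have hc : Continuous h := by
    rw [continuous_iff_continuousAt]
    intro x
    by_cases hx : x = 0
    · subst hx
      refine continuousAt_const.congr (f := fun _ => (0 : ℝ)) ?_
      filter_upwards [eventually_lt_nhds (show (0 : ℝ) < 1 by norm_num)] with x hx
      exact (h0 x fun h => by linarith [h.1]).symm
    · exact contDiff_cutoff.continuous.continuousAt.mul (continuousAt_inv₀ hx)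
  -- The primitive of −h normalised to vanish for x ≥ 3.
  set K : ℝ → ℝ := fun x => (∫ t, h t) - ∫ t in (0 : ℝ)..x, h t with hK
  have dK : ∀ x, HasDerivAt K (-h x) x := fun x => (hasDerivAt_primitive hc x).const_sub _
  have cK : Continuous K := continuous_iff_continuousAt.2 fun x => (dK x).continuousAt
  have K3 : ∀ x ≥ 3, K x = 0 := fun x hx => by
    simp only [hK, primitive_eq_const h0 hx, sub_self]
  have cut0 : ∀ x ∉ Ioo (1 : ℝ) 3, cutoff x = 0 := fun x hx => cutoff_eq_zero hx
  have inner : ∀ s : ℝ, 0 ≤ s → ∫ z : ℂ, h (‖z‖ ^ 2 + s) = Real.pi * K s := by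
    intro s hs
    rw [integral_radial (fun y => h (y ^ 2 + s)),
      integral_Ioi_deriv (A := fun y => -(1 / 2) * K (y ^ 2 + s)) (T := 3) (L := 0)]
    · simp; ring
    · exact continuous_id.mul (hc.comp (by fun_prop))
    · exact continuous_const.mul (cK.comp (by fun_prop))
    · intro y _
      have := ((dK (y ^ 2 + s)).comp y (((hasDerivAt_id y).pow 2).add_const s)).const_mul
        (-(1 / 2))
      refine this.congr_deriv ?_
      simp; ring
    · intro y hy
      rw [h0 _ (fun h => ?_), mul_zero]
      nlinarith [h.2]
    · intro y hy
      rw [K3 _ (by nlinarith), mul_zero]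
  have outer : ∫ z : ℂ, 2 * ‖z‖ ^ 2 * (Real.pi * K (‖z‖ ^ 4)) = Real.pi ^ 2 := by
    -- The antiderivative comes from (xK)' = K − xh = K − cutoff at x = y⁴.
    rw [integral_radial (fun y => 2 * y ^ 2 * (Real.pi * K (y ^ 4))),
      integral_Ioi_deriv
        (A := fun y => Real.pi / 2 * (y ^ 4 * K (y ^ 4) + ∫ t in (0 : ℝ)..y ^ 4, cutoff t))
        (T := 3) (L := Real.pi / 2)]
    · simp; ring
    · fun_prop
    · have : Continuous (fun x => ∫ t in (0 : ℝ)..x, cutoff t) :=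
        (contDiff_primitive contDiff_cutoff).continuous
      exact continuous_const.mul (((continuous_pow 4).mul (cK.comp (continuous_pow 4))).add
        (this.comp (continuous_pow 4)))
    · intro y hy
      have hy' : y ≠ 0 := ne_of_gt hy
      have d4 : HasDerivAt (fun y : ℝ => y ^ 4) (4 * y ^ 3) y := by
        simpa using hasDerivAt_pow 4 y
      have e1 := (dK (y ^ 4)).comp y d4
      have e2 := (hasDerivAt_primitive contDiff_cutoff.continuous (y ^ 4)).comp y d4
      have := ((d4.mul e1).add e2).const_mul (Real.pi / 2)
      refine this.congr_deriv ?_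
      simp only [hdef, Function.comp]
      field_simp
      ring
    · intro y hy
      have : (3 : ℝ) ≤ y ^ 4 := by
        have := pow_le_pow_left₀ (by norm_num) hy.le 4
        linarith
      rw [K3 _ this]; ring
    · intro y hy
      have : (3 : ℝ) ≤ y ^ 4 := by
        have := pow_le_pow_left₀ (by norm_num) hy.le 4
        linarith
      rw [K3 _ this, primitive_eq_const cut0 this, integral_cutoff]; ring
  set G : ℂ × ℂ → ℝ := fun p => h (‖p.1‖ ^ 2 + ‖p.2‖ ^ 4) * (2 * ‖p.2‖ ^ 2) with hG
  have cG : Continuous G := (hc.comp (by fun_prop)).mul (by fun_prop)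
  have e1 : ∫ w : C2, cutoff (quasi w) * (quasi w)⁻¹ * (2 * Complex.normSq (w 1)) =
      ∫ p, G p := by
    rw [← (volume_preserving_finTwoArrow ℂ).integral_comp' G]
    congr 1
    funext w
    simp [hG, hdef, quasi, Complex.normSq_eq_norm_sq, MeasurableEquiv.finTwoArrow]
    ring_nf
    simp
  have iG : Integrable G := by
    refine cG.integrable_of_hasCompactSupport (HasCompactSupport.intro
      ((isCompact_closedBall (0 : ℂ) 3).prod (isCompact_closedBall (0 : ℂ) 3)) fun p hp => ?_)
    rw [hG]
    simp only
    rw [h0 _ fun hh => hp ?_, zero_mul]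
    rw [mem_prod, mem_closedBall_zero_iff, mem_closedBall_zero_iff]
    have a1 := norm_nonneg p.1
    have a2 := norm_nonneg p.2
    have h2 := hh.2
    constructor
    · by_contra! h3
      nlinarith [pow_nonneg a2 4]
    · by_contra! h3
      have := pow_le_pow_left₀ (by norm_num) h3.le 4
      nlinarith [sq_nonneg ‖p.1‖]
  rw [e1, Measure.volume_eq_prod, integral_prod_symm _ (by rwa [Measure.volume_eq_prod] at iG),
    ← outer]
  congr 1
  funext z
  simp only [hG]
  rw [integral_mul_const, inner _ (by positivity)]
  ring

/-! ### The integral of the model form -/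

/-- The form v^k ω is closed, as v^k is holomorphic, and homogeneous, so pulling it back along
`gproj` only multiplies it by a power of m. After that power is absorbed into γ,
`integral_closed_eq` replaces m by `quasi`, for which all derivatives are explicit. -/
lemma IsGauge.levelIntegral_model {m : C2 → ℝ} {c C : ℝ} (hm : IsGauge m c C) (k : ℕ) :
    levelIntegral m (fun w => w 1 ^ k * modelP w) (fun w => w 1 ^ k * modelQ w) =
      8 * ∫ w : C2, ((cutoff (quasi w) * quasi w * (quasi w)⁻¹ ^ k : ℝ) : ℂ) *
        (w 1 ^ k * (starRingEnd ℂ) (w 1) * (quasi w : ℂ)⁻¹) := by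
  -- The coefficients of v^k ω have degrees k − 6 and k − 5. Combined with the m⁻⁵ and m⁻⁴ of the
  -- density, both leave m^(1−k).
  set γ : ℝ → ℝ := fun x => cutoff x * x * x⁻¹ ^ k with hγ
  have h0 : ∀ x ∉ Ioo (1 : ℝ) 3, γ x = 0 := fun x hx => by simp [hγ, cutoff_eq_zero hx]
  have hc : ContDiff ℝ ∞ γ := by
    rw [contDiff_iff_contDiffAt]
    intro x
    by_cases hx : x = 0
    · subst hx
      refine contDiffAt_const (c := (0 : ℝ)).congr_of_eventuallyEq ?_
      filter_upwards [eventually_lt_nhds (show (0 : ℝ) < 1 by norm_num)] with x hx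
      exact h0 x fun h => by linarith [h.1]
    · exact (contDiff_cutoff.contDiffAt.mul contDiffAt_id).mul ((contDiffAt_id.inv hx).pow k)
  have hne : ∀ᵐ w : C2, w ≠ 0 := by simp [ae_iff]
  have s1 : ∀ w : C2, ContDiffAt ℝ ∞ (fun w : C2 => w 1 ^ k) w := fun w =>
    ((contDiff_coord 1).pow k).contDiffAt
  have key := hm.integral_closed_eq hc h0 (P := fun w => w 1 ^ k * modelP w)
    (Q := fun w => w 1 ^ k * modelQ w) (fun w hw => (s1 w).mul (contDiffAt_modelP hw))
    (fun w hw => (s1 w).mul (contDiffAt_modelQ hw)) (fun w hw => by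
      rw [dbr_mul ((s1 w).differentiableAt (by simp))
        ((contDiffAt_modelP hw).differentiableAt (by simp)),
        dbr_mul ((s1 w).differentiableAt (by simp))
        ((contDiffAt_modelQ hw).differentiableAt (by simp)), dbr_model hw,
        dbr_pow k (differentiableAt_coord 1 w), dbr_pow k (differentiableAt_coord 1 w),
        dbr_coord, dbr_coord]
      ring)
  have e1 : ∫ w, levelDensity m (fun w => w 1 ^ k * modelP w) (fun w => w 1 ^ k * modelQ w) w =
      ∫ w, (γ (m w) : ℂ) * (w 1 ^ k * modelP w * dbr 1 (fun z => (m z : ℂ)) w -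
        w 1 ^ k * modelQ w * dbr 0 (fun z => (m z : ℂ)) w) := by
    refine integral_congr_ae ?_
    filter_upwards [hne] with w hw
    have hm0 : (m w : ℂ) ≠ 0 := by exact_mod_cast (hm.pos w hw).ne'
    have hq := quasi_ofReal_ne_zero hw
    simp only [levelDensity, modelP, modelQ, gproj, quasi_dil, dil_apply_zero, dil_apply_one, hγ,
      mul_pow]
    push_cast
    simp only [map_mul, map_pow, map_inv₀, Complex.conj_ofReal]
    field_simp
  -- Here −v̄² · 2v²v̄ − 2ūv̄ · u = −2v̄ · `quasi`.
  have e2 : ∫ w, (γ (quasi w) : ℂ) * (w 1 ^ k * modelP w * dbr 1 (fun z => (quasi z : ℂ)) w -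
        w 1 ^ k * modelQ w * dbr 0 (fun z => (quasi z : ℂ)) w) =
      ∫ w : C2, -2 * (((cutoff (quasi w) * quasi w * (quasi w)⁻¹ ^ k : ℝ) : ℂ) *
        (w 1 ^ k * (starRingEnd ℂ) (w 1) * (quasi w : ℂ)⁻¹)) := by
    refine integral_congr_ae ?_
    filter_upwards [hne] with w hw
    have hq := quasi_ofReal_ne_zero hw
    rw [(dbr_quasi w).1, (dbr_quasi w).2]
    simp only [modelP, modelQ, hγ]
    push_cast
    field_simp
    rw [quasi_eq]
    ring
  rw [levelIntegral, e1, key, e2, integral_const_mul]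
  ring

/-- `rot` preserves `quasi` and multiplies v̄ by −i, so the integral equals −i times itself. -/
lemma IsGauge.levelIntegral_model_zero {m : C2 → ℝ} {c C : ℝ} (hm : IsGauge m c C) :
    levelIntegral m modelP modelQ = 0 := by
  have h := hm.levelIntegral_model 0
  simp only [pow_zero, one_mul, mul_one] at h
  rw [h]
  set f : C2 → ℂ := fun w => ((cutoff (quasi w) * quasi w : ℝ) : ℂ) *
    ((starRingEnd ℂ) (w 1) * (quasi w : ℂ)⁻¹) with hf
  have h1 : ∫ w, f w = -Complex.I * ∫ w, f w := by
    rw [← integral_const_mul]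
    conv_lhs => rw [← integral_comp_rot]
    congr 1
    funext w
    simp [hf, quasi_rot]
    ring
  have h2 : (1 + Complex.I) * ∫ w, f w = 0 := by linear_combination h1
  have h3 : (1 + Complex.I) ≠ 0 := fun h => by simpa using congrArg Complex.re h
  rw [(mul_eq_zero.1 h2).resolve_left h3, mul_zero]

lemma IsGauge.levelIntegral_model_one {m : C2 → ℝ} {c C : ℝ} (hm : IsGauge m c C) :
    levelIntegral m (fun w => w 1 * modelP w) (fun w => w 1 * modelQ w) = 4 * Real.pi ^ 2 := by
  have h := hm.levelIntegral_model 1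
  simp only [pow_one] at h
  have hne : ∀ᵐ w : C2, w ≠ 0 := by simp [ae_iff]
  have e : ∫ w : C2, ((cutoff (quasi w) * quasi w * (quasi w)⁻¹ : ℝ) : ℂ) *
        (w 1 * (starRingEnd ℂ) (w 1) * (quasi w : ℂ)⁻¹) =
      ∫ w : C2, (2 : ℂ)⁻¹ * ((cutoff (quasi w) * (quasi w)⁻¹ * (2 * Complex.normSq (w 1)) : ℝ) : ℂ) := by
    refine integral_congr_ae ?_
    filter_upwards [hne] with w hw
    have hq := quasi_ofReal_ne_zero hw
    rw [Complex.mul_conj]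
    push_cast
    field_simp
  rw [h, e, integral_const_mul, integral_complex_ofReal, integral_model]
  push_cast
  ring

/-! ### Real coordinates -/

lemma measurePreserving_realCoords : MeasurePreserving realCoords := by
  have hmeas : Measurable realCoords := by
    rw [measurable_pi_iff]
    intro i
    fin_cases i
    · exact Complex.measurable_re.comp (measurable_pi_apply 0)
    · exact Complex.measurable_im.comp (measurable_pi_apply 0)
    · exact Complex.measurable_re.comp (measurable_pi_apply 1)
    · exact Complex.measurable_im.comp (measurable_pi_apply 1)
  refine ⟨hmeas, ?_⟩
  symm
  rw [volume_pi]
  refine Measure.pi_eq fun s hs => ?_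
  rw [Measure.map_apply hmeas (MeasurableSet.univ_pi hs)]
  have hrect : ∀ a b : Set ℝ, MeasurableSet a → MeasurableSet b →
      volume (Complex.measurableEquivRealProd ⁻¹' (a ×ˢ b)) = volume a * volume b := by
    intro a b ha hb
    rw [Complex.volume_preserving_equiv_real_prod.measure_preimage
      (ha.prod hb).nullMeasurableSet, Measure.volume_eq_prod, Measure.prod_prod]
  have hpre : realCoords ⁻¹' (univ.pi s) = univ.pi
      ![Complex.measurableEquivRealProd ⁻¹' (s 0 ×ˢ s 1),
        Complex.measurableEquivRealProd ⁻¹' (s 2 ×ˢ s 3)] := by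
    ext w
    simp [realCoords, Fin.forall_fin_succ, and_assoc]
  rw [hpre, volume_pi_pi]
  simp only [Fin.prod_univ_two, Matrix.cons_val_zero, Matrix.cons_val_one]
  rw [hrect _ _ (hs 0) (hs 1), hrect _ _ (hs 2) (hs 3), Fin.prod_univ_four]
  ring

/-- The real coordinates as a continuous linear equivalence. -/
def realCoordsL : C2 ≃L[ℝ] (Fin 4 → ℝ) :=
  LinearEquiv.toContinuousLinearEquiv
    { toFun := realCoords
      map_add' := fun z w => by
        funext i; fin_cases i <;> simp [realCoords]
      map_smul' := fun c w => by
        funext i; fin_cases i <;> simp [realCoords]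
      invFun := fun x => ![⟨x 0, x 1⟩, ⟨x 2, x 3⟩]
      left_inv := fun w => by
        apply C2_ext <;> simp [realCoords]
      right_inv := fun x => by
        funext i; fin_cases i <;> simp [realCoords] }

@[simp] lemma realCoordsL_apply (w : C2) : realCoordsL w = realCoords w := rfl

lemma integral_comp_realCoordsL_symm (f : C2 → ℂ) :
    ∫ x, f (realCoordsL.symm x) = ∫ w, f w := by
  have h : MeasurePreserving realCoordsL := measurePreserving_realCoords
  have := h.integral_comp realCoordsL.toHomeomorph.measurableEmbedding
    (fun x => f (realCoordsL.symm x))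
  rw [← this]
  simp only [ContinuousLinearEquiv.symm_apply_apply]

/-! ### Linear algebra of `(2,1)`-forms -/

/-- The determinant of a real frame of `ℂ²`. -/
def frameDet (n : C2) (h : Fin 3 → C2) : ℝ :=
  (Matrix.of ![realCoords n, realCoords (h 0), realCoords (h 1), realCoords (h 2)]).det

lemma frameDet_eq (n : C2) (h : Fin 3 → C2) : frameDet n h =
    (n 0).re * ((h 0 0).im * ((h 1 1).re * (h 2 1).im - (h 1 1).im * (h 2 1).re)
      - (h 0 1).re * ((h 1 0).im * (h 2 1).im - (h 1 1).im * (h 2 0).im)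
      + (h 0 1).im * ((h 1 0).im * (h 2 1).re - (h 1 1).re * (h 2 0).im))
    - (n 0).im * ((h 0 0).re * ((h 1 1).re * (h 2 1).im - (h 1 1).im * (h 2 1).re)
      - (h 0 1).re * ((h 1 0).re * (h 2 1).im - (h 1 1).im * (h 2 0).re)
      + (h 0 1).im * ((h 1 0).re * (h 2 1).re - (h 1 1).re * (h 2 0).re))
    + (n 1).re * ((h 0 0).re * ((h 1 0).im * (h 2 1).im - (h 1 1).im * (h 2 0).im)
      - (h 0 0).im * ((h 1 0).re * (h 2 1).im - (h 1 1).im * (h 2 0).re)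
      + (h 0 1).im * ((h 1 0).re * (h 2 0).im - (h 1 0).im * (h 2 0).re))
    - (n 1).im * ((h 0 0).re * ((h 1 0).im * (h 2 1).re - (h 1 1).re * (h 2 0).im)
      - (h 0 0).im * ((h 1 0).re * (h 2 1).re - (h 1 1).re * (h 2 0).re)
      + (h 0 1).re * ((h 1 0).re * (h 2 0).im - (h 1 0).im * (h 2 0).re)) := by
  simp [frameDet, realCoords, Matrix.det_succ_row_zero, Fin.sum_univ_succ, Fin.succAbove]
  ring

/-- The exponent is the sum 2 + 2 + 1 + 1 of the weights of the four real coordinates. -/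
lemma frameDet_dil (s : ℝ) (n : C2) (h : Fin 3 → C2) :
    frameDet (dil s n) (fun k => dil s (h k)) = s ^ 6 * frameDet n h := by
  have e0 : ∀ z : C2, ((dil s z) 0).re = s ^ 2 * (z 0).re ∧
      ((dil s z) 0).im = s ^ 2 * (z 0).im := fun z => by
    rw [dil_apply_zero, ← Complex.ofReal_pow, Complex.re_ofReal_mul, Complex.im_ofReal_mul]
    exact ⟨rfl, rfl⟩
  have e1 : ∀ z : C2, ((dil s z) 1).re = s * (z 1).re ∧
      ((dil s z) 1).im = s * (z 1).im := fun z => by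
    rw [dil_apply_one, Complex.re_ofReal_mul, Complex.im_ofReal_mul]
    exact ⟨rfl, rfl⟩
  simp only [frameDet_eq, (e0 _).1, (e0 _).2, (e1 _).1, (e1 _).2]
  ring

lemma frameDet_smul (s : ℝ) (n : C2) (h : Fin 3 → C2) :
    frameDet (s • n) h = s * frameDet n h := by
  simp [frameDet_eq]
  ring

/-- The minor of `(x, u, v)` on a triple of vectors. -/
def minor (x : C2 → ℂ) (h : Fin 3 → C2) : ℂ :=
  x (h 0) * (h 1 0 * h 2 1 - h 2 0 * h 1 1) - x (h 1) * (h 0 0 * h 2 1 - h 2 0 * h 0 1) +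
    x (h 2) * (h 0 0 * h 1 1 - h 1 0 * h 0 1)

/-- The form `(P dū + Q dv̄) ∧ du ∧ dv`. -/
def form21 (P Q : ℂ) (h : Fin 3 → C2) : ℂ :=
  P * minor (fun z => (starRingEnd ℂ) (z 0)) h + Q * minor (fun z => (starRingEnd ℂ) (z 1)) h

/-- The complex determinant of a real frame in the coordinates `(ū, v̄, u, v)`. -/
def conjDet (n : C2) (h : Fin 3 → C2) : ℂ :=
  (starRingEnd ℂ) (n 0) * minor (fun z => (starRingEnd ℂ) (z 1)) h -
    (starRingEnd ℂ) (n 1) * minor (fun z => (starRingEnd ℂ) (z 0)) h +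
    n 0 * ((starRingEnd ℂ) (h 0 0) * ((starRingEnd ℂ) (h 1 1) * h 2 1 - (starRingEnd ℂ) (h 2 1) * h 1 1)
      - (starRingEnd ℂ) (h 1 0) * ((starRingEnd ℂ) (h 0 1) * h 2 1 - (starRingEnd ℂ) (h 2 1) * h 0 1)
      + (starRingEnd ℂ) (h 2 0) * ((starRingEnd ℂ) (h 0 1) * h 1 1 - (starRingEnd ℂ) (h 1 1) * h 0 1))
    - n 1 * ((starRingEnd ℂ) (h 0 0) * ((starRingEnd ℂ) (h 1 1) * h 2 0 - (starRingEnd ℂ) (h 2 1) * h 1 0)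
      - (starRingEnd ℂ) (h 1 0) * ((starRingEnd ℂ) (h 0 1) * h 2 0 - (starRingEnd ℂ) (h 2 1) * h 0 0)
      + (starRingEnd ℂ) (h 2 0) * ((starRingEnd ℂ) (h 0 1) * h 1 0 - (starRingEnd ℂ) (h 1 1) * h 0 0))

-- dū ∧ dv̄ ∧ du ∧ dv = −(dū ∧ du) ∧ (dv̄ ∧ dv) = −(2i)² times the volume form; this is the source
-- of the factor 4.
set_option maxHeartbeats 1600000 in
lemma conjDet_eq (n : C2) (h : Fin 3 → C2) : conjDet n h = 4 * frameDet n h := by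
  rw [frameDet_eq]
  apply Complex.ext
  · simp [conjDet, minor]
    ring
  · simp [conjDet, minor]
    ring

/-- The holomorphic component of a real-linear functional. -/
def holPart (k : Fin 2) (l : C2 →L[ℝ] ℂ) : ℂ :=
  (l (Pi.single k 1) - Complex.I * l (Pi.single k Complex.I)) / 2

lemma apply_eq_parts (l : C2 →L[ℝ] ℂ) (z : C2) :
    l z = holPart 0 l * z 0 + barPart 0 l * (starRingEnd ℂ) (z 0) +
      (holPart 1 l * z 1 + barPart 1 l * (starRingEnd ℂ) (z 1)) := by
  have hz : z = (z 0).re • (Pi.single 0 1 : C2) + (z 0).im • (Pi.single 0 Complex.I : C2) +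
      ((z 1).re • (Pi.single 1 1 : C2) + (z 1).im • (Pi.single 1 Complex.I : C2)) := by
    apply C2_ext <;> simp
  have key : ∀ (A B w : ℂ), (A - Complex.I * B) / 2 * w +
      (A + Complex.I * B) / 2 * (starRingEnd ℂ) w = w.re * A + w.im * B := by
    intro A B w
    have h1 : w = w.re + w.im * Complex.I := (Complex.re_add_im w).symm
    have h2 : (starRingEnd ℂ) w = w.re - w.im * Complex.I := by
      apply Complex.ext <;> simp
    rw [h2]
    nth_rewrite 1 [h1]
    linear_combination (-(w.im : ℂ) * B) * Complex.I_sq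
  conv_lhs => rw [hz]
  simp only [map_add, map_smul, Complex.real_smul, holPart, barPart]
  rw [key, key]

/-- A `(2,1)`-form on the kernel of a real functional, in terms of a transverse vector. -/
lemma form21_mul_apply (P Q : ℂ) (l : C2 →L[ℝ] ℂ) (n : C2) (h : Fin 3 → C2)
    (hl : ∀ k, l (h k) = 0) :
    form21 P Q h * l n = -4 * (P * barPart 1 l - Q * barPart 0 l) * frameDet n h := by
  -- The expansion of (l ∧ Θ)(n, h₀, h₁, h₂). Against du ∧ dv only the antiholomorphic part of l
  -- survives, which leaves a multiple of dū ∧ dv̄ ∧ du ∧ dv, that is, of `conjDet`.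
  have key : l n * form21 P Q h =
      -(P * barPart 1 l - Q * barPart 0 l) * conjDet n h
      + l (h 0) * form21 P Q ![n, h 1, h 2] - l (h 1) * form21 P Q ![n, h 0, h 2]
      + l (h 2) * form21 P Q ![n, h 0, h 1] := by
    simp only [apply_eq_parts l, form21, conjDet, minor, Matrix.cons_val_zero,
      Matrix.cons_val_one, Matrix.cons_val]
    ring
  rw [hl, hl, hl, conjDet_eq] at key
  linear_combination key

/-- The vector n − (l n / l e) e and the three h_k lie in the three-dimensional kernel of l, hence
have determinant 0. The proof compares two instances of `form21_mul_apply`. -/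
lemma frameDet_mul_apply (l : C2 →L[ℝ] ℝ) {n e : C2} {h : Fin 3 → C2} (hl : ∀ k, l (h k) = 0)
    (he : l e ≠ 0) : frameDet n h * l e = frameDet e h * l n := by
  set L : C2 →L[ℝ] ℂ := Complex.ofRealCLM.comp l
  have hL : ∀ k, L (h k) = 0 := fun k => by simp [L, hl k]
  -- Chosen so that K is the sum of the |`barPart k L`|², which is nonzero because a real functional
  -- is determined by its antiholomorphic part.
  set P := (starRingEnd ℂ) (barPart 1 L)
  set Q := -(starRingEnd ℂ) (barPart 0 L)
  set K : ℂ := P * barPart 1 L - Q * barPart 0 L with hK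
  have e1 := form21_mul_apply P Q L n h hL
  have e2 := form21_mul_apply P Q L e h hL
  have hK0 : K ≠ 0 := by
    intro h0
    have hK' : K = ((Complex.normSq (barPart 1 L) + Complex.normSq (barPart 0 L) : ℝ) : ℂ) := by
      push_cast
      rw [hK, ← Complex.mul_conj, ← Complex.mul_conj]
      simp only [P, Q]
      ring
    rw [hK', Complex.ofReal_eq_zero] at h0
    have a1 := Complex.normSq_nonneg (barPart 1 L)
    have a0 := Complex.normSq_nonneg (barPart 0 L)
    have b1 : barPart 1 L = 0 := Complex.normSq_eq_zero.1 (by linarith)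
    have b0 : barPart 0 L = 0 := Complex.normSq_eq_zero.1 (by linarith)
    have c : ∀ k, holPart k L = (starRingEnd ℂ) (barPart k L) := fun k => by
      simp [holPart, barPart, L, sub_eq_add_neg, map_ofNat (starRingEnd ℂ) 2]
    have : L e = 0 := by rw [apply_eq_parts, c, c, b0, b1]; simp
    exact he (by simpa [L] using this)
  have e3 : (-4 * K) * ((frameDet n h : ℂ) * L e - frameDet e h * L n) = 0 := by
    linear_combination L n * e2 - L e * e1
  have e4 : (frameDet n h : ℂ) * L e - frameDet e h * L n = 0 :=
    (mul_eq_zero.1 e3).resolve_left (mul_ne_zero (by norm_num) hK0)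
  have e5 : ((frameDet n h * l e - frameDet e h * l n : ℝ) : ℂ) = 0 := by
    push_cast
    simpa [L] using e4
  exact sub_eq_zero.1 (Complex.ofReal_eq_zero.1 e5)

/-! ### The boundary of a sublevel set of a gauge -/

namespace IsGauge

variable {m : C2 → ℝ} {c C : ℝ}

lemma continuous (hm : IsGauge m c C) : Continuous m := by
  rw [continuous_iff_continuousAt]
  intro w
  by_cases hw : w = 0
  · subst hw
    rw [Metric.continuousAt_iff']
    intro ε hε
    have : ∀ᶠ w in 𝓝 (0 : C2), quasi w < ε ^ 4 / C :=
      continuous_quasi.continuousAt.eventually_lt continuousAt_const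
        (by simpa using div_pos (pow_pos hε 4) hm.C_pos)
    filter_upwards [this] with w hw
    rw [hm.zero, dist_zero_right, Real.norm_of_nonneg (hm.nonneg w)]
    by_contra! h
    have h1 := pow_le_pow_left₀ hε.le h 4
    have h2 := hm.upper w
    rw [lt_div_iff₀ hm.C_pos] at hw
    linarith
  · exact (hm.smooth w hw).continuousAt

lemma ne_zero_of_eq (hm : IsGauge m c C) {r : ℝ} (hr : 0 < r) {p : C2} (hp : m p = r) : p ≠ 0 := by
  rintro rfl
  rw [hm.zero] at hp
  exact hr.ne hp

/-- Dilating a point of {m = r} by a factor slightly above 1 leaves the sublevel set, so such a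
point is not interior. -/
lemma interior_sublevel (hm : IsGauge m c C) {r : ℝ} (hr : 0 < r) :
    interior {w | m w ≤ r} = {w | m w < r} := by
  apply subset_antisymm
  · intro w hw
    have hle : m w ≤ r := interior_subset (s := {w | m w ≤ r}) hw
    refine lt_of_le_of_ne hle fun h => ?_
    have hw0 := hm.ne_zero_of_eq hr h
    have hc : ContinuousAt (fun t : ℝ => dil t w) 1 := (hasDerivAt_dil one_ne_zero w).continuousAt
    have h1 : ∀ᶠ t in 𝓝 (1 : ℝ), dil t w ∈ interior {w | m w ≤ r} := by
      apply hc
      simp only [dil_one]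
      exact isOpen_interior.mem_nhds hw
    have h2 : ∀ᶠ t in 𝓝[>] (1 : ℝ), dil t w ∈ interior {w | m w ≤ r} := h1.filter_mono inf_le_left
    obtain ⟨t, ht, ht1⟩ := (h2.and self_mem_nhdsWithin).exists
    have ht' : m (dil t w) ≤ r := interior_subset (s := {w | m w ≤ r}) ht
    have ht1' : (1 : ℝ) < t := ht1
    rw [hm.hom t (by linarith), h] at ht'
    nlinarith
  · exact interior_maximal (fun w (hw : m w < r) => show m w ≤ r from hw.le)
      (isOpen_lt hm.continuous continuous_const)

lemma frontier_sublevel (hm : IsGauge m c C) {r : ℝ} (hr : 0 < r) :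
    frontier {w | m w ≤ r} = {w | m w = r} := by
  rw [frontier, hm.interior_sublevel hr,
    (isClosed_le hm.continuous continuous_const).closure_eq]
  ext w
  simp only [Set.mem_sdiff, mem_ofPred_eq, not_lt]
  exact ⟨fun h => le_antisymm h.1 h.2, fun h => ⟨h.le, h.ge⟩⟩

/-- Euler's identity for a function homogeneous of degree one. -/
lemma fderiv_euler (hm : IsGauge m c C) {p : C2} (hp : p ≠ 0) :
    fderiv ℝ m p (euler p) = m p := by
  have h1 : HasDerivAt (fun s : ℝ => m (dil s p)) (fderiv ℝ m p (euler p)) 1 := by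
    have hd := hasDerivAt_dil one_ne_zero p
    rw [inv_one, one_smul, dil_one] at hd
    have hf : HasFDerivAt m (fderiv ℝ m p) (dil 1 p) := by
      rw [dil_one]; exact (hm.diff hp).hasFDerivAt
    exact hf.comp_hasDerivAt (1 : ℝ) hd
  have h2 : HasDerivAt (fun s : ℝ => s * m p) (m p) 1 := by
    simpa using (hasDerivAt_id (1 : ℝ)).mul_const (m p)
  refine h1.unique (h2.congr_of_eventuallyEq ?_)
  filter_upwards [eventually_gt_nhds one_pos] with s hs using hm.hom s hs p

lemma fderiv_tangentFrame (hm : IsGauge m c C) {r : ℝ} (hr : 0 < r) {V : Set (Fin 3 → ℝ)}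
    {ψ : (Fin 3 → ℝ) → C2} (hV : IsOpen V) (hψ : ContDiffOn ℝ ∞ ψ V)
    (hmap : ∀ y ∈ V, m (ψ y) = r) {y : Fin 3 → ℝ} (hy : y ∈ V) (k : Fin 3) :
    fderiv ℝ m (ψ y) (tangentFrame ψ y k) = 0 := by
  have hd : DifferentiableAt ℝ ψ y := (hψ.contDiffAt (hV.mem_nhds hy)).differentiableAt (by simp)
  have h1 := (hm.diff (hm.ne_zero_of_eq hr (hmap y hy))).hasFDerivAt.comp y hd.hasFDerivAt
  have h2 : HasFDerivAt (m ∘ ψ) (0 : (Fin 3 → ℝ) →L[ℝ] ℝ) y := by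
    refine (hasFDerivAt_const r y).congr_of_eventuallyEq ?_
    filter_upwards [hV.mem_nhds hy] with z hz using hmap z hz
  have := congrArg (fun l : (Fin 3 → ℝ) →L[ℝ] ℝ => l (Pi.single k 1)) (h1.unique h2)
  simpa [tangentFrame] using this

/-- An inequality is all that the difference quotients give, since the definition of outward does
not by itself exclude first-order tangency. Strictness is recovered in `frameDet_euler_pos` from the
nonvanishing determinant. -/
lemma isOutward_fderiv_nonneg (hm : IsGauge m c C) {r : ℝ} (hr : 0 < r) {p n : C2}
    (hp : m p = r) (hn : IsOutward {w | m w ≤ r} p n) : 0 ≤ fderiv ℝ m p n := by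
  have hd : HasDerivAt (fun t : ℝ => m (p + t • n)) (fderiv ℝ m p n) 0 := by
    have h1 : HasDerivAt (fun t : ℝ => p + t • n) n 0 := by
      simpa using ((hasDerivAt_id (0 : ℝ)).smul_const n).const_add p
    have hf : HasFDerivAt m (fderiv ℝ m p) (p + (0 : ℝ) • n) := by
      rw [zero_smul, add_zero]; exact (hm.diff (hm.ne_zero_of_eq hr hp)).hasFDerivAt
    exact hf.comp_hasDerivAt (0 : ℝ) h1
  have ht := (hasDerivAt_iff_tendsto_slope.1 hd).mono_left
    (nhdsWithin_mono (0 : ℝ) (fun x (hx : 0 < x) => ne_of_gt hx) : 𝓝[>] (0 : ℝ) ≤ _)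
  refine ge_of_tendsto ht ?_
  filter_upwards [hn, self_mem_nhdsWithin] with t h1 h2
  have h3 : r < m (p + t • n) := by simpa using h1.1
  have h2' : (0 : ℝ) < t := h2
  simp only [slope, sub_zero, zero_smul, add_zero, vsub_eq_sub, smul_eq_mul, hp]
  exact mul_nonneg (inv_nonneg.2 h2'.le) (by linarith)

/-- The unspecified outward vector is exchanged for the Euler field, which is the radial direction
of the cone used for integration. -/
lemma frameDet_euler_pos (hm : IsGauge m c C) {r : ℝ} (hr : 0 < r) {V : Set (Fin 3 → ℝ)}
    {ψ : (Fin 3 → ℝ) → C2} (h : IsOrientedParam {w | m w ≤ r} V ψ) {y : Fin 3 → ℝ}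
    (hy : y ∈ V) : 0 < frameDet (euler (ψ y)) (tangentFrame ψ y) := by
  have hmap : ∀ y ∈ V, m (ψ y) = r := fun y hy => by
    have := h.mapsTo hy
    rwa [hm.frontier_sublevel hr] at this
  have hp := hmap y hy
  obtain ⟨n, hn, hdet⟩ := h.oriented y hy
  have h1 := hm.isOutward_fderiv_nonneg hr hp hn
  have h2 := hm.fderiv_tangentFrame hr h.isOpen h.smooth hmap hy
  have h3 := hm.fderiv_euler (hm.ne_zero_of_eq hr hp)
  rw [hp] at h3
  have h4 := frameDet_mul_apply (fderiv ℝ m (ψ y)) (n := n) h2 (by rw [h3]; exact hr.ne')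
  rw [h3] at h4
  have hdet' : 0 < frameDet n (tangentFrame ψ y) := hdet
  by_contra! hneg
  have := mul_pos hdet' hr
  rw [h4] at this
  nlinarith

lemma dbr_dil (hm : IsGauge m c C) {s : ℝ} (hs : 0 < s) {p : C2} (hp : p ≠ 0) :
    dbr 0 (fun z => (m z : ℂ)) (dil s p) = (s : ℂ)⁻¹ * dbr 0 (fun z => (m z : ℂ)) p ∧
      dbr 1 (fun z => (m z : ℂ)) (dil s p) = dbr 1 (fun z => (m z : ℂ)) p := by
  have h := dbr_comp_dil (hm.diff_ofReal (dil_ne_zero hs.ne' hp))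
  have e : (fun w => (m (dil s w) : ℂ)) = fun w => (s : ℂ) * (m w : ℂ) := by
    funext w; rw [hm.hom s hs]; push_cast; rfl
  have hs' : (s : ℂ) ≠ 0 := by exact_mod_cast hs.ne'
  have h2 : ∀ k, dbr k (fun w => (s : ℂ) * (m w : ℂ)) p = s * dbr k (fun w => (m w : ℂ)) p :=
    fun k => by rw [dbr_mul (differentiableAt_const _) (hm.diff_ofReal hp), dbr_const]; ring
  rw [e, h2, h2] at h
  constructor
  · have := h.1
    field_simp at this ⊢
    linear_combination -this
  · exact (mul_left_cancel₀ hs' h.2).symm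

end IsGauge

/-! ### Integration over a patch in the polar coordinates of the dilations -/

/-- The dilated cone over a hypersurface patch. -/
def coneMap (r : ℝ) (ψ : (Fin 3 → ℝ) → C2) (x : Fin 4 → ℝ) : Fin 4 → ℝ :=
  realCoordsL (dil (x 0 / r) (ψ (Fin.tail x)))

/-- With s = x₀/r, the radial derivative is x₀⁻¹ times the s-dilate of the Euler vector, and the
other partial derivatives are the s-dilates of the tangent frame. Multilinearity pulls out x₀⁻¹ and
s⁶. -/
lemma hasFDerivAt_coneMap {r : ℝ} (hr : 0 < r) {ψ : (Fin 3 → ℝ) → C2} {x : Fin 4 → ℝ}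
    (hx : 0 < x 0) (hψ : DifferentiableAt ℝ ψ (Fin.tail x)) :
    ∃ D : (Fin 4 → ℝ) →L[ℝ] (Fin 4 → ℝ), HasFDerivAt (coneMap r ψ) D x ∧
      D.det = (x 0)⁻¹ * (x 0 / r) ^ 6 *
        frameDet (euler (ψ (Fin.tail x))) (tangentFrame ψ (Fin.tail x)) := by
  set y := Fin.tail x with hy
  set s := x 0 / r with hs
  have hs0 : s ≠ 0 := (div_pos hx hr).ne'
  set T : (Fin 4 → ℝ) →L[ℝ] (Fin 3 → ℝ) :=
    ContinuousLinearMap.pi fun i => ContinuousLinearMap.proj i.succ with hT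
  have hTx : ∀ x, T x = Fin.tail x := fun x => rfl
  have h1 : HasFDerivAt (fun x => ψ (T x)) ((fderiv ℝ ψ y).comp T) x :=
    HasFDerivAt.comp (g := ψ) x (by rw [hTx]; exact hψ.hasFDerivAt) T.hasFDerivAt
  set S : (Fin 4 → ℝ) →L[ℝ] ℝ := r⁻¹ • ContinuousLinearMap.proj 0 with hS
  have hSx : ∀ x, S x = x 0 / r := fun x => by simp [hS, div_eq_inv_mul]
  have hd : DifferentiableAt ℝ (fun q : ℝ × C2 => dil q.1 q.2) (s, ψ y) :=
    contDiff_dil.contDiffAt.differentiableAt (by simp)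
  set G := fderiv ℝ (fun q : ℝ × C2 => dil q.1 q.2) (s, ψ y) with hG
  have e0 : ∀ h, G (0, h) = dil s h := by
    intro h
    have a := HasFDerivAt.comp (g := fun q : ℝ × C2 => dil q.1 q.2)
      (f := fun z => (s, id z)) (ψ y) hd.hasFDerivAt
      ((hasFDerivAt_const s (ψ y)).prodMk (hasFDerivAt_id (ψ y)))
    have b := a.unique (dil s).hasFDerivAt
    have := congrArg (fun l : C2 →L[ℝ] C2 => l h) b
    simpa using this
  have e1 : G (1, 0) = s⁻¹ • dil s (euler (ψ y)) := by
    have a := HasFDerivAt.comp_hasDerivAt (f := fun t : ℝ => (t, ψ y)) (x := s)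
      (l := fun q : ℝ × C2 => dil q.1 q.2) hd.hasFDerivAt
      ((hasDerivAt_id s).prodMk (hasDerivAt_const s (ψ y)))
    exact a.unique (hasDerivAt_dil hs0 (ψ y))
  have h2 : HasFDerivAt (fun x => dil (S x) (ψ (T x)))
      (G.comp (S.prod ((fderiv ℝ ψ y).comp T))) x := by
    refine HasFDerivAt.comp (g := fun q : ℝ × C2 => dil q.1 q.2)
      (f := fun x => (S x, ψ (T x))) x ?_ (S.hasFDerivAt.prodMk h1)
    rw [hSx, hTx]
    exact hd.hasFDerivAt
  refine ⟨(realCoordsL : C2 →L[ℝ] (Fin 4 → ℝ)).comp (G.comp (S.prod ((fderiv ℝ ψ y).comp T))),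
    ?_, ?_⟩
  · have h3 := (realCoordsL : C2 →L[ℝ] (Fin 4 → ℝ)).hasFDerivAt.comp x h2
    refine h3.congr_of_eventuallyEq (Eventually.of_forall fun x => ?_)
    simp [coneMap, hSx, hTx]
  · set D := (realCoordsL : C2 →L[ℝ] (Fin 4 → ℝ)).comp
      (G.comp (S.prod ((fderiv ℝ ψ y).comp T))) with hD
    have hcol0 : D (Pi.single 0 1) = realCoords ((x 0)⁻¹ • dil s (euler (ψ y))) := by
      have t0 : T (Pi.single 0 1) = 0 := by
        rw [hTx]; funext i; simp [Fin.tail]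
      have s0 : S (Pi.single 0 1) = r⁻¹ := by rw [hSx]; simp
      have : G (r⁻¹, 0) = r⁻¹ • G (1, 0) := by rw [← map_smul]; simp
      simp only [hD, ContinuousLinearMap.comp_apply, ContinuousLinearMap.prod_apply, t0, s0,
        map_zero, this, e1, smul_smul]
      simp only [ContinuousLinearEquiv.coe_coe, realCoordsL_apply]
      congr 2
      rw [hs]
      field_simp
    have hcol : ∀ k : Fin 3, D (Pi.single k.succ 1) = realCoords (dil s (tangentFrame ψ y k)) := by
      intro k
      have t0 : T (Pi.single k.succ 1) = Pi.single k 1 := by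
        rw [hTx]; funext i; simp [Fin.tail, Pi.single_apply]
      have s0 : S (Pi.single k.succ 1) = 0 := by rw [hSx]; simp
      simp only [hD, ContinuousLinearMap.comp_apply, ContinuousLinearMap.prod_apply, t0, s0, e0]
      rfl
    have hdet : D.det = frameDet ((x 0)⁻¹ • dil s (euler (ψ y)))
        (fun k => dil s (tangentFrame ψ y k)) := by
      rw [ContinuousLinearMap.det, ← LinearMap.det_toMatrix', frameDet, ← Matrix.det_transpose]
      congr 1
      ext i j
      rw [Matrix.transpose_apply, LinearMap.toMatrix'_apply]
      fin_cases i
      · exact congrFun hcol0 j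
      · exact congrFun (hcol 0) j
      · exact congrFun (hcol 1) j
      · exact congrFun (hcol 2) j
    rw [hdet, frameDet_smul, frameDet_dil]
    ring

namespace IsGauge

variable {m : C2 → ℝ} {c C : ℝ}

/-- The integral of a form supported in a patch of the level set. -/
lemma integral_patch (hm : IsGauge m c C) {r : ℝ} (hr : 0 < r) {V : Set (Fin 3 → ℝ)}
    {ψ : (Fin 3 → ℝ) → C2} (h : IsOrientedParam {w | m w ≤ r} V ψ) {P Q : C2 → ℂ}
    (hsupp : ∀ p, m p = r → p ∉ ψ '' V → P p = 0 ∧ Q p = 0) :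
    ∫ y in V, form21 (P (ψ y)) (Q (ψ y)) (tangentFrame ψ y) =
      levelIntegral m (fun p => (r : ℂ) ^ 5 * P (dil r p))
        (fun p => (r : ℂ) ^ 4 * Q (dil r p)) := by
  have hmap : ∀ y ∈ V, m (ψ y) = r := fun y hy => by
    have := h.mapsTo hy
    rwa [hm.frontier_sublevel hr] at this
  set F : C2 → ℂ := levelDensity m (fun p => (r : ℂ) ^ 5 * P (dil r p))
        (fun p => (r : ℂ) ^ 4 * Q (dil r p)) with hF
  set S : Set (Fin 4 → ℝ) := {x | 0 < x 0 ∧ Fin.tail x ∈ V} with hS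
  have htail : Continuous (fun x : Fin 4 → ℝ => Fin.tail x) :=
    continuous_pi fun i => continuous_apply i.succ
  have hSo : IsOpen S := (isOpen_lt continuous_const (continuous_apply 0)).inter
    (h.isOpen.preimage htail)
  have hdiff : ∀ y ∈ V, DifferentiableAt ℝ ψ y := fun y hy =>
    (h.smooth.contDiffAt (h.isOpen.mem_nhds hy)).differentiableAt (by simp)
  choose! D hD using fun (x : Fin 4 → ℝ) (hx : x ∈ S) =>
    hasFDerivAt_coneMap hr hx.1 (hdiff _ hx.2)
  have hm_cone : ∀ x ∈ S, m (dil (x 0 / r) (ψ (Fin.tail x))) = x 0 := fun x hx => by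
    rw [hm.hom _ (div_pos hx.1 hr), hmap _ hx.2, div_mul_cancel₀ _ hr.ne']
  have hinj : InjOn (coneMap r ψ) S := by
    intro x hx x' hx' hxx
    have e1 : dil (x 0 / r) (ψ (Fin.tail x)) = dil (x' 0 / r) (ψ (Fin.tail x')) :=
      realCoordsL.injective hxx
    have e2 : x 0 = x' 0 := by rw [← hm_cone x hx, ← hm_cone x' hx', e1]
    have e3 : ψ (Fin.tail x) = ψ (Fin.tail x') := by
      have hne := (div_pos hx.1 hr).ne'
      rw [← dil_inv_dil hne (ψ (Fin.tail x)), e1, ← e2, dil_inv_dil hne]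
    have e4 := h.injOn hx.2 hx'.2 e3
    rw [← Fin.cons_self_tail x, ← Fin.cons_self_tail x', e2, e4]
  -- Off the cone either the cutoff vanishes, or the projection to {m = r} misses the patch, where P
  -- and Q vanish.
  have hzero : ∀ x ∉ coneMap r ψ '' S, F (realCoordsL.symm x) = 0 := by
    intro x hx
    set w := realCoordsL.symm x with hw
    by_contra hne
    have hcut : cutoff (m w) ≠ 0 := by
      intro h0; apply hne; simp [hF, levelDensity, h0]
    have hmw : 0 < m w := by
      by_contra! hle
      exact hcut (cutoff_eq_zero fun h => by linarith [h.1])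
    have hw0 : w ≠ 0 := by
      intro h0; rw [h0, hm.zero] at hmw; exact lt_irrefl _ hmw
    have hp : m (dil r (gproj m w)) = r := by
      rw [hm.hom r hr, hm.gproj_eq_one hw0, mul_one]
    by_cases hpV : dil r (gproj m w) ∈ ψ '' V
    · obtain ⟨y, hy, hyp⟩ := hpV
      apply hx
      refine ⟨Fin.cons (m w) y, ⟨hmw, by simpa using hy⟩, ?_⟩
      rw [coneMap, Fin.cons_zero, Fin.tail_cons, hyp, gproj, dil_dil, dil_dil]
      have : m w / r * r * (m w)⁻¹ = 1 := by field_simp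
      rw [this, dil_one, hw, ContinuousLinearEquiv.apply_symm_apply]
    · obtain ⟨p0, q0⟩ := hsupp _ hp hpV
      apply hne
      simp [hF, levelDensity, p0, q0]
  -- The Jacobian cancels every power of x₀ in the density, so the integrand separates into a radial
  -- bump and the form on the patch. `form21_mul_apply` with l = dm and n the Euler vector makes the
  -- identification; the Jacobian is positive by orientation, so its absolute value is harmless.
  have hval : ∀ x ∈ S, |(D x).det| • (-4 * F (realCoordsL.symm (coneMap r ψ x))) =
      (cutoff (x 0) : ℂ) * form21 (P (ψ (Fin.tail x))) (Q (ψ (Fin.tail x)))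
        (tangentFrame ψ (Fin.tail x)) := by
    intro x hx
    set y := Fin.tail x with hy
    set p := ψ y with hpdef
    have hp : m p = r := hmap y hx.2
    have hp0 : p ≠ 0 := hm.ne_zero_of_eq hr hp
    have hs : 0 < x 0 / r := div_pos hx.1 hr
    have hpos := hm.frameDet_euler_pos hr h hx.2
    have hx0 : 0 < x 0 := hx.1
    rw [(hD x hx).2, abs_of_pos (by positivity), coneMap,
      ContinuousLinearEquiv.symm_apply_apply]
    have hg : dil r (gproj m (dil (x 0 / r) p)) = p := by
      rw [gproj, hm_cone x hx, dil_dil, dil_dil]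
      have : r * (x 0)⁻¹ * (x 0 / r) = 1 := by field_simp
      rw [this, dil_one]
    set L : C2 →L[ℝ] ℂ := Complex.ofRealCLM.comp (fderiv ℝ m p) with hL
    have hLd : fderiv ℝ (fun z => (m z : ℂ)) p = L :=
      (Complex.ofRealCLM.hasFDerivAt.comp p (hm.diff hp0).hasFDerivAt).fderiv
    have key := form21_mul_apply (P p) (Q p) L (euler p) (tangentFrame ψ y) (fun k => by
      change Complex.ofRealCLM (fderiv ℝ m (ψ y) (tangentFrame ψ y k)) = 0
      rw [hm.fderiv_tangentFrame hr h.isOpen h.smooth hmap hx.2 k, map_zero])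
    have hLe : L (euler p) = r := by
      simp [hL, hm.fderiv_euler hp0, hp]
    rw [hLe] at key
    simp only [← hy, ← hpdef]
    have hmc : m (dil (x 0 / r) p) = x 0 := hm_cone x hx
    simp only [hF, levelDensity, hg, hmc, (hm.dbr_dil hs hp0).1,
      (hm.dbr_dil hs hp0).2]
    rw [dbr, dbr, hLd]
    have hr' : (r : ℂ) ≠ 0 := by exact_mod_cast hr.ne'
    have hx' : (x 0 : ℂ) ≠ 0 := by exact_mod_cast hx0.ne'
    rw [Complex.real_smul]
    apply mul_right_cancel₀ hr'
    rw [mul_assoc (cutoff (x 0) : ℂ) (form21 _ _ _), key]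
    push_cast
    field_simp
  have hcov := integral_image_eq_integral_abs_det_fderiv_smul volume hSo.measurableSet
    (fun x hx => (hD x hx).1.hasFDerivWithinAt) hinj (fun x => -4 * F (realCoordsL.symm x))
  rw [setIntegral_eq_integral_of_forall_compl_eq_zero
    (fun x hx => by rw [hzero x hx, mul_zero]), setIntegral_congr_fun hSo.measurableSet hval,
    integral_const_mul, integral_comp_realCoordsL_symm] at hcov
  rw [levelIntegral, hcov]
  set g : (Fin 3 → ℝ) → ℂ := fun y => form21 (P (ψ y)) (Q (ψ y)) (tangentFrame ψ y) with hg
  have hpre : S = (MeasurableEquiv.piFinSuccAbove (fun _ : Fin 4 => ℝ) 0) ⁻¹' (Ioi 0 ×ˢ V) := by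
    ext x
    rfl
  have hmp := volume_preserving_piFinSuccAbove (fun _ : Fin 4 => ℝ) 0
  have h1 := hmp.setIntegral_preimage_emb
    (MeasurableEquiv.piFinSuccAbove (fun _ : Fin 4 => ℝ) 0).measurableEmbedding
    (fun q : ℝ × (Fin 3 → ℝ) => (cutoff q.1 : ℂ) * g q.2) (Ioi 0 ×ˢ V)
  rw [← hpre] at h1
  have h2 : ∫ x in S, (cutoff (x 0) : ℂ) * g (Fin.tail x) =
      ∫ q in Ioi (0 : ℝ) ×ˢ V, (cutoff q.1 : ℂ) * g q.2 := h1
  -- The radial factor has mass one, whatever the bump.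
  have h3 : ∫ t in Ioi (0 : ℝ), (cutoff t : ℂ) = 1 := by
    rw [setIntegral_eq_integral_of_forall_compl_eq_zero, integral_complex_ofReal, integral_cutoff,
      Complex.ofReal_one]
    intro t ht
    rw [cutoff_eq_zero fun h => ht (by simp only [mem_Ioi]; linarith [h.1]), Complex.ofReal_zero]
  rw [h2, Measure.volume_eq_prod, setIntegral_prod_mul (fun t : ℝ => (cutoff t : ℂ)) g, h3, one_mul]

/-- The boundary integral of a `(2,1)`-form over a sublevel set of a gauge. -/
theorem boundaryIntegral_eq (hm : IsGauge m c C) {r : ℝ} (hr : 0 < r) {P Q : C2 → ℂ}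
    (hP : ∀ p, m p = r → ContinuousAt P p) (hQ : ∀ p, m p = r → ContinuousAt Q p)
    {Θ : C2 → (Fin 3 → C2) → ℂ} (hΘ : ∀ p, m p = r → ∀ h, Θ p h = form21 (P p) (Q p) h)
    {J : ℂ} (hJ : IsBoundaryIntegral {w | m w ≤ r} Θ J) :
    J = levelIntegral m (fun p => (r : ℂ) ^ 5 * P (dil r p))
        (fun p => (r : ℂ) ^ 4 * Q (dil r p)) := by
  obtain ⟨N, V, K, ψ, χ, hor, hK, hχ, hsupp, hsum, rfl⟩ := hJ
  rw [hm.frontier_sublevel hr] at hsupp hsum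
  have e1 : ∀ i, ∫ y in V i, (χ i (ψ i y) : ℂ) * Θ (ψ i y) (tangentFrame (ψ i) y) =
      levelIntegral m (fun p => (r : ℂ) ^ 5 * ((χ i (dil r p) : ℂ) * P (dil r p)))
        (fun p => (r : ℂ) ^ 4 * ((χ i (dil r p) : ℂ) * Q (dil r p))) := by
    intro i
    -- The patch formula is applied to χ_i Θ, which vanishes on {m = r} off the image of V_i.
    rw [← hm.integral_patch hr (hor i) (P := fun p => (χ i p : ℂ) * P p)
      (Q := fun p => (χ i p : ℂ) * Q p)]
    · refine setIntegral_congr_fun (hor i).isOpen.measurableSet fun y hy => ?_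
      have : m (ψ i y) = r := by
        have := (hor i).mapsTo hy
        rwa [hm.frontier_sublevel hr] at this
      simp only [hΘ _ this, form21]
      ring
    · intro p hp hpV
      have : χ i p = 0 := by
        by_contra h0
        exact hpV (image_mono (hK i).2 (hsupp i p hp h0))
      simp [this]
  have hcont : ∀ (R : C2 → ℂ), (∀ p, m p = r → ContinuousAt R p) → ∀ p, m p = 1 →
      ContinuousAt (fun p => R (dil r p)) p := fun R hR p hp =>
    ContinuousAt.comp (f := fun p => dil r p) (hR _ (by rw [hm.hom r hr, hp, mul_one]))
      (dil r).continuous.continuousAt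
  have hχc : ∀ i p, ContinuousAt (fun p => (χ i p : ℂ)) p := fun i p =>
    (Complex.continuous_ofReal.comp (hχ i).1.continuous).continuousAt
  simp only [e1, levelIntegral]
  rw [← Finset.mul_sum, ← integral_finsetSum]
  · congr 1
    refine integral_congr_ae ?_
    have hne : ∀ᵐ w : C2, w ≠ 0 := by simp [ae_iff]
    filter_upwards [hne] with w hw
    have hp : m (dil r (gproj m w)) = r := by
      rw [hm.hom r hr, hm.gproj_eq_one hw, mul_one]
    -- The density only sees its form on the level set, which is where the χ_i sum to 1.
    have hs : ∑ i, (χ i (dil r (gproj m w)) : ℂ) = 1 := by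
      rw [← Complex.ofReal_sum, hsum _ hp, Complex.ofReal_one]
    simp only [levelDensity]
    conv_rhs => rw [← one_mul (_ * _), ← hs, Finset.sum_mul]
    refine Finset.sum_congr rfl fun i _ => ?_
    ring
  · intro i _
    refine hm.integrable_levelDensity (fun p _ hp => continuousAt_const.mul ?_)
      (fun p _ hp => continuousAt_const.mul ?_)
    · exact hcont (fun p => (χ i p : ℂ) * P p) (fun p hp => (hχc i p).mul (hP p hp)) p hp
    · exact hcont (fun p => (χ i p : ℂ) * Q p) (fun p hp => (hχc i p).mul (hQ p hp)) p hp

end IsGauge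

/-! ### An atlas of the level set of a gauge -/

/-- The weights of the dilations in real coordinates. -/
def weight : Fin 4 → ℕ := ![2, 2, 1, 1]

lemma weight_pos (j : Fin 4) : 0 < weight j := by
  fin_cases j <;> simp [weight]

lemma realCoords_dil (s : ℝ) (w : C2) (j : Fin 4) :
    realCoords (dil s w) j = s ^ weight j * realCoords w j := by
  have h : ∀ z : ℂ, ((s : ℂ) ^ 2 * z).re = s ^ 2 * z.re ∧ ((s : ℂ) ^ 2 * z).im = s ^ 2 * z.im := by
    intro z
    rw [← Complex.ofReal_pow, Complex.re_ofReal_mul, Complex.im_ofReal_mul]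
    exact ⟨rfl, rfl⟩
  fin_cases j <;> simp [realCoords, weight, (h _).1, (h _).2]

lemma realCoords_euler (w : C2) (j : Fin 4) :
    realCoords (euler w) j = weight j * realCoords w j := by
  fin_cases j <;> simp [realCoords, weight]

lemma euler_dil (s : ℝ) (w : C2) : euler (dil s w) = dil s (euler w) := by
  apply C2_ext <;> simp
  ring

lemma hasFDerivAt_dil {s : ℝ} (hs : s ≠ 0) (w : C2) :
    HasFDerivAt (fun q : ℝ × C2 => dil q.1 q.2)
      ((ContinuousLinearMap.fst ℝ ℝ C2).smulRight (s⁻¹ • dil s (euler w)) +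
        (dil s).comp (ContinuousLinearMap.snd ℝ ℝ C2)) (s, w) := by
  have hd : DifferentiableAt ℝ (fun q : ℝ × C2 => dil q.1 q.2) (s, w) :=
    contDiff_dil.contDiffAt.differentiableAt (by simp)
  refine hd.hasFDerivAt.congr_fderiv ?_
  set G := fderiv ℝ (fun q : ℝ × C2 => dil q.1 q.2) (s, w) with hG
  have e0 : ∀ h, G (0, h) = dil s h := by
    intro h
    have a := HasFDerivAt.comp (g := fun q : ℝ × C2 => dil q.1 q.2)
      (f := fun z => (s, id z)) w hd.hasFDerivAt
      ((hasFDerivAt_const s w).prodMk (hasFDerivAt_id w))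
    have b := a.unique (dil s).hasFDerivAt
    have := congrArg (fun l : C2 →L[ℝ] C2 => l h) b
    simpa using this
  have e1 : G (1, 0) = s⁻¹ • dil s (euler w) := by
    have a := HasFDerivAt.comp_hasDerivAt (f := fun t : ℝ => (t, w)) (x := s)
      (l := fun q : ℝ × C2 => dil q.1 q.2) hd.hasFDerivAt
      ((hasDerivAt_id s).prodMk (hasDerivAt_const s w))
    exact a.unique (hasDerivAt_dil hs w)
  refine ContinuousLinearMap.ext fun q => ?_
  have : q = q.1 • ((1 : ℝ), (0 : C2)) + (0, q.2) := by simp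
  conv_lhs => rw [this, map_add, map_smul, e0, e1]
  simp

/-- A sign change of the first coordinate. -/
def flipFst (δ : ℝ) (y : Fin 3 → ℝ) : Fin 3 → ℝ := ![δ * y 0, y 1, y 2]

lemma flipFst_flipFst {δ : ℝ} (hδ : δ * δ = 1) (y : Fin 3 → ℝ) : flipFst δ (flipFst δ y) = y := by
  funext k
  fin_cases k
  · simp [flipFst, ← mul_assoc, hδ]
  · rfl
  · rfl

lemma continuous_flipFst (δ : ℝ) : Continuous (flipFst δ) := by
  refine continuous_pi fun k => ?_
  fin_cases k
  · exact continuous_const.mul (continuous_apply 0)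
  · exact continuous_apply 1
  · exact continuous_apply 2

/-- The affine parametrisation of the hyperplane on which the `i`-th real coordinate is `ε`. -/
def slice (i : Fin 4) (ε : ℝ) (y : Fin 3 → ℝ) : C2 :=
  realCoordsL.symm (i.insertNth ε (flipFst (ε * (-1) ^ (i : ℕ)) y))

lemma realCoords_slice (i : Fin 4) (ε : ℝ) (y : Fin 3 → ℝ) :
    realCoords (slice i ε y) = i.insertNth ε (flipFst (ε * (-1) ^ (i : ℕ)) y) := by
  rw [slice, ← realCoordsL_apply, ContinuousLinearEquiv.apply_symm_apply]

lemma slice_ne_zero (i : Fin 4) {ε : ℝ} (hε : ε ≠ 0) (y : Fin 3 → ℝ) : slice i ε y ≠ 0 := by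
  intro h
  have h1 := realCoords_slice i ε y
  rw [h, ← realCoordsL_apply, map_zero] at h1
  have := congrFun h1 i
  rw [Fin.insertNth_apply_same] at this
  exact hε this.symm

/-- The linear part of `slice`. -/
def sliceL (i : Fin 4) (ε : ℝ) : (Fin 3 → ℝ) →L[ℝ] C2 :=
  (realCoordsL.symm : (Fin 4 → ℝ) →L[ℝ] C2).comp
    (LinearMap.toContinuousLinearMap
      { toFun := fun y => i.insertNth 0 (flipFst (ε * (-1) ^ (i : ℕ)) y)
        map_add' := fun y z => by
          funext j
          rcases Fin.eq_self_or_eq_succAbove i j with rfl | ⟨k, rfl⟩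
          · simp
          · simp only [Fin.insertNth_apply_succAbove, Pi.add_apply]
            fin_cases k <;> simp [flipFst, mul_add]
        map_smul' := fun t y => by
          funext j
          rcases Fin.eq_self_or_eq_succAbove i j with rfl | ⟨k, rfl⟩
          · simp
          · simp only [Fin.insertNth_apply_succAbove, Pi.smul_apply, RingHom.id_apply]
            fin_cases k <;> simp [flipFst, mul_left_comm] })

lemma slice_eq (i : Fin 4) (ε : ℝ) (y : Fin 3 → ℝ) :
    slice i ε y = realCoordsL.symm (Pi.single i ε) + sliceL i ε y := by
  rw [slice]
  simp only [sliceL, ContinuousLinearMap.comp_apply, ContinuousLinearEquiv.coe_coe]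
  rw [← map_add]
  congr 1
  funext j
  rcases Fin.eq_self_or_eq_succAbove i j with rfl | ⟨k, rfl⟩
  · simp
  · simp

lemma hasFDerivAt_slice (i : Fin 4) (ε : ℝ) (y : Fin 3 → ℝ) :
    HasFDerivAt (slice i ε) (sliceL i ε) y := by
  have : slice i ε = fun y => realCoordsL.symm (Pi.single i ε) + sliceL i ε y :=
    funext (slice_eq i ε)
  rw [this]
  exact (sliceL i ε).hasFDerivAt.const_add _

lemma contDiff_slice (i : Fin 4) (ε : ℝ) : ContDiff ℝ ∞ (slice i ε) := by
  have : slice i ε = fun y => realCoordsL.symm (Pi.single i ε) + sliceL i ε y :=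
    funext (slice_eq i ε)
  rw [this]
  exact contDiff_const.add (sliceL i ε).contDiff

/-- In column i only the Euler row is nonzero, with entry `weight i` · ε and cofactor sign (−1)^i.
The sign ε(−1)^i built into `slice` cancels both, so all eight charts are positively oriented. -/
lemma frameDet_slice (i : Fin 4) {ε : ℝ} (hε : ε * ε = 1) (y : Fin 3 → ℝ) :
    frameDet (euler (slice i ε y)) (fun k => sliceL i ε (Pi.single k 1)) = weight i := by
  have hb : ∀ k, realCoords (sliceL i ε (Pi.single k 1)) =
      i.insertNth 0 (flipFst (ε * (-1) ^ (i : ℕ)) (Pi.single k 1)) := fun k => by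
    rw [← realCoordsL_apply]
    simp [sliceL]
  have he : realCoords (euler (slice i ε y)) = fun j => (weight j : ℝ) *
      (i.insertNth ε (flipFst (ε * (-1) ^ (i : ℕ)) y) : Fin 4 → ℝ) j := by
    funext j
    rw [realCoords_euler, realCoords_slice]
  set δ := ε * (-1) ^ (i : ℕ) with hδ
  set A : Matrix (Fin 4) (Fin 4) ℝ := Matrix.of ![realCoords (euler (slice i ε y)),
    realCoords (sliceL i ε (Pi.single 0 1)), realCoords (sliceL i ε (Pi.single 1 1)),
    realCoords (sliceL i ε (Pi.single 2 1))] with hA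
  have hA0 : A 0 i = weight i * ε := by
    change realCoords (euler (slice i ε y)) i = _
    rw [he]
    simp only [Fin.insertNth_apply_same]
  have hAs : ∀ k : Fin 3, A k.succ = i.insertNth 0 (flipFst δ (Pi.single k 1)) := fun k => by
    rw [← hb]
    fin_cases k <;> rfl
  have hsub : A.submatrix Fin.succ i.succAbove = Matrix.diagonal ![δ, 1, 1] := by
    ext k l
    rw [Matrix.submatrix_apply, hAs, Fin.insertNth_apply_succAbove]
    fin_cases k <;> fin_cases l <;> simp [flipFst]
  change A.det = _
  rw [Matrix.det_succ_column A i, Fin.sum_univ_succ, Finset.sum_eq_zero (fun k _ => by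
    rw [hAs, Fin.insertNth_apply_same]; ring), Fin.succAbove_zero, hsub, Matrix.det_diagonal, hA0,
    Fin.prod_univ_three]
  have h1 : ((-1 : ℝ) ^ (i : ℕ)) * (-1) ^ (i : ℕ) = 1 := by
    rw [← mul_pow]; simp
  simp only [Matrix.cons_val_zero, Matrix.cons_val_one, Matrix.cons_val, Fin.val_zero, zero_add,
    add_zero, mul_one, hδ]
  linear_combination (weight i : ℝ) * (ε * ε) * h1 + (weight i : ℝ) * hε

lemma frameDet_add_smul (n : C2) (h : Fin 3 → C2) (a : Fin 3 → ℝ) :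
    frameDet n (fun k => a k • n + h k) = frameDet n h := by
  simp [frameDet_eq]
  ring

namespace IsGauge

variable {m : C2 → ℝ} {c C : ℝ}

/-- The parametrisation of the level set by a hyperplane. -/
def chart (m : C2 → ℝ) (r : ℝ) (i : Fin 4) (ε : ℝ) (y : Fin 3 → ℝ) : C2 :=
  dil (r / m (slice i ε y)) (slice i ε y)

lemma chart_mem (hm : IsGauge m c C) {r : ℝ} (hr : 0 < r) (i : Fin 4) {ε : ℝ} (hε : ε ≠ 0)
    (y : Fin 3 → ℝ) : m (chart m r i ε y) = r := by
  have h := hm.pos _ (slice_ne_zero i hε y)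
  rw [chart, hm.hom _ (div_pos hr h), div_mul_cancel₀ _ h.ne']

lemma contDiff_chart (hm : IsGauge m c C) (r : ℝ) (i : Fin 4) {ε : ℝ} (hε : ε ≠ 0) :
    ContDiff ℝ ∞ (chart m r i ε) := by
  rw [contDiff_iff_contDiffAt]
  intro y
  have h0 := slice_ne_zero i hε y
  have h1 : ContDiffAt ℝ ∞ (fun y => r / m (slice i ε y)) y := by
    simp only [div_eq_mul_inv]
    exact contDiffAt_const.mul ((ContDiffAt.comp y (hm.smooth _ h0)
      (contDiff_slice i ε).contDiffAt).inv (hm.pos _ h0).ne')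
  exact h1.dil (contDiff_slice i ε).contDiffAt

/-- The i-th real coordinate of the image is the dilation factor to the power `weight i`, times ε.
It determines the factor, and then the point of the hyperplane. -/
lemma injective_chart (hm : IsGauge m c C) {r : ℝ} (hr : 0 < r) (i : Fin 4) {ε : ℝ}
    (hε : ε * ε = 1) : Function.Injective (chart m r i ε) := by
  intro y y' h
  have hε0 : ε ≠ 0 := fun h0 => by simp [h0] at hε
  have p := div_pos hr (hm.pos _ (slice_ne_zero i hε0 y))
  have p' := div_pos hr (hm.pos _ (slice_ne_zero i hε0 y'))
  have h1 : ∀ y, realCoords (chart m r i ε y) i = (r / m (slice i ε y)) ^ weight i * ε := fun y => by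
    rw [chart, realCoords_dil, realCoords_slice, Fin.insertNth_apply_same]
  have h2 : (r / m (slice i ε y)) ^ weight i = (r / m (slice i ε y')) ^ weight i := by
    have := h1 y
    rw [h, h1 y'] at this
    exact (mul_right_cancel₀ hε0 this).symm
  have h3 := (pow_left_inj₀ p.le p'.le (weight_pos i).ne').1 h2
  have h4 : slice i ε y = slice i ε y' := by
    unfold chart at h
    rw [← dil_inv_dil p.ne' (slice i ε y), h, h3, dil_inv_dil p'.ne']
  have h5 := realCoords_slice i ε y
  rw [h4, realCoords_slice] at h5
  have h6 : flipFst (ε * (-1) ^ (i : ℕ)) y' = flipFst (ε * (-1) ^ (i : ℕ)) y := by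
    funext k
    have := congrFun h5 (i.succAbove k)
    simpa only [Fin.insertNth_apply_succAbove] using this
  have hδ : (ε * (-1) ^ (i : ℕ)) * (ε * (-1) ^ (i : ℕ)) = 1 := by
    have : ((-1 : ℝ) ^ (i : ℕ)) * (-1) ^ (i : ℕ) = 1 := by rw [← mul_pow]; simp
    linear_combination (ε * ε) * this + hε
  rw [← flipFst_flipFst hδ y, ← h6, flipFst_flipFst hδ]

/-- The inverse of `chart`. -/
def chartInv (i : Fin 4) (ε : ℝ) (p : C2) : Fin 3 → ℝ :=
  flipFst (ε * (-1) ^ (i : ℕ))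
    (fun k => realCoords (dil (((ε * realCoords p i)⁻¹) ^ ((weight i : ℝ)⁻¹)) p) (i.succAbove k))

lemma chart_chartInv (hm : IsGauge m c C) {r : ℝ} (i : Fin 4) {ε : ℝ}
    (hε : ε * ε = 1) {p : C2} (hp : m p = r) (hpi : 0 < ε * realCoords p i) :
    chart m r i ε (chartInv i ε p) = p := by
  have hδ : (ε * (-1) ^ (i : ℕ)) * (ε * (-1) ^ (i : ℕ)) = 1 := by
    have : ((-1 : ℝ) ^ (i : ℕ)) * (-1) ^ (i : ℕ) = 1 := by rw [← mul_pow]; simp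
    linear_combination (ε * ε) * this + hε
  -- The factor that dilates p to the hyperplane where the i-th coordinate is ε; here ε² = 1 makes ε
  -- its own inverse.
  set t := ((ε * realCoords p i)⁻¹) ^ ((weight i : ℝ)⁻¹) with ht
  have ht0 : 0 < t := Real.rpow_pos_of_pos (inv_pos.2 hpi) _
  have htw : t ^ weight i = (ε * realCoords p i)⁻¹ :=
    Real.rpow_inv_natCast_pow (inv_pos.2 hpi).le (weight_pos i).ne'
  have hs : slice i ε (chartInv i ε p) = dil t p := by
    apply realCoordsL.injective
    rw [realCoordsL_apply, realCoordsL_apply, realCoords_slice, chartInv, flipFst_flipFst hδ]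
    funext j
    rcases Fin.eq_self_or_eq_succAbove i j with rfl | ⟨k, rfl⟩
    · rw [Fin.insertNth_apply_same, realCoords_dil, htw]
      rw [eq_comm, inv_mul_eq_iff_eq_mul₀ hpi.ne']
      linear_combination (-realCoords p j) * hε
    · rw [Fin.insertNth_apply_succAbove]
  have hp0 : 0 < r := by
    rw [← hp]
    refine hm.pos p fun h0 => ?_
    rw [h0, ← realCoordsL_apply, map_zero] at hpi
    simp at hpi
  rw [chart, hs, hm.hom t ht0, hp, dil_dil]
  have : r / (t * r) * t = 1 := by field_simp
  rw [this, dil_one]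

lemma continuousOn_chartInv (i : Fin 4) (ε : ℝ) :
    ContinuousOn (chartInv i ε) {p | 0 < ε * realCoords p i} := by
  have hc : ∀ j, Continuous (fun p : C2 => realCoords p j) := fun j =>
    (continuous_apply j).comp realCoordsL.continuous
  have h1 : ContinuousOn (fun p : C2 => ((ε * realCoords p i)⁻¹) ^ ((weight i : ℝ)⁻¹))
      {p | 0 < ε * realCoords p i} := by
    intro p (hp : 0 < ε * realCoords p i)
    refine ContinuousAt.continuousWithinAt ?_
    exact ((continuous_const.mul (hc i)).continuousAt.inv₀ hp.ne').rpow_const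
      (Or.inl (inv_pos.2 hp).ne')
  have h2 : ContinuousOn (fun p : C2 => dil (((ε * realCoords p i)⁻¹) ^ ((weight i : ℝ)⁻¹)) p)
      {p | 0 < ε * realCoords p i} :=
    contDiff_dil.continuous.comp_continuousOn (h1.prodMk continuousOn_id)
  refine (continuous_flipFst _).comp_continuousOn (continuousOn_pi.2 fun k => ?_)
  exact (hc _).comp_continuousOn h2

lemma isOutward_euler (hm : IsGauge m c C) {r : ℝ} (hr : 0 < r) {p : C2} (hp : m p = r) :
    IsOutward {w | m w ≤ r} p (euler p) := by
  have hp0 := hm.ne_zero_of_eq hr hp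
  have hd : HasDerivAt (fun t : ℝ => m (p + t • euler p)) r 0 := by
    have h1 : HasDerivAt (fun t : ℝ => p + t • euler p) (euler p) 0 := by
      simpa using ((hasDerivAt_id (0 : ℝ)).smul_const (euler p)).const_add p
    have hf : HasFDerivAt m (fderiv ℝ m p) (p + (0 : ℝ) • euler p) := by
      rw [zero_smul, add_zero]; exact (hm.diff hp0).hasFDerivAt
    have := hf.comp_hasDerivAt (0 : ℝ) h1
    rwa [hm.fderiv_euler hp0, hp] at this
  have hs := (hasDerivAt_iff_tendsto_slope.1 hd).eventually (lt_mem_nhds hr)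
  have key : ∀ᶠ t : ℝ in 𝓝[≠] 0, 0 < t⁻¹ * (m (p + t • euler p) - r) := by
    filter_upwards [hs] with t ht
    simpa [slope, hp] using ht
  have h1 : ∀ᶠ t : ℝ in 𝓝[>] 0, 0 < t⁻¹ * (m (p + t • euler p) - r) :=
    key.filter_mono (nhdsWithin_mono (0 : ℝ) fun x (hx : 0 < x) => ne_of_gt hx)
  have hneg : Tendsto (fun t : ℝ => -t) (𝓝[>] 0) (𝓝[≠] 0) := by
    refine tendsto_nhdsWithin_iff.2 ⟨?_, ?_⟩
    · have : Tendsto (fun t : ℝ => -t) (𝓝 0) (𝓝 0) := by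
        simpa using (continuous_neg (G := ℝ)).tendsto 0
      exact this.mono_left inf_le_left
    · filter_upwards [self_mem_nhdsWithin] with t ht
      exact neg_ne_zero.2 (ne_of_gt ht)
  have h2 := hneg.eventually key
  filter_upwards [h1, h2, self_mem_nhdsWithin] with t a b ht
  have ht' : (0 : ℝ) < t := ht
  have hti := inv_pos.2 ht'
  rw [hm.interior_sublevel hr]
  constructor
  · have := (mul_pos_iff_of_pos_left hti).1 a
    simp only [not_le]
    linarith
  · rw [inv_neg, neg_smul, ← sub_eq_add_neg, neg_mul, ← mul_neg] at b
    have := (mul_pos_iff_of_pos_left hti).1 b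
    simp only [mem_ofPred_eq]
    linarith

lemma isOrientedParam_chart (hm : IsGauge m c C) {r : ℝ} (hr : 0 < r) (i : Fin 4) {ε : ℝ}
    (hε : ε * ε = 1) : IsOrientedParam {w | m w ≤ r} univ (chart m r i ε) := by
  have hε0 : ε ≠ 0 := fun h0 => by simp [h0] at hε
  refine ⟨isOpen_univ, (hm.contDiff_chart r i hε0).contDiffOn,
    (hm.injective_chart hr i hε).injOn, fun y _ => ?_, fun y _ => ?_⟩
  · rw [hm.frontier_sublevel hr]
    exact hm.chart_mem hr i hε0 y
  · refine ⟨euler (chart m r i ε y), hm.isOutward_euler hr (hm.chart_mem hr i hε0 y), ?_⟩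
    have hw0 := slice_ne_zero i hε0 y
    have hmw := hm.pos _ hw0
    set s := r / m (slice i ε y) with hs
    have hs0 : 0 < s := div_pos hr hmw
    have hd : DifferentiableAt ℝ (fun y => r / m (slice i ε y)) y := by
      simp only [div_eq_mul_inv]
      exact (DifferentiableAt.comp y (hm.diff hw0)
        (hasFDerivAt_slice i ε y).differentiableAt).inv hmw.ne' |>.const_mul r
    have h1 : HasFDerivAt (chart m r i ε) _ y :=
      HasFDerivAt.comp (g := fun q : ℝ × C2 => dil q.1 q.2)
        (f := fun y => (r / m (slice i ε y), slice i ε y)) y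
        (hasFDerivAt_dil hs0.ne' (slice i ε y)) (hd.hasFDerivAt.prodMk (hasFDerivAt_slice i ε y))
    set a : Fin 3 → ℝ := fun k =>
      fderiv ℝ (fun y => r / m (slice i ε y)) y (Pi.single k 1) * s⁻¹ with ha
    -- The variation of the dilation factor adds multiples of the Euler vector, which do not affect
    -- a determinant whose first row is that vector.
    have h2 : tangentFrame (chart m r i ε) y = fun k => a k • euler (chart m r i ε y) +
        dil s (sliceL i ε (Pi.single k 1)) := by
      funext k
      rw [tangentFrame, h1.fderiv, chart, euler_dil, ha]
      simp [smul_smul]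
      rfl
    change 0 < frameDet (euler (chart m r i ε y)) (tangentFrame (chart m r i ε) y)
    rw [h2, frameDet_add_smul, chart, euler_dil, ← hs, frameDet_dil, frameDet_slice i hε]
    have := weight_pos i
    positivity

/-- The sign attached to an element of `Fin 2`. -/
def signOf (σ : Fin 2) : ℝ := if σ = 0 then 1 else -1

lemma signOf_mul_self (σ : Fin 2) : signOf σ * signOf σ = 1 := by
  unfold signOf; split_ifs <;> norm_num

/-- The boundary integral over a sublevel set of a gauge exists. -/
theorem exists_boundaryIntegral (hm : IsGauge m c C) {r : ℝ} (hr : 0 < r)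
    (Θ : C2 → (Fin 3 → C2) → ℂ) : ∃ J, IsBoundaryIntegral {w | m w ≤ r} Θ J := by
  set M : Set C2 := {w | m w = r} with hM
  have hMc : IsClosed M := isClosed_eq hm.continuous continuous_const
  have hMk : IsCompact M := by
    refine (isCompact_quasi_Icc 0 (r ^ 4 / c)).of_isClosed_subset hMc fun w (hw : m w = r) => ?_
    refine ⟨quasi_nonneg w, ?_⟩
    rw [le_div_iff₀ hm.c_pos, ← hw, mul_comm]
    exact hm.lower w
  set ix : Fin (4 * 2) → Fin 4 := fun q => (finProdFinEquiv.symm q).1 with hix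
  set sg : Fin (4 * 2) → ℝ := fun q => signOf (finProdFinEquiv.symm q).2 with hsg
  -- Eight open half-spaces, one for each real coordinate and sign; they cover every nonzero point.
  set U : Fin (4 * 2) → Set C2 := fun q => {p | 0 < sg q * realCoords p (ix q)} with hU
  have hc : ∀ j, Continuous (fun p : C2 => realCoords p j) := fun j =>
    (continuous_apply j).comp realCoordsL.continuous
  have hUo : ∀ q, IsOpen (U q) := fun q =>
    isOpen_lt continuous_const (continuous_const.mul (hc _))
  have hcov : M ⊆ ⋃ q, U q := by
    intro p hp
    have hp0 := hm.ne_zero_of_eq hr hp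
    have : ∃ j, realCoords p j ≠ 0 := by
      by_contra! h
      apply hp0
      apply realCoordsL.injective
      rw [map_zero]
      funext j
      exact h j
    obtain ⟨j, hj⟩ := this
    rw [mem_iUnion]
    rcases lt_or_gt_of_ne hj with h | h
    · refine ⟨finProdFinEquiv (j, 1), ?_⟩
      simp only [hU, hsg, hix, Equiv.symm_apply_apply, mem_ofPred_eq, signOf]
      norm_num
      exact h
    · refine ⟨finProdFinEquiv (j, 0), ?_⟩
      simp only [hU, hsg, hix, Equiv.symm_apply_apply, mem_ofPred_eq, signOf]
      norm_num
      exact h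
  obtain ⟨f, hf⟩ := SmoothPartitionOfUnity.exists_isSubordinate
    (modelWithCornersSelf ℝ C2) hMc U hUo hcov
  have hsq : ∀ q, sg q * sg q = 1 := fun q => signOf_mul_self _
  -- Each chart is defined on all of ℝ³, and the compact set required by the definition is the
  -- preimage of the part of M in the support of the bump.
  refine ⟨_, 4 * 2, fun _ => univ, fun q => chartInv (ix q) (sg q) '' (tsupport (f q) ∩ M),
    fun q => chart m r (ix q) (sg q), fun q => f q, fun q => hm.isOrientedParam_chart hr _ (hsq q),
    fun q => ⟨?_, subset_univ _⟩, fun q => ⟨(f q).contMDiff.contDiff, f.nonneg q⟩, ?_, ?_, rfl⟩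
  · refine (hMk.inter_left (isClosed_tsupport _)).image_of_continuousOn
      ((continuousOn_chartInv _ _).mono fun p hp => hf q hp.1)
  · intro q p hp hne
    rw [hm.frontier_sublevel hr] at hp
    have hts : p ∈ tsupport (f q) := subset_tsupport _ hne
    exact ⟨_, ⟨p, ⟨hts, hp⟩, rfl⟩, hm.chart_chartInv _ (hsq q) hp (hf q hts)⟩
  · intro p hp
    rw [hm.frontier_sublevel hr] at hp
    rw [← finsum_eq_sum_of_fintype]
    exact f.sum_eq_one hp

end IsGauge

/-! ### The rescaled vector field and its norm -/

/-- The vector field, pulled back by the dilation of factor `r` and divided by `r²`. -/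
def sfield (a : ℂ) (r : ℝ) (w : C2) : C2 := ![w 0 * (a + r * w 1), -(w 1) ^ 2]

@[simp] lemma sfield_zero (a : ℂ) (r : ℝ) (w : C2) : sfield a r w 0 = w 0 * (a + r * w 1) := rfl
@[simp] lemma sfield_one (a : ℂ) (r : ℝ) (w : C2) : sfield a r w 1 = -(w 1) ^ 2 := rfl

/-- The components `∑ g_{i j̄} Y^j̄` of the metric dual of the rescaled field. -/
def scovec (a : ℂ) (g : C2 → Matrix (Fin 2) (Fin 2) ℂ) (i : Fin 2) (r : ℝ) (w : C2) : ℂ :=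
  ∑ j, g (dil r w) i j * (starRingEnd ℂ) (sfield a r w j)

/-- The Hermitian square of the rescaled field. -/
def sherm (a : ℂ) (g : C2 → Matrix (Fin 2) (Fin 2) ℂ) (r : ℝ) (w : C2) : ℂ :=
  ∑ i, scovec a g i r w * sfield a r w i

/-- The squared norm of the rescaled field. -/
def snorm (a : ℂ) (g : C2 → Matrix (Fin 2) (Fin 2) ℂ) (r : ℝ) (w : C2) : ℝ :=
  (sherm a g r w).re

variable {a : ℂ} {g : C2 → Matrix (Fin 2) (Fin 2) ℂ}

/-- This is why the weights are 2 and 1: both u and v² scale by r², and v in a + v is lower order.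
-/
lemma field_dil (a : ℂ) (r : ℝ) (w : C2) (i : Fin 2) :
    field a (dil r w) i = (r : ℂ) ^ 2 * sfield a r w i := by
  fin_cases i <;> simp [field] <;> ring

lemma sfield_dil (a : ℂ) (r t : ℝ) (w : C2) (i : Fin 2) :
    sfield a r (dil t w) i = (t : ℂ) ^ 2 * sfield a (r * t) w i := by
  fin_cases i <;> simp <;> ring

lemma scovec_dil (r t : ℝ) (w : C2) (i : Fin 2) :
    scovec a g i r (dil t w) = (t : ℂ) ^ 2 * scovec a g i (r * t) w := by
  simp only [scovec, dil_dil, sfield_dil, Finset.mul_sum, map_mul, map_pow, Complex.conj_ofReal]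
  exact Finset.sum_congr rfl fun j _ => by ring

lemma snorm_dil (r t : ℝ) (w : C2) : snorm a g r (dil t w) = t ^ 4 * snorm a g (r * t) w := by
  have : sherm a g r (dil t w) = ((t ^ 4 : ℝ) : ℂ) * sherm a g (r * t) w := by
    simp only [sherm, scovec_dil, sfield_dil, Finset.mul_sum]
    refine Finset.sum_congr rfl fun j _ => ?_
    push_cast
    ring
  rw [snorm, this, Complex.re_ofReal_mul, snorm]

lemma covec_dil (r : ℝ) (w : C2) (i : Fin 2) :
    ∑ j, g (dil r w) i j * star (field a (dil r w) j) = (r : ℂ) ^ 2 * scovec a g i r w := by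
  simp only [scovec, field_dil, Finset.mul_sum, Complex.star_def, map_mul, map_pow,
    Complex.conj_ofReal]
  exact Finset.sum_congr rfl fun j _ => by ring

lemma fieldNormSq_dil (r : ℝ) (w : C2) :
    fieldNormSq a g (dil r w) = r ^ 4 * snorm a g r w := by
  have : ∑ i, ∑ j, g (dil r w) i j * field a (dil r w) i * star (field a (dil r w) j) =
      ((r ^ 4 : ℝ) : ℂ) * sherm a g r w := by
    have h : ∀ i, ∑ j, g (dil r w) i j * field a (dil r w) i * star (field a (dil r w) j) =
        (∑ j, g (dil r w) i j * star (field a (dil r w) j)) * field a (dil r w) i := fun i => by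
      rw [Finset.sum_mul]
      exact Finset.sum_congr rfl fun j _ => by ring
    simp only [h, covec_dil, sherm, Finset.mul_sum]
    refine Finset.sum_congr rfl fun j _ => ?_
    rw [field_dil]
    push_cast
    ring
  rw [fieldNormSq, this, Complex.re_ofReal_mul, snorm]

lemma sherm_pos_of_posDef {r : ℝ} {w : C2} (hg : (g (dil r w)).PosDef)
    (hw : sfield a r w ≠ 0) : 0 < sherm a g r w := by
  -- The matrix acts on conjugated coefficients, so positivity is used at the conjugate vector.
  have := hg.dotProduct_mulVec_pos (star_ne_zero.2 hw)
  rw [star_star] at this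
  convert this using 1
  simp only [sherm, scovec, dotProduct, Matrix.mulVec, Pi.star_apply, Complex.star_def]
  exact Finset.sum_congr rfl fun i _ => by ring

/-- A smooth Hermitian metric near the origin, on the set where `quasi < s⁴`. -/
structure MetricNear (a : ℂ) (g : C2 → Matrix (Fin 2) (Fin 2) ℂ) (s : ℝ) : Prop where
  ha : a ≠ 0
  s_pos : 0 < s
  smooth : ∀ w, quasi w < s ^ 4 → ∀ i j, ContDiffAt ℝ ∞ (fun z => g z i j) w
  posDef : ∀ w, quasi w < s ^ 4 → (g w).PosDef
  le : s ≤ ‖a‖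

namespace MetricNear

variable {s : ℝ}

/-- The bound s ≤ ‖a‖ keeps the second zero v = −a of the u-coefficient out of the region. -/
lemma add_ne_zero (h : MetricNear a g s) {r : ℝ} {w : C2} (hw : quasi (dil r w) < s ^ 4) :
    a + r * w 1 ≠ 0 := by
  intro h0
  have h1 : (dil r w) 1 = -a := by rw [dil_apply_one]; linear_combination h0
  have h2 : ‖a‖ ^ 4 ≤ quasi (dil r w) := by
    rw [quasi, h1, Complex.normSq_neg, Complex.normSq_eq_norm_sq a]
    have := Complex.normSq_nonneg ((dil r w) 0)
    nlinarith
  have h3 := pow_le_pow_left₀ h.s_pos.le h.le 4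
  linarith

lemma sfield_ne_zero (h : MetricNear a g s) {r : ℝ} {w : C2} (hw : quasi (dil r w) < s ^ 4)
    (hw0 : w ≠ 0) : sfield a r w ≠ 0 := by
  intro h0
  have e0 := congrFun h0 0
  have e1 := congrFun h0 1
  simp only [sfield_zero, sfield_one, Pi.zero_apply, mul_eq_zero, neg_eq_zero,
    h.add_ne_zero hw, or_false] at e0 e1
  exact hw0 (C2_ext e0 (pow_eq_zero_iff two_ne_zero |>.1 e1))

lemma sherm_pos (h : MetricNear a g s) {r : ℝ} {w : C2} (hw : quasi (dil r w) < s ^ 4)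
    (hw0 : w ≠ 0) : 0 < sherm a g r w :=
  sherm_pos_of_posDef (h.posDef _ hw) (h.sfield_ne_zero hw hw0)

lemma snorm_pos (h : MetricNear a g s) {r : ℝ} {w : C2} (hw : quasi (dil r w) < s ^ 4)
    (hw0 : w ≠ 0) : 0 < snorm a g r w :=
  (Complex.pos_iff.1 (h.sherm_pos hw hw0)).1

lemma ofReal_snorm (h : MetricNear a g s) {r : ℝ} {w : C2} (hw : quasi (dil r w) < s ^ 4)
    (hw0 : w ≠ 0) : (snorm a g r w : ℂ) = sherm a g r w := by
  have := (Complex.pos_iff.1 (h.sherm_pos hw hw0)).2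
  apply Complex.ext
  · rfl
  · rw [Complex.ofReal_im]; exact this

lemma contDiffAt_sfield (a : ℂ) (i : Fin 2) (q : ℝ × C2) :
    ContDiffAt ℝ ∞ (fun q : ℝ × C2 => sfield a q.1 q.2 i) q := by
  have h1 : ContDiff ℝ ∞ (fun q : ℝ × C2 => (q.1 : ℂ)) :=
    Complex.ofRealCLM.contDiff.comp contDiff_fst
  have h2 : ∀ i, ContDiff ℝ ∞ (fun q : ℝ × C2 => q.2 i) := fun i =>
    (contDiff_apply ℝ ℂ i).comp contDiff_snd
  fin_cases i
  · exact ((h2 0).mul (contDiff_const.add (h1.mul (h2 1)))).contDiffAt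
  · exact ((h2 1).pow 2).neg.contDiffAt

lemma contDiffAt_scovec (h : MetricNear a g s) {q : ℝ × C2} (hq : quasi (dil q.1 q.2) < s ^ 4)
    (i : Fin 2) : ContDiffAt ℝ ∞ (fun q : ℝ × C2 => scovec a g i q.1 q.2) q := by
  refine ContDiffAt.sum fun j _ => ?_
  exact (ContDiffAt.comp q (h.smooth _ hq i j) contDiff_dil.contDiffAt).mul
    (Complex.conjCLE.contDiff.contDiffAt.comp q (contDiffAt_sfield a j q))

lemma contDiffAt_snorm (h : MetricNear a g s) {q : ℝ × C2} (hq : quasi (dil q.1 q.2) < s ^ 4) :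
    ContDiffAt ℝ ∞ (fun q : ℝ × C2 => snorm a g q.1 q.2) q := by
  have : ContDiffAt ℝ ∞ (fun q : ℝ × C2 => sherm a g q.1 q.2) q :=
    ContDiffAt.sum fun i _ => (h.contDiffAt_scovec hq i).mul (contDiffAt_sfield a i q)
  exact Complex.reCLM.contDiff.contDiffAt.comp q this

lemma hasDerivAt_snorm (h : MetricNear a g s) {r : ℝ} {w : C2} (hq : quasi (dil r w) < s ^ 4) :
    HasDerivAt (fun r => snorm a g r w)
      (fderiv ℝ (fun q : ℝ × C2 => snorm a g q.1 q.2) (r, w) (1, 0)) r := by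
  have hd : DifferentiableAt ℝ (fun q : ℝ × C2 => snorm a g q.1 q.2) (r, w) :=
    (h.contDiffAt_snorm hq).differentiableAt (by simp)
  exact HasFDerivAt.comp_hasDerivAt (f := fun t : ℝ => (t, w)) (x := r)
      (l := fun q : ℝ × C2 => snorm a g q.1 q.2) hd.hasFDerivAt
      ((hasDerivAt_id r).prodMk (hasDerivAt_const r w))

end MetricNear

/-! ### Uniform bounds from compactness -/

lemma exists_dil_eq {w : C2} (hw : w ≠ 0) :
    ∃ ρ > 0, ∃ z, quasi z = 1 ∧ dil ρ z = w ∧ ρ ^ 4 = quasi w := by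
  have hq := quasi_pos hw
  refine ⟨quasi w ^ ((4 : ℕ) : ℝ)⁻¹, Real.rpow_pos_of_pos hq _, dil (quasi w ^ ((4 : ℕ) : ℝ)⁻¹)⁻¹ w, ?_, ?_, ?_⟩
  · rw [quasi_dil, inv_pow, Real.rpow_inv_natCast_pow hq.le (by norm_num),
      inv_mul_cancel₀ hq.ne']
  · rw [dil_dil, mul_inv_cancel₀ (Real.rpow_pos_of_pos hq _).ne', dil_one]
  · exact Real.rpow_inv_natCast_pow hq.le (by norm_num)

/-- Quantitative bounds for the rescaled norm. -/
structure MetricScale (a : ℂ) (g : C2 → Matrix (Fin 2) (Fin 2) ℂ) (s c C : ℝ) : Prop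
    extends MetricNear a g s where
  c_pos : 0 < c
  C_pos : 0 < C
  lower : ∀ r w, quasi (dil r w) < s ^ 4 → c * quasi w ≤ snorm a g r w
  upper : ∀ r w, quasi (dil r w) < s ^ 4 → snorm a g r w ≤ C * quasi w
  deriv_pos : ∀ r t w, w ≠ 0 → 0 < t → quasi (dil (r * t) w) < s ^ 4 →
    ∃ d > 0, HasDerivAt (fun t => t ^ 4 * snorm a g (r * t) w) d t

lemma snorm_zero (r : ℝ) : snorm a g r 0 = 0 := by
  simp [snorm, sherm]

/-- By `snorm_dil`, all three estimates reduce to the compact set of (r, z) with `quasi z = 1` and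
|r| bounded. With w the ρ-dilate of z, the derivative in t is t³ρ⁴(4F + rtρ · ∂F/∂r) at (rtρ, z), so
it is positive once |rtρ| is small compared with F. -/
lemma MetricNear.exists_scale {s₀ : ℝ} (h : MetricNear a g s₀) :
    ∃ s c C, s ≤ s₀ ∧ MetricScale a g s c C := by
  set F : ℝ × C2 → ℝ := fun q => snorm a g q.1 q.2 with hF
  set D : ℝ × C2 → ℝ := fun q => fderiv ℝ F q (1, 0) with hD
  set s₂ := s₀ / 2 with hs₂
  have hs₂0 : 0 < s₂ := half_pos h.s_pos
  have hs₂1 : s₂ < s₀ := half_lt_self h.s_pos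
  set S : Set (ℝ × C2) := Icc (-s₂) s₂ ×ˢ {w : C2 | quasi w ∈ Icc 1 1} with hS
  have hSc : IsCompact S := isCompact_Icc.prod (isCompact_quasi_Icc 1 1)
  have hreg : ∀ q ∈ S, quasi (dil q.1 q.2) < s₀ ^ 4 := by
    rintro ⟨r, w⟩ ⟨hr, hw⟩
    have hw1 : quasi w = 1 := le_antisymm hw.2 hw.1
    have : |r| ≤ s₂ := abs_le.2 hr
    rw [quasi_dil, hw1, mul_one, ← (by decide : Even 4).pow_abs]
    exact pow_lt_pow_left₀ (this.trans_lt hs₂1) (abs_nonneg r) (by norm_num)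
  have hne : ∀ q ∈ S, q.2 ≠ 0 := by
    rintro ⟨r, w⟩ ⟨hr, hw⟩ h0
    simp only at h0
    have := hw.1
    rw [h0, quasi_zero] at this
    linarith
  have hFc : ContinuousOn F S := fun q hq =>
    (h.contDiffAt_snorm (hreg q hq)).continuousAt.continuousWithinAt
  have hDc : ContinuousOn D S := fun q hq => by
    have h1 : ContinuousAt (fderiv ℝ F) q :=
      ((h.contDiffAt_snorm (hreg q hq)).fderiv_right (m := 0) (by simp)).continuousAt
    exact (h1.clm_apply continuousAt_const).continuousWithinAt
  have hSn : S.Nonempty := by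
    refine ⟨(0, ![1, 0]), ⟨by constructor <;> linarith, ?_⟩⟩
    simp [quasi]
  obtain ⟨q₀, hq₀, hmin⟩ := hSc.exists_isMinOn hSn hFc
  obtain ⟨q₁, hq₁, hmax⟩ := hSc.exists_isMaxOn hSn hFc
  obtain ⟨M, hM⟩ := hSc.exists_bound_of_continuousOn hDc
  have hcpos : 0 < F q₀ := h.snorm_pos (hreg q₀ hq₀) (hne q₀ hq₀)
  have hCpos : 0 < F q₁ := h.snorm_pos (hreg q₁ hq₁) (hne q₁ hq₁)
  have hM0 : 0 ≤ M := (norm_nonneg _).trans (hM q₀ hq₀)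
  -- F q₀ is the minimum of F and M bounds |∂F/∂r|, so sM < F q₀ and the first-order term cannot
  -- outweigh 4F.
  set s := min s₂ (F q₀ / (M + 1)) with hs
  have hs0 : 0 < s := lt_min hs₂0 (div_pos hcpos (by linarith))
  have hss : s ≤ s₂ := min_le_left _ _
  have hsM : s * (M + 1) ≤ F q₀ := by
    rw [← le_div_iff₀ (by linarith)]; exact min_le_right _ _
  have hpow : s ^ 4 ≤ s₀ ^ 4 := pow_le_pow_left₀ hs0.le (hss.trans hs₂1.le) 4
  have key : ∀ r w ρ z, 0 < ρ → quasi z = 1 → dil ρ z = w → ρ ^ 4 = quasi w →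
      quasi (dil r w) < s ^ 4 → |r * ρ| < s := by
    intro r w ρ z hρ hz hzw hρw hq
    rw [← hzw, dil_dil, quasi_dil, hz, mul_one, ← (by decide : Even 4).pow_abs] at hq
    exact lt_of_pow_lt_pow_left₀ 4 hs0.le hq
  have mem : ∀ r z, |r| < s → quasi z = 1 → (r, z) ∈ S := by
    intro r z hr hz
    obtain ⟨h1, h2⟩ := abs_lt.1 hr
    exact ⟨⟨by linarith, by linarith⟩, ⟨hz.ge, hz.le⟩⟩
  refine ⟨s, F q₀, F q₁, hss.trans hs₂1.le, ⟨h.ha, hs0, fun w hw => h.smooth w (hw.trans_le hpow),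
    fun w hw => h.posDef w (hw.trans_le hpow), (hss.trans hs₂1.le).trans h.le⟩, hcpos, hCpos,
    ?_, ?_, ?_⟩
  · intro r w hq
    by_cases hw : w = 0
    · rw [hw, quasi_zero, mul_zero, snorm_zero]
    obtain ⟨ρ, hρ, z, hz, hzw, hρw⟩ := exists_dil_eq hw
    have h1 : F q₀ ≤ F (r * ρ, z) := hmin (mem _ z (key r w ρ z hρ hz hzw hρw hq) hz)
    rw [← hρw, ← hzw, snorm_dil, mul_comm]
    exact mul_le_mul_of_nonneg_left h1 (by positivity)
  · intro r w hq
    by_cases hw : w = 0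
    · rw [hw, quasi_zero, mul_zero, snorm_zero]
    obtain ⟨ρ, hρ, z, hz, hzw, hρw⟩ := exists_dil_eq hw
    have h1 : F (r * ρ, z) ≤ F q₁ := hmax (mem _ z (key r w ρ z hρ hz hzw hρw hq) hz)
    rw [← hρw, ← hzw, snorm_dil, mul_comm]
    exact mul_le_mul_of_nonneg_right h1 (by positivity)
  · intro r t w hw ht hq
    obtain ⟨ρ, hρ, z, hz, hzw, hρw⟩ := exists_dil_eq hw
    have hk := key _ w ρ z hρ hz hzw hρw hq
    have hmem := mem _ z hk hz
    have hfun : (fun t => t ^ 4 * snorm a g (r * t) w) =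
        fun t => (t * ρ) ^ 4 * snorm a g (r * (t * ρ)) z := by
      funext t
      rw [← hzw, snorm_dil]
      rw [mul_pow, mul_assoc, mul_assoc]
    rw [hfun]
    have e1 := (h.hasDerivAt_snorm (r := r * (t * ρ)) (w := z) (by
      have := hreg _ hmem
      rwa [mul_assoc] at this)).comp t (((hasDerivAt_id t).mul_const ρ).const_mul r)
    have e2 := (((hasDerivAt_id t).mul_const ρ).pow 4).mul e1
    refine ⟨_, ?_, e2⟩
    have hFq : F q₀ ≤ F (r * t * ρ, z) := hmin hmem
    have hDq := hM _ hmem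
    rw [Real.norm_eq_abs] at hDq
    rw [mul_assoc] at hFq hDq hk
    have hDq' : -(s * M) ≤ r * (t * ρ) * D (r * (t * ρ), z) := by
      have h1 : |r * (t * ρ) * D (r * (t * ρ), z)| ≤ s * M := by
        rw [abs_mul]
        exact mul_le_mul hk.le hDq (abs_nonneg _) hs0.le
      exact (abs_le.1 h1).1
    have hgoal : 0 < t ^ 3 * ρ ^ 4 * (4 * F (r * (t * ρ), z) +
        r * (t * ρ) * D (r * (t * ρ), z)) := by
      have : 0 < 4 * F (r * (t * ρ), z) + r * (t * ρ) * D (r * (t * ρ), z) := by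
        nlinarith
      positivity
    refine lt_of_lt_of_eq hgoal ?_
    simp only [id, one_mul, Nat.cast_ofNat, hF, hD]
    simp
    ring

/-! ### The gauges of the level sets -/

/-- `t` is the dilation factor that takes `w` to the level set of the rescaled norm. -/
def IsScale (a : ℂ) (g : C2 → Matrix (Fin 2) (Fin 2) ℂ) (s r : ℝ) (w : C2) (t : ℝ) : Prop :=
  0 < t ∧ quasi (dil (r * t) w) < s ^ 4 ∧ t ^ 4 * snorm a g (r * t) w = 1

open Classical in
/-- The gauge whose level set `1` is the level set `1` of the rescaled norm. -/
def gaugeOf (a : ℂ) (g : C2 → Matrix (Fin 2) (Fin 2) ℂ) (s r : ℝ) (w : C2) : ℝ :=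
  if h : ∃ t, IsScale a g s r w t then h.choose⁻¹ else 0

namespace MetricScale

variable {s c C : ℝ}

lemma mono (h : MetricScale a g s c C) {r t t' : ℝ} {w : C2} (hw : w ≠ 0) (ht : 0 < t)
    (htt : t < t') (hq : quasi (dil (r * t') w) < s ^ 4) :
    t ^ 4 * snorm a g (r * t) w < t' ^ 4 * snorm a g (r * t') w := by
  have hq' : ∀ x ∈ Icc t t', quasi (dil (r * x) w) < s ^ 4 := by
    intro x hx
    refine lt_of_le_of_lt ?_ hq
    rw [quasi_dil, quasi_dil, mul_pow, mul_pow]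
    have := pow_le_pow_left₀ (ht.le.trans hx.1) hx.2 4
    have h2 := quasi_nonneg w
    gcongr
  have hd : ∀ x ∈ Icc t t', ∃ d > 0, HasDerivAt (fun t => t ^ 4 * snorm a g (r * t) w) d x :=
    fun x hx => h.deriv_pos r x w hw (ht.trans_le hx.1) (hq' x hx)
  have := strictMonoOn_of_deriv_pos (convex_Icc t t')
    (f := fun t => t ^ 4 * snorm a g (r * t) w)
    (fun x hx => by
      obtain ⟨d, _, hd⟩ := hd x hx
      exact hd.continuousAt.continuousWithinAt)
    (fun x hx => by
      obtain ⟨d, hd0, hd⟩ := hd x (interior_subset hx)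
      rw [hd.deriv]; exact hd0)
  exact this (left_mem_Icc.2 htt.le) (right_mem_Icc.2 htt.le) htt

lemma isScale_unique (h : MetricScale a g s c C) {r t t' : ℝ} {w : C2} (hw : w ≠ 0)
    (ht : IsScale a g s r w t) (ht' : IsScale a g s r w t') : t = t' := by
  rcases lt_trichotomy t t' with hlt | heq | hgt
  · have := h.mono hw ht.1 hlt ht'.2.1
    rw [ht.2.2, ht'.2.2] at this
    exact absurd this (lt_irrefl _)
  · exact heq
  · have := h.mono hw ht'.1 hgt ht.2.1
    rw [ht.2.2, ht'.2.2] at this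
    exact absurd this (lt_irrefl _)

lemma gaugeOf_eq (h : MetricScale a g s c C) {r t : ℝ} {w : C2} (hw : w ≠ 0)
    (ht : IsScale a g s r w t) : gaugeOf a g s r w = t⁻¹ := by
  have hex : ∃ t, IsScale a g s r w t := ⟨t, ht⟩
  rw [gaugeOf, dif_pos hex, h.isScale_unique hw hex.choose_spec ht]

lemma exists_isScale (h : MetricScale a g s c C) {r : ℝ} (hr : r ^ 4 < c * s ^ 4) {w : C2}
    (hw : w ≠ 0) : ∃ t, IsScale a g s r w t := by
  have hq := quasi_pos hw
  have hc := h.c_pos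
  -- At T the lower bound c · `quasi` already forces the value 1, so the intermediate value theorem
  -- applies on [0, T]. The condition r⁴ < cs⁴ keeps the dilated point inside the region up to T.
  set T := ((c * quasi w)⁻¹) ^ ((4 : ℕ) : ℝ)⁻¹ with hT
  have hTpos : 0 < T := Real.rpow_pos_of_pos (by positivity) _
  have hT4 : T ^ 4 = (c * quasi w)⁻¹ := Real.rpow_inv_natCast_pow (by positivity) (by norm_num)
  have hqT : ∀ x ∈ Icc 0 T, quasi (dil (r * x) w) < s ^ 4 := by
    intro x hx
    have h1 := pow_le_pow_left₀ hx.1 hx.2 4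
    rw [quasi_dil, mul_pow]
    calc r ^ 4 * x ^ 4 * quasi w ≤ r ^ 4 * T ^ 4 * quasi w := by gcongr
      _ = r ^ 4 / c := by rw [hT4]; field_simp
      _ < s ^ 4 := by rw [div_lt_iff₀ hc]; linarith
  have hcont : ContinuousOn (fun t => t ^ 4 * snorm a g (r * t) w) (Icc 0 T) := by
    intro x hx
    have h1 := (h.hasDerivAt_snorm (hqT x hx)).continuousAt
    have h2 : ContinuousAt (fun t : ℝ => r * t) x := by fun_prop
    exact ((continuousAt_id.pow 4).mul
      (ContinuousAt.comp (g := fun r => snorm a g r w) h1 h2)).continuousWithinAt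
  have hTv : 1 ≤ T ^ 4 * snorm a g (r * T) w := by
    have h1 := h.lower _ w (hqT T ⟨hTpos.le, le_rfl⟩)
    rw [hT4]
    rw [inv_mul_eq_div, le_div_iff₀ (by positivity), one_mul]
    exact h1
  obtain ⟨t, ht, hval⟩ := intermediate_value_Icc hTpos.le hcont
    (show (1 : ℝ) ∈ Icc _ _ from ⟨by simp, hTv⟩)
  refine ⟨t, lt_of_le_of_ne ht.1 fun h0 => ?_, hqT t ht, hval⟩
  rw [← h0] at hval
  norm_num at hval

lemma exists_gaugeOf (h : MetricScale a g s c C) {r : ℝ} (hr : r ^ 4 < c * s ^ 4) {w : C2}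
    (hw : w ≠ 0) : ∃ t, IsScale a g s r w t ∧ gaugeOf a g s r w = t⁻¹ := by
  obtain ⟨t, ht⟩ := h.exists_isScale hr hw
  exact ⟨t, ht, h.gaugeOf_eq hw ht⟩

lemma gaugeOf_zero (a : ℂ) (g : C2 → Matrix (Fin 2) (Fin 2) ℂ) (s r : ℝ) :
    gaugeOf a g s r 0 = 0 := by
  rw [gaugeOf, dif_neg]
  rintro ⟨t, ht⟩
  have := ht.2.2
  rw [snorm_zero, mul_zero] at this
  exact zero_ne_one this

/-- Joint smoothness of the family of gauges. -/
lemma contDiffAt_gaugeOf (h : MetricScale a g s c C) {q : ℝ × C2} (hr : q.1 ^ 4 < c * s ^ 4)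
    (hw : q.2 ≠ 0) : ContDiffAt ℝ ∞ (fun q : ℝ × C2 => gaugeOf a g s q.1 q.2) q := by
  obtain ⟨r, w⟩ := q
  simp only at hr hw
  obtain ⟨t, ht⟩ := h.exists_isScale hr hw
  set f : (ℝ × C2) × ℝ → ℝ := fun x => x.2 ^ 4 * snorm a g (x.1.1 * x.2) x.1.2 with hf
  set u : (ℝ × C2) × ℝ := ((r, w), t) with hu
  have cdf : ContDiffAt ℝ ∞ f u := by
    refine (contDiffAt_snd.pow 4).mul ?_
    exact ContDiffAt.comp (g := fun q : ℝ × C2 => snorm a g q.1 q.2)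
      (f := fun x : (ℝ × C2) × ℝ => (x.1.1 * x.2, x.1.2)) u (h.contDiffAt_snorm ht.2.1)
      ((contDiffAt_fst.fst.mul contDiffAt_snd).prodMk contDiffAt_fst.snd)
  -- The t-derivative is nonzero, so the implicit function theorem solves for t in terms of (r, w),
  -- including near r = 0.
  obtain ⟨d, hd0, hd⟩ := h.deriv_pos r t w hw ht.1 ht.2.1
  have hinr : fderiv ℝ f u ∘L .inr ℝ (ℝ × C2) ℝ = ContinuousLinearMap.toSpanSingleton ℝ d := by
    have h1 := (cdf.differentiableAt (by simp)).hasFDerivAt.comp t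
      ((hasFDerivAt_const (r, w) t).prodMk (hasFDerivAt_id t))
    have h2 := h1.unique hd.hasFDerivAt
    rw [← h2]
    ext
    simp
  have if₂ : (fderiv ℝ f u ∘L .inr ℝ (ℝ × C2) ℝ).IsInvertible := by
    rw [hinr]
    refine ⟨ContinuousLinearEquiv.unitsEquivAut ℝ (Units.mk0 d hd0.ne'), ?_⟩
    ext
    simp
  set ψ := cdf.implicitFunction (by simp) if₂ with hψ
  have hψc : ContDiffAt ℝ ∞ ψ (r, w) := cdf.contDiffAt_implicitFunction (by simp) if₂
  have hψ0 : ψ (r, w) = t := cdf.implicitFunction_apply_self (by simp) if₂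
  have ev1 := cdf.eventually_apply_implicitFunction (by simp) if₂
  have ev2 : ∀ᶠ x in 𝓝 (r, w), 0 < ψ x :=
    hψc.continuousAt.eventually (lt_mem_nhds (by rw [hψ0]; exact ht.1))
  have ev3 : ∀ᶠ x : ℝ × C2 in 𝓝 (r, w), quasi (dil (x.1 * ψ x) x.2) < s ^ 4 := by
    have : ContinuousAt (fun x : ℝ × C2 => quasi (dil (x.1 * ψ x) x.2)) (r, w) := by
      refine continuous_quasi.continuousAt.comp ?_
      exact ContinuousAt.comp (g := fun q : ℝ × C2 => dil q.1 q.2)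
        (f := fun x : ℝ × C2 => (x.1 * ψ x, x.2)) contDiff_dil.continuous.continuousAt
        ((continuousAt_fst.mul hψc.continuousAt).prodMk continuousAt_snd)
    refine this.eventually (gt_mem_nhds ?_)
    simp only [hψ0]
    exact ht.2.1
  have ev4 : ∀ᶠ x : ℝ × C2 in 𝓝 (r, w), x.2 ≠ 0 :=
    continuousAt_snd.eventually_ne hw
  -- The implicit solution satisfies the conditions of `IsScale`, hence is the scale, by uniqueness.
  have hev : (fun q : ℝ × C2 => gaugeOf a g s q.1 q.2) =ᶠ[𝓝 (r, w)] fun x => (ψ x)⁻¹ := by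
    filter_upwards [ev1, ev2, ev3, ev4] with x h1 h2 h3 h4
    refine h.gaugeOf_eq h4 ⟨h2, h3, ?_⟩
    have : f u = 1 := ht.2.2
    rw [this] at h1
    exact h1
  refine ContDiffAt.congr_of_eventuallyEq ?_ hev
  exact hψc.inv (by rw [hψ0]; exact ht.1.ne')

/-- For r ≠ 0 the rescaled norm is not homogeneous, but its level set 1 meets each dilation orbit,
apart from the origin, once within the region, and 1/t is homogeneous by construction: dilating w by
l divides t by l. -/
lemma isGauge (h : MetricScale a g s c C) {r : ℝ} (hr : r ^ 4 < c * s ^ 4) :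
    IsGauge (gaugeOf a g s r) c C where
  c_pos := h.c_pos
  C_pos := h.C_pos
  zero := gaugeOf_zero a g s r
  pos := fun w hw => by
    obtain ⟨t, ht, e⟩ := h.exists_gaugeOf hr hw
    rw [e]; exact inv_pos.2 ht.1
  smooth := fun w hw =>
    ContDiffAt.comp (g := fun q : ℝ × C2 => gaugeOf a g s q.1 q.2) (f := fun w => (r, w)) w
      (h.contDiffAt_gaugeOf (q := (r, w)) hr hw) (contDiffAt_const.prodMk contDiffAt_id)
  hom := fun l hl w => by
    by_cases hw : w = 0
    · rw [hw, map_zero, gaugeOf_zero, mul_zero]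
    obtain ⟨t, ht, e⟩ := h.exists_gaugeOf hr hw
    have : IsScale a g s r (dil l w) (t / l) := by
      refine ⟨div_pos ht.1 hl, ?_, ?_⟩
      · rw [dil_dil]
        have : r * (t / l) * l = r * t := by field_simp
        rw [this]; exact ht.2.1
      · rw [snorm_dil]
        have : r * (t / l) * l = r * t := by field_simp
        rw [this, ← ht.2.2]
        field_simp
    rw [h.gaugeOf_eq (dil_ne_zero hl.ne' hw) this, e, inv_div, div_eq_mul_inv]
  lower := fun w => by
    by_cases hw : w = 0
    · rw [hw, gaugeOf_zero, quasi_zero]; norm_num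
    obtain ⟨t, ht, e⟩ := h.exists_gaugeOf hr hw
    rw [e, inv_pow, ← one_div, ← ht.2.2, mul_div_cancel_left₀ _ (pow_ne_zero 4 ht.1.ne')]
    exact h.lower _ _ ht.2.1
  upper := fun w => by
    by_cases hw : w = 0
    · rw [hw, gaugeOf_zero, quasi_zero]; norm_num
    obtain ⟨t, ht, e⟩ := h.exists_gaugeOf hr hw
    rw [e, inv_pow, ← one_div, ← ht.2.2, mul_div_cancel_left₀ _ (pow_ne_zero 4 ht.1.ne')]
    exact h.upper _ _ ht.2.1

lemma snorm_eq_one (h : MetricScale a g s c C) {r : ℝ} (hr : r ^ 4 < c * s ^ 4) {p : C2}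
    (hp0 : p ≠ 0) (hp : gaugeOf a g s r p = 1) :
    quasi (dil r p) < s ^ 4 ∧ snorm a g r p = 1 := by
  obtain ⟨t, ht, e⟩ := h.exists_gaugeOf hr hp0
  rw [hp] at e
  have : t = 1 := by rw [← inv_inv t, ← e, inv_one]
  rw [this] at ht
  simpa [IsScale] using ht

/-- Small distorted balls are sublevel sets of a gauge. -/
lemma distortedBall_eq (h : MetricScale a g s c C) {K : Set C2} (hK : IsCompact K)
    (hsub : ∀ w, quasi w < s ^ 4 → w ∈ K) (hcont : ContinuousOn (fieldNormSq a g) K)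
    (hpos : ∀ w ∈ K, w ≠ 0 → 0 < fieldNormSq a g w) :
    ∀ᶠ r in 𝓝[>] (0 : ℝ), distortedBall a g K r = {w | gaugeOf a g s r w ≤ r} := by
  -- X vanishes in K at the origin only, so |X|² has a positive lower bound away from the region;
  -- for small r this excludes other pieces of the ball.
  have hκ : ∃ κ > 0, ∀ w ∈ K, s ^ 4 ≤ quasi w → κ ≤ fieldNormSq a g w := by
    set L := K ∩ {w | s ^ 4 ≤ quasi w} with hL
    have hLc : IsCompact L := hK.inter_right (isClosed_le continuous_const continuous_quasi)
    rcases L.eq_empty_or_nonempty with he | hn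
    · refine ⟨1, one_pos, fun w hw hq => ?_⟩
      have : w ∈ L := ⟨hw, hq⟩
      rw [he] at this
      exact absurd this (notMem_empty w)
    · obtain ⟨w₀, hw₀, hmin⟩ := hLc.exists_isMinOn hn (hcont.mono inter_subset_left)
      refine ⟨fieldNormSq a g w₀, hpos w₀ hw₀.1 ?_, fun w hw hq => hmin ⟨hw, hq⟩⟩
      rintro rfl
      have := hw₀.2
      simp only [mem_ofPred_eq, quasi_zero] at this
      linarith [pow_pos h.s_pos 4]
  obtain ⟨κ, hκ0, hκ⟩ := hκ
  have ev : ∀ b > 0, ∀ᶠ r in 𝓝[>] (0 : ℝ), r ^ 4 < b := fun b hb => by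
    have : Tendsto (fun r : ℝ => r ^ 4) (𝓝 0) (𝓝 0) := by
      simpa using (continuous_pow (M := ℝ) 4).tendsto 0
    exact (this.eventually (gt_mem_nhds hb)).filter_mono inf_le_left
  filter_upwards [ev κ hκ0, ev _ (mul_pos h.c_pos (pow_pos h.s_pos 4)), self_mem_nhdsWithin]
    with r h1 h2 h3
  have hr : (0 : ℝ) < r := h3
  ext w
  simp only [distortedBall, mem_ofPred_eq]
  by_cases hw : w = 0
  · subst hw
    have hK0 : (0 : C2) ∈ K := hsub 0 (by rw [quasi_zero]; exact pow_pos h.s_pos 4)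
    have hf0 : fieldNormSq a g 0 = 0 := by
      have := fieldNormSq_dil (a := a) (g := g) 0 0
      simpa using this
    rw [gaugeOf_zero, hf0]
    exact ⟨fun _ => hr.le, fun _ => ⟨hK0, by positivity⟩⟩
  obtain ⟨t, ht, e⟩ := h.exists_gaugeOf h2 hw
  have hle : gaugeOf a g s r w ≤ r ↔ r⁻¹ ≤ t := by
    rw [e, inv_le_comm₀ ht.1 hr]
  rw [hle]
  -- Inside the region, |X|²(w)/r⁴ is the value at r⁻¹ of the increasing function that takes the
  -- value 1 at t, so the ball condition reads r⁻¹ ≤ t.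
  by_cases hq : quasi w < s ^ 4
  · have hf : fieldNormSq a g w = snorm a g (r * r⁻¹) w := by
      have := fieldNormSq_dil (a := a) (g := g) 1 w
      rw [dil_one] at this
      rw [this, mul_inv_cancel₀ hr.ne']; ring
    have hq1 : quasi (dil (r * r⁻¹) w) < s ^ 4 := by
      rwa [mul_inv_cancel₀ hr.ne', dil_one]
    have hiff : fieldNormSq a g w ≤ r ^ 4 ↔ r⁻¹ ^ 4 * snorm a g (r * r⁻¹) w ≤ 1 := by
      rw [hf, inv_pow, inv_mul_le_iff₀ (pow_pos hr 4), mul_one]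
    rw [hiff]
    constructor
    · rintro ⟨-, hle1⟩
      by_contra! hlt
      have := h.mono hw ht.1 hlt hq1
      rw [ht.2.2] at this
      linarith
    · intro hle1
      refine ⟨hsub w hq, ?_⟩
      rcases hle1.eq_or_lt with heq | hlt
      · rw [heq]; exact ht.2.2.le
      · have := h.mono hw (inv_pos.2 hr) hlt ht.2.1
        rw [ht.2.2] at this
        exact this.le
  · push Not at hq
    constructor
    · rintro ⟨hwK, hle1⟩
      have := hκ w hwK hq
      linarith
    -- From rt ≥ 1, the dilate of w by rt lies even further out than w, against the region condition
    -- satisfied by t.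
    · intro hle1
      exfalso
      have h5 : 1 ≤ r * t := by
        rwa [inv_le_iff_one_le_mul₀ hr, mul_comm] at hle1
      have h6 := one_le_pow₀ (n := 4) h5
      have h7 := ht.2.1
      rw [quasi_dil] at h7
      nlinarith [quasi_nonneg w]

end MetricScale

/-! ### The form `η ∧ ∂̄η` in coordinates -/

/-- The coefficients of `η ∧ ∂̄η = (P dū + Q dv̄) ∧ du ∧ dv` for `η = H₀ du + H₁ dv`. -/
def wedgeCoeff (H : Fin 2 → C2 → ℂ) (k : Fin 2) (w : C2) : ℂ :=
  H 1 w * dbr k (H 0) w - H 0 w * dbr k (H 1) w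

lemma dbarFun_eq (l : C2 →L[ℝ] ℂ) (h : C2) :
    (l h + Complex.I * l (Complex.I • h)) / 2 =
      barPart 0 l * (starRingEnd ℂ) (h 0) + barPart 1 l * (starRingEnd ℂ) (h 1) := by
  rw [apply_eq_parts l h, apply_eq_parts l (Complex.I • h)]
  simp only [Pi.smul_apply, smul_eq_mul, map_mul, Complex.conj_I]
  linear_combination ((holPart 0 l * h 0 + holPart 1 l * h 1) / 2 -
    (barPart 0 l * (starRingEnd ℂ) (h 0) + barPart 1 l * (starRingEnd ℂ) (h 1)) / 2) *
    Complex.I_sq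

lemma wedge_dbar_eq {H : Fin 2 → C2 → ℂ} {z : C2} (hH : ∀ i, DifferentiableAt ℝ (H i) z)
    {η : C2 → (C2 →L[ℂ] ℂ)}
    (hη : η = fun z => ∑ i, H i z • (ContinuousLinearMap.proj i : C2 →L[ℂ] ℂ))
    (h : Fin 3 → C2) :
    wedge (η z) (dbar η z) h = form21 (wedgeCoeff H 0 z) (wedgeCoeff H 1 z) h := by
  have hd : HasFDerivAt η (∑ i, (fderiv ℝ (H i) z).smulRight
      (ContinuousLinearMap.proj i : C2 →L[ℂ] ℂ)) z := by
    rw [hη]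
    exact HasFDerivAt.fun_sum fun i _ => (hH i).hasFDerivAt.smul_const
      (ContinuousLinearMap.proj i : C2 →L[ℂ] ℂ)
  have hb : ∀ x y : C2, (fderiv ℝ η z x + Complex.I • fderiv ℝ η z (Complex.I • x)) y / 2 =
      ∑ i, (dbr 0 (H i) z * (starRingEnd ℂ) (x 0) + dbr 1 (H i) z * (starRingEnd ℂ) (x 1)) *
        y i := by
    intro x y
    simp only [dbr, ← dbarFun_eq]
    rw [hd.fderiv]
    simp
    ring
  have hv : ∀ x, η z x = ∑ i, H i z * x i := fun x => by rw [hη]; simp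
  simp only [wedge, dbar, hb, hv, form21, minor, wedgeCoeff, Fin.sum_univ_two]
  ring

/-- The w-derivative is the restriction of the full derivative to the second factor, so it depends
smoothly on (r, w) jointly. -/
lemma contDiffAt_dbr_snd {f : ℝ × C2 → ℂ} {q : ℝ × C2} (hf : ContDiffAt ℝ ∞ f q) (k : Fin 2) :
    ContDiffAt ℝ ∞ (fun q : ℝ × C2 => dbr k (fun w => f (q.1, w)) q.2) q := by
  have h1 : ContDiffAt ℝ ∞ (fderiv ℝ f) q := hf.fderiv_right (m := ∞) (by simp)
  have h2 : ∀ᶠ x in 𝓝 q, fderiv ℝ (fun w => f (x.1, w)) x.2 =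
      (fderiv ℝ f x).comp (ContinuousLinearMap.inr ℝ ℝ C2) := by
    have := (hf.of_le (show (1 : WithTop ℕ∞) ≤ ∞ by exact_mod_cast le_top)).eventually (by simp)
    filter_upwards [this] with x hx
    have hd : HasFDerivAt f (fderiv ℝ f x) (x.1, x.2) :=
      (hx.differentiableAt (by simp)).hasFDerivAt
    exact (HasFDerivAt.comp (g := f) (f := fun w => (x.1, w)) x.2 hd
      (hasFDerivAt_prodMk_right x.1 x.2)).fderiv
  have h3 : ContDiffAt ℝ ∞
      (fun x => barPart k ((fderiv ℝ f x).comp (ContinuousLinearMap.inr ℝ ℝ C2))) q := by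
    unfold barPart
    simp only [ContinuousLinearMap.comp_apply]
    exact ((h1.clm_apply contDiffAt_const).add
      (contDiffAt_const.mul (h1.clm_apply contDiffAt_const))).div_const 2
  refine h3.congr_of_eventuallyEq ?_
  filter_upwards [h2] with x hx
  rw [dbr, hx]

/-! ### The rescaled form -/

variable {a : ℂ} {g : C2 → Matrix (Fin 2) (Fin 2) ℂ}

/-- The coefficients of `η`. -/
def etaCoeff (a : ℂ) (g : C2 → Matrix (Fin 2) (Fin 2) ℂ) (i : Fin 2) (z : C2) : ℂ :=
  (∑ j, g z i j * star (field a z j)) / (fieldNormSq a g z : ℂ)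

/-- The coefficients of the rescaled form. -/
def sform (a : ℂ) (g : C2 → Matrix (Fin 2) (Fin 2) ℂ) (r : ℝ) (i : Fin 2) (w : C2) : ℂ :=
  scovec a g i r w / (snorm a g r w : ℂ)

lemma etaCoeff_dil {r : ℝ} (hr : r ≠ 0) (i : Fin 2) (w : C2) :
    etaCoeff a g i (dil r w) = ((r : ℂ) ^ 2)⁻¹ * sform a g r i w := by
  have hr' : (r : ℂ) ≠ 0 := by exact_mod_cast hr
  rw [etaCoeff, sform, covec_dil, fieldNormSq_dil]
  push_cast
  by_cases h : (snorm a g r w : ℂ) = 0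
  -- Both sides are 0 by the convention for division by zero.
  · simp [h]
  · field_simp

namespace MetricNear

variable {s : ℝ}

lemma contDiffAt_sform (h : MetricNear a g s) {q : ℝ × C2} (hq : quasi (dil q.1 q.2) < s ^ 4)
    (hw : q.2 ≠ 0) (i : Fin 2) :
    ContDiffAt ℝ ∞ (fun q : ℝ × C2 => sform a g q.1 i q.2) q := by
  refine contDiffAt_div (h.contDiffAt_scovec hq i)
    (Complex.ofRealCLM.contDiff.contDiffAt.comp q (h.contDiffAt_snorm hq)) ?_
  simpa using (h.snorm_pos hq hw).ne'

lemma contDiffAt_sform_snd (h : MetricNear a g s) {r : ℝ} {w : C2}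
    (hq : quasi (dil r w) < s ^ 4) (hw : w ≠ 0) (i : Fin 2) :
    ContDiffAt ℝ ∞ (sform a g r i) w :=
  ContDiffAt.comp (g := fun q : ℝ × C2 => sform a g q.1 i q.2) (f := fun w => (r, w)) w
    (h.contDiffAt_sform (q := (r, w)) hq hw i) (contDiffAt_const.prodMk contDiffAt_id)

lemma sum_sform_mul_sfield (h : MetricNear a g s) {r : ℝ} {w : C2}
    (hq : quasi (dil r w) < s ^ 4) (hw : w ≠ 0) :
    ∑ i, sform a g r i w * sfield a r w i = 1 := by
  have h0 := (h.sherm_pos hq hw).ne'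
  simp only [sform, h.ofReal_snorm hq hw, div_mul_eq_mul_div, ← Finset.sum_div]
  exact div_self h0

lemma contDiffAt_etaCoeff (h : MetricNear a g s) {z : C2} (hq : quasi z < s ^ 4) (hz : z ≠ 0)
    (i : Fin 2) : ContDiffAt ℝ ∞ (etaCoeff a g i) z := by
  have e : etaCoeff a g i = sform a g 1 i := by
    funext w
    have := etaCoeff_dil (a := a) (g := g) one_ne_zero i w
    simpa using this
  rw [e]
  exact h.contDiffAt_sform_snd (by rwa [dil_one]) hz i

lemma residueForm_eq (h : MetricNear a g s) (φ : C2 → ℂ) {z : C2} (hq : quasi z < s ^ 4)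
    (hz : z ≠ 0) (v : Fin 3 → C2) :
    residueForm a g φ z v = form21 (φ z * wedgeCoeff (etaCoeff a g) 0 z)
      (φ z * wedgeCoeff (etaCoeff a g) 1 z) v := by
  rw [residueForm, wedge_dbar_eq (H := etaCoeff a g) (η := eta a g)
    (fun i => (h.contDiffAt_etaCoeff hq hz i).differentiableAt (by simp)) rfl, form21, form21]
  ring

/-- Two factors of η give r⁻⁴ and the ∂̄-derivative r⁻² or r⁻¹, against r⁵ or r⁴ from the dilated
basis forms. The surplus r⁻¹ is what brings the derivative of φ into the limit. -/
lemma wedgeCoeff_etaCoeff_dil (h : MetricNear a g s) {r : ℝ} (hr : r ≠ 0) {w : C2}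
    (hq : quasi (dil r w) < s ^ 4) (hw : w ≠ 0) :
    (r : ℂ) ^ 5 * wedgeCoeff (etaCoeff a g) 0 (dil r w) =
        (r : ℂ)⁻¹ * wedgeCoeff (sform a g r) 0 w ∧
      (r : ℂ) ^ 4 * wedgeCoeff (etaCoeff a g) 1 (dil r w) =
        (r : ℂ)⁻¹ * wedgeCoeff (sform a g r) 1 w := by
  have hr' : (r : ℂ) ≠ 0 := by exact_mod_cast hr
  have hd : ∀ i, dbr 0 (etaCoeff a g i) (dil r w) =
        ((r : ℂ) ^ 4)⁻¹ * dbr 0 (sform a g r i) w ∧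
      dbr 1 (etaCoeff a g i) (dil r w) = ((r : ℂ) ^ 3)⁻¹ * dbr 1 (sform a g r i) w := by
    intro i
    have h1 := dbr_comp_dil ((h.contDiffAt_etaCoeff hq (dil_ne_zero hr hw) i).differentiableAt
      (by simp))
    have h2 : (fun w => etaCoeff a g i (dil r w)) =
        fun w => ((r : ℂ) ^ 2)⁻¹ * sform a g r i w := funext fun w => etaCoeff_dil hr i w
    have hs := (h.contDiffAt_sform_snd hq hw i).differentiableAt (by simp)
    have h3 : ∀ k, dbr k (fun w => ((r : ℂ) ^ 2)⁻¹ * sform a g r i w) w =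
        ((r : ℂ) ^ 2)⁻¹ * dbr k (sform a g r i) w := fun k => by
      rw [dbr_mul (differentiableAt_const _) hs, dbr_const]; ring
    rw [h2, h3, h3] at h1
    constructor
    · have := h1.1
      field_simp at this ⊢
      rw [this]
    · have := h1.2
      field_simp at this ⊢
      rw [this]
  simp only [wedgeCoeff, etaCoeff_dil hr, (hd _).1, (hd _).2]
  constructor <;> field_simp

end MetricNear

lemma contDiffAt_wedgeCoeff {H : Fin 2 → C2 → ℂ} {w : C2} (hH : ∀ i, ContDiffAt ℝ ∞ (H i) w)
    (k : Fin 2) : ContDiffAt ℝ ∞ (wedgeCoeff H k) w :=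
  ((hH 1).mul (contDiffAt_dbr (hH 0) k)).sub ((hH 0).mul (contDiffAt_dbr (hH 1) k))

/-! ### The model form and the exact value for linear test functions -/

/-- The coefficients of the model form that is dual to the rescaled field. -/
def modelForm (a : ℂ) (r : ℝ) : Fin 2 → C2 → ℂ :=
  ![fun w => (a + r * w 1)⁻¹ * ((starRingEnd ℂ) (w 0) / quasi w),
    fun w => -(((starRingEnd ℂ) (w 1)) ^ 2 / quasi w)]

lemma contDiffAt_add_mul (a : ℂ) (r : ℝ) (w : C2) :
    ContDiffAt ℝ ∞ (fun w : C2 => a + r * w 1) w :=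
  (contDiff_const.add (contDiff_const.mul (contDiff_coord 1))).contDiffAt

lemma dbr_add_mul (k : Fin 2) (a b : ℂ) (w : C2) : dbr k (fun w : C2 => a + b * w 1) w = 0 := by
  have d1 : DifferentiableAt ℝ (fun w : C2 => b * w 1) w :=
    (differentiableAt_coord 1 w).const_mul b
  rw [dbr_add (differentiableAt_const _) d1,
    dbr_mul (differentiableAt_const _) (differentiableAt_coord 1 w)]
  simp [dbr_const, dbr_coord]

lemma dbr_mul_of_dbr_eq_zero {k : Fin 2} {f h : C2 → ℂ} {w : C2} (hf : DifferentiableAt ℝ f w)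
    (hh : DifferentiableAt ℝ h w) (h0 : dbr k f w = 0) :
    dbr k (fun w => f w * h w) w = f w * dbr k h w := by
  rw [dbr_mul hf hh, h0, zero_mul, zero_add]

section

variable {a : ℂ} {r : ℝ} {w : C2}

lemma contDiffAt_conj_div_quasi (hw : w ≠ 0) :
    ContDiffAt ℝ ∞ (fun w : C2 => (starRingEnd ℂ) (w 0) / (quasi w : ℂ)) w :=
  contDiffAt_div (contDiff_conj_coord 0).contDiffAt contDiff_quasi_ofReal.contDiffAt
    (quasi_ofReal_ne_zero hw)

lemma contDiffAt_conj_sq_div_quasi (hw : w ≠ 0) :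
    ContDiffAt ℝ ∞ (fun w : C2 => (starRingEnd ℂ) (w 1) ^ 2 / (quasi w : ℂ)) w :=
  contDiffAt_div ((contDiff_conj_coord 1).pow 2).contDiffAt contDiff_quasi_ofReal.contDiffAt
    (quasi_ofReal_ne_zero hw)

/-- Thus v² times the model form is ∂̄-exact, even after multiplication by a holomorphic function;
this removes the quadratic remainder in `levelIntegral_affine`. -/
lemma dbr_conj_div_quasi (hw : w ≠ 0) :
    dbr 0 (fun w : C2 => (starRingEnd ℂ) (w 0) / (quasi w : ℂ)) w = -w 1 ^ 2 * modelP w ∧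
    dbr 1 (fun w : C2 => (starRingEnd ℂ) (w 0) / (quasi w : ℂ)) w = -w 1 ^ 2 * modelQ w := by
  have hN := quasi_ofReal_ne_zero hw
  constructor
  · rw [dbr_div (differentiableAt_conj_coord 0 w) (differentiableAt_quasi_ofReal w) hN]
    simp only [dbr_conj_coord, (dbr_quasi w).1, modelP]
    field_simp
    simp [quasi_eq]
    ring
  · rw [dbr_div (differentiableAt_conj_coord 0 w) (differentiableAt_quasi_ofReal w) hN]
    simp only [dbr_conj_coord, (dbr_quasi w).2, modelQ]
    field_simp
    simp [quasi_eq]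

lemma contDiffAt_modelForm (hne : a + r * w 1 ≠ 0) (hw : w ≠ 0) (i : Fin 2) :
    ContDiffAt ℝ ∞ (modelForm a r i) w := by
  fin_cases i
  · exact ((contDiffAt_add_mul a r w).inv hne).mul (contDiffAt_conj_div_quasi hw)
  · exact (contDiffAt_conj_sq_div_quasi hw).neg

lemma sum_modelForm_mul_sfield (hne : a + r * w 1 ≠ 0) (hw : w ≠ 0) :
    ∑ i, modelForm a r i w * sfield a r w i = 1 := by
  have hN := quasi_ofReal_ne_zero hw
  simp only [modelForm, Fin.sum_univ_two, Matrix.cons_val_zero, Matrix.cons_val_one, sfield_zero,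
    sfield_one]
  field_simp
  rw [quasi_eq]
  ring

lemma dbr_inv_add_mul (hne : a + r * w 1 ≠ 0) (k : Fin 2) :
    dbr k (fun w : C2 => (a + r * w 1)⁻¹) w = 0 := by
  rw [dbr_inv ((contDiffAt_add_mul a r w).differentiableAt (by simp)) hne, dbr_add_mul]
  simp

/-- The factor 1/(a + rv) is holomorphic, hence passes through ∂̄, and it sits in only one of the
two components, so it appears to the first power. -/
lemma wedgeCoeff_modelForm (hne : a + r * w 1 ≠ 0) (hw : w ≠ 0) :
    wedgeCoeff (modelForm a r) 0 w = (a + r * w 1)⁻¹ * modelP w ∧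
      wedgeCoeff (modelForm a r) 1 w = (a + r * w 1)⁻¹ * modelQ w := by
  have hN := quasi_ofReal_ne_zero hw
  have hinv : DifferentiableAt ℝ (fun w : C2 => (a + r * w 1)⁻¹) w :=
    ((contDiffAt_add_mul a r w).inv hne).differentiableAt (by simp)
  have e0 : ∀ k, dbr k (modelForm a r 0) w = (a + r * w 1)⁻¹ *
      dbr k (fun w : C2 => (starRingEnd ℂ) (w 0) / (quasi w : ℂ)) w := fun k =>
    dbr_mul_of_dbr_eq_zero hinv ((contDiffAt_conj_div_quasi hw).differentiableAt (by simp))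
      (dbr_inv_add_mul hne k)
  have e1 : ∀ k, dbr k (modelForm a r 1) w =
      -dbr k (fun w : C2 => (starRingEnd ℂ) (w 1) ^ 2 / (quasi w : ℂ)) w := fun k => dbr_neg
  have c1 := differentiableAt_conj_coord 1 w
  constructor
  · rw [wedgeCoeff, e0, e1, (dbr_conj_div_quasi hw).1,
      dbr_div (c1.fun_pow 2) (differentiableAt_quasi_ofReal w) hN, dbr_pow 2 c1]
    simp only [dbr_conj_coord, (dbr_quasi w).1, modelP, modelForm,
      Matrix.cons_val_zero, Matrix.cons_val_one]
    field_simp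
    simp [quasi_eq]
    ring
  · rw [wedgeCoeff, e0, e1, (dbr_conj_div_quasi hw).2,
      dbr_div (c1.fun_pow 2) (differentiableAt_quasi_ofReal w) hN, dbr_pow 2 c1]
    simp only [dbr_conj_coord, (dbr_quasi w).2, modelQ, modelForm,
      Matrix.cons_val_zero, Matrix.cons_val_one]
    field_simp
    simp [quasi_eq]
    ring

/-- Two forms dual to the same nonvanishing field have cohomologous `η ∧ ∂̄η`. -/
lemma wedgeCoeff_eq_add_dbr {H H' : Fin 2 → C2 → ℂ} (hH : ∀ i, DifferentiableAt ℝ (H i) w)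
    (hH' : ∀ i, DifferentiableAt ℝ (H' i) w)
    (hY : ∀ᶠ z in 𝓝 w, ∑ i, H i z * sfield a r z i = 1)
    (hY' : ∀ᶠ z in 𝓝 w, ∑ i, H' i z * sfield a r z i = 1) (k : Fin 2) :
    wedgeCoeff H' k w = wedgeCoeff H k w +
      dbr k (fun z => H' 0 z * H 1 z - H 0 z * H' 1 z) w := by
  -- Differentiating η(X_r) = 1: the coefficients of X_r are holomorphic, so ∂̄ falls on η alone.
  have hann : ∀ H : Fin 2 → C2 → ℂ, (∀ i, DifferentiableAt ℝ (H i) w) →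
      (∀ᶠ z in 𝓝 w, ∑ i, H i z * sfield a r z i = 1) →
      dbr k (H 0) w * sfield a r w 0 + dbr k (H 1) w * sfield a r w 1 = 0 := by
    intro H hH hY
    have h1 : dbr k (fun z => H 0 z * sfield a r z 0 + H 1 z * sfield a r z 1) w = 0 := by
      rw [← dbr_const k 1 w]
      refine dbr_congr ?_
      filter_upwards [hY] with z hz
      rw [← hz, Fin.sum_univ_two]
    have hd : DifferentiableAt ℝ (fun w : C2 => a + r * w 1) w :=
      (contDiffAt_add_mul a r w).differentiableAt (by simp)
    have s0 : DifferentiableAt ℝ (fun z => sfield a r z 0) w :=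
      (differentiableAt_coord 0 w).fun_mul hd
    have s1 : DifferentiableAt ℝ (fun z => sfield a r z 1) w :=
      ((differentiableAt_coord 1 w).fun_pow 2).fun_neg
    have z0 : dbr k (fun z => sfield a r z 0) w = 0 := by
      simp only [sfield_zero]
      rw [dbr_mul (differentiableAt_coord 0 w) hd, dbr_coord, dbr_add_mul]; ring
    have z1 : dbr k (fun z => sfield a r z 1) w = 0 := by
      simp only [sfield_one]
      rw [dbr_neg, dbr_pow 2 (differentiableAt_coord 1 w), dbr_coord]; simp
    rw [dbr_add ((hH 0).fun_mul s0) ((hH 1).fun_mul s1), dbr_mul (hH 0) s0, dbr_mul (hH 1) s1,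
      z0, z1] at h1
    linear_combination h1
  have a1 := hann H hH hY
  have a2 := hann H' hH' hY'
  have b1 := hY.self_of_nhds
  have b2 := hY'.self_of_nhds
  rw [Fin.sum_univ_two] at b1 b2
  rw [dbr_sub ((hH' 0).fun_mul (hH 1)) ((hH 0).fun_mul (hH' 1)), dbr_mul (hH' 0) (hH 1),
    dbr_mul (hH 0) (hH' 1), wedgeCoeff, wedgeCoeff]
  set Y0 := sfield a r w 0
  set Y1 := sfield a r w 1
  have hY0 : Y0 ≠ 0 ∨ Y1 ≠ 0 := by
    by_contra! hc
    rw [hc.1, hc.2] at b1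
    simp at b1
  set B0 := dbr k (H 0) w
  set B1 := dbr k (H 1) w
  set B0' := dbr k (H' 0) w
  set B1' := dbr k (H' 1) w
  -- The covectors H' − H and ∂̄_k(H' + H) both annihilate the nonzero vector X_r of ℂ², so they are
  -- proportional.
  have key : (H' 1 w - H 1 w) * (B0' + B0) - (H' 0 w - H 0 w) * (B1' + B1) = 0 := by
    rcases hY0 with h | h
    · refine (mul_eq_zero.1 (?_ : Y0 * _ = 0)).resolve_left h
      linear_combination (H' 1 w - H 1 w) * (a1 + a2) - (B1' + B1) * (b2 - b1)
    · refine (mul_eq_zero.1 (?_ : Y1 * _ = 0)).resolve_left h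
      linear_combination -(H' 0 w - H 0 w) * (a1 + a2) + (B0' + B0) * (b2 - b1)
  linear_combination key

end

/-- The exact value of the level integral for a test function that is affine in `v`. -/
lemma IsGauge.levelIntegral_affine {m : C2 → ℝ} {c C : ℝ} (hm : IsGauge m c C) {a : ℂ}
    (ha : a ≠ 0) {r : ℝ} {H : Fin 2 → C2 → ℂ}
    (hH : ∀ p ≠ 0, m p = 1 → ∀ i, ContDiffAt ℝ ∞ (H i) p)
    (hY : ∀ p ≠ 0, m p = 1 → ∀ᶠ w in 𝓝 p, ∑ i, H i w * sfield a r w i = 1)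
    (hne : ∀ p ≠ 0, m p = 1 → a + r * p 1 ≠ 0) (x y : ℂ) :
    levelIntegral m (fun w => (x + r * y * w 1) * wedgeCoeff H 0 w)
        (fun w => (x + r * y * w 1) * wedgeCoeff H 1 w) =
      r * (4 * (Real.pi : ℂ) ^ 2 * (y / a - x / a ^ 2)) := by
  -- Division with remainder: (x + ryv)/(a + rv) = x/a + rbv − r²bv²/(a + rv).
  set b := y / a - x / a ^ 2 with hb
  set d : C2 → ℂ := fun z => modelForm a r 0 z * H 1 z - H 0 z * modelForm a r 1 z with hd
  set e : C2 → ℂ := fun z => (a + r * z 1)⁻¹ * ((starRingEnd ℂ) (z 0) / (quasi z : ℂ)) with he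
  -- A primitive of all exact terms: the first summand accounts for the remainder of the division,
  -- the second for the passage from H to the model form.
  set f : C2 → ℂ := fun z => r ^ 2 * b * e z - (x + r * y * z 1) * d z with hf
  have hev : ∀ p ≠ 0, m p = 1 → ∀ᶠ w in 𝓝 p, ∑ i, modelForm a r i w * sfield a r w i = 1 := by
    intro p hp0 hp
    filter_upwards [((contDiffAt_add_mul a r p).continuousAt).eventually_ne (hne p hp0 hp),
      eventually_ne_nhds hp0] with w h1 h2
    exact sum_modelForm_mul_sfield h1 h2
  have hM : ∀ p ≠ 0, m p = 1 → ∀ i, ContDiffAt ℝ ∞ (modelForm a r i) p := fun p hp0 hp i =>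
    contDiffAt_modelForm (hne p hp0 hp) hp0 i
  have hdc : ∀ p ≠ 0, m p = 1 → ContDiffAt ℝ ∞ d p := fun p hp0 hp =>
    ((hM p hp0 hp 0).mul (hH p hp0 hp 1)).sub ((hH p hp0 hp 0).mul (hM p hp0 hp 1))
  have hec : ∀ p ≠ 0, m p = 1 → ContDiffAt ℝ ∞ e p := fun p hp0 hp =>
    ((contDiffAt_add_mul a r p).inv (hne p hp0 hp)).mul (contDiffAt_conj_div_quasi hp0)
  have hlc : ∀ p : C2, ContDiffAt ℝ ∞ (fun z : C2 => x + r * y * z 1) p := fun p =>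
    (contDiff_const.add (contDiff_const.mul (contDiff_coord 1))).contDiffAt
  have hfc : ∀ p ≠ 0, m p = 1 → ContDiffAt ℝ ∞ f p := fun p hp0 hp =>
    (contDiffAt_const.mul (hec p hp0 hp)).sub ((hlc p).mul (hdc p hp0 hp))
  have hmod : ∀ p ≠ 0, m p = 1 → ∀ k (M : C2 → ℂ), dbr k e p = (a + r * p 1)⁻¹ *
      (-p 1 ^ 2 * M p) → wedgeCoeff (modelForm a r) k p = (a + r * p 1)⁻¹ * M p →
      (x + r * y * p 1) * wedgeCoeff H k p =
        (x / a * M p + r * b * (p 1 * M p)) + dbr k f p := by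
    intro p hp0 hp k M hM1 hM2
    have hn := hne p hp0 hp
    have dif : ∀ {h : C2 → ℂ}, ContDiffAt ℝ ∞ h p → DifferentiableAt ℝ h p := fun h =>
      h.differentiableAt (by simp)
    have h1 := wedgeCoeff_eq_add_dbr (fun i => dif (hH p hp0 hp i))
      (fun i => dif (hM p hp0 hp i)) (hY p hp0 hp) (hev p hp0 hp) k
    rw [hM2] at h1
    have h2 : dbr k f p = r ^ 2 * b * dbr k e p - (x + r * y * p 1) * dbr k d p := by
      rw [hf, dbr_sub ((dif (hec p hp0 hp)).const_mul _)
          ((dif (hlc p)).fun_mul (dif (hdc p hp0 hp))),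
        dbr_mul_of_dbr_eq_zero (differentiableAt_const _) (dif (hec p hp0 hp)) (dbr_const _ _ _),
        dbr_mul_of_dbr_eq_zero (dif (hlc p)) (dif (hdc p hp0 hp)) (dbr_add_mul _ _ _ _)]
    rw [h2, hM1]
    have h3 : wedgeCoeff H k p = (a + r * p 1)⁻¹ * M p - dbr k d p := by
      rw [h1]; ring
    rw [h3, hb]
    field_simp
    ring
  have de : ∀ p ≠ 0, m p = 1 → ∀ k, dbr k e p = (a + r * p 1)⁻¹ *
      dbr k (fun w : C2 => (starRingEnd ℂ) (w 0) / (quasi w : ℂ)) p := fun p hp0 hp k =>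
    dbr_mul_of_dbr_eq_zero
      (((contDiffAt_add_mul a r p).inv (hne p hp0 hp)).differentiableAt (by simp))
      ((contDiffAt_conj_div_quasi hp0).differentiableAt (by simp)) (dbr_inv_add_mul (hne p hp0 hp) k)
  have cP : ∀ p ≠ 0, m p = 1 → ContinuousAt modelP p := fun p hp0 _ =>
    (contDiffAt_modelP hp0).continuousAt
  have cQ : ∀ p ≠ 0, m p = 1 → ContinuousAt modelQ p := fun p hp0 _ =>
    (contDiffAt_modelQ hp0).continuousAt
  have cv : ∀ p : C2, ContinuousAt (fun z : C2 => z 1) p := fun p =>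
    (contDiff_coord 1).continuous.continuousAt
  have cd : ∀ k, ∀ p ≠ 0, m p = 1 → ContinuousAt (dbr k f) p := fun k p hp0 hp =>
    continuousAt_dbr (hfc p hp0 hp) k
  rw [hm.levelIntegral_congr
    (P' := fun p => (x / a * modelP p + r * b * (p 1 * modelP p)) + dbr 0 f p)
    (Q' := fun p => (x / a * modelQ p + r * b * (p 1 * modelQ p)) + dbr 1 f p)
    (fun p hp0 hp => hmod p hp0 hp 0 modelP (by rw [de p hp0 hp, (dbr_conj_div_quasi hp0).1])
      (wedgeCoeff_modelForm (hne p hp0 hp) hp0).1)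
    (fun p hp0 hp => hmod p hp0 hp 1 modelQ (by rw [de p hp0 hp, (dbr_conj_div_quasi hp0).2])
      (wedgeCoeff_modelForm (hne p hp0 hp) hp0).2),
    hm.levelIntegral_add _ _ (cd 0) (cd 1), hm.levelIntegral_add, levelIntegral_const_mul,
    levelIntegral_const_mul, hm.levelIntegral_model_zero, hm.levelIntegral_model_one,
    hm.levelIntegral_dbr hfc]
  · ring
  · exact fun p hp0 hp => continuousAt_const.mul (cP p hp0 hp)
  · exact fun p hp0 hp => continuousAt_const.mul (cQ p hp0 hp)
  · exact fun p hp0 hp => continuousAt_const.mul ((cv p).mul (cP p hp0 hp))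
  · exact fun p hp0 hp => continuousAt_const.mul ((cv p).mul (cQ p hp0 hp))
  · exact fun p hp0 hp => (continuousAt_const.mul (cP p hp0 hp)).add
      (continuousAt_const.mul ((cv p).mul (cP p hp0 hp)))
  · exact fun p hp0 hp => (continuousAt_const.mul (cQ p hp0 hp)).add
      (continuousAt_const.mul ((cv p).mul (cQ p hp0 hp)))

/-! ### The first-order remainder -/

/-- First-order Taylor expansion at the origin. The u-directions are dilated by r², so after
division by r they contribute O(r) and only the v̄-derivative remains; the estimate is uniform on a
bounded set. -/
lemma eventually_remainder_le {φ : C2 → ℂ} (hφ : DifferentiableAt ℝ φ 0) (b : ℝ) {ε : ℝ}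
    (hε : 0 < ε) : ∀ᶠ r : ℝ in 𝓝[>] 0, ∀ p : C2, quasi p ≤ b →
      ‖(r : ℂ)⁻¹ * (φ (dil r p) - (φ 0 + r * wirtinger 1 φ 0 * p 1)) -
        dbr 1 φ 0 * (starRingEnd ℂ) (p 1)‖ ≤ ε := by
  obtain ⟨B, hB⟩ := (isCompact_quasi_Icc 0 b).isBounded.exists_pos_norm_le
  obtain ⟨hB0, hB⟩ := hB
  set D := ‖holPart 0 (fderiv ℝ φ 0)‖ + ‖barPart 0 (fderiv ℝ φ 0)‖ with hD
  have hD0 : 0 ≤ D := by positivity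
  -- Half of ε is reserved for the Taylor remainder, where ‖`dil r p`‖ ≤ rB, and half for the
  -- u-derivatives.
  have ho := hφ.hasFDerivAt.isLittleO.def (show 0 < ε / (2 * B) by positivity)
  simp only [sub_zero] at ho
  obtain ⟨δ, hδ, ho⟩ := Metric.eventually_nhds_iff.1 ho
  have e1 : ∀ᶠ r : ℝ in 𝓝[>] 0, r < min 1 (min (δ / B) (ε / (2 * (D + 1) * B))) :=
    (gt_mem_nhds (by positivity)).filter_mono inf_le_left
  filter_upwards [e1, self_mem_nhdsWithin] with r hr (hr0 : 0 < r) p hp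
  obtain ⟨hr1, hr2, hr3⟩ : r < 1 ∧ r < δ / B ∧ r < ε / (2 * (D + 1) * B) := by
    simpa [lt_min_iff] using hr
  have hpB : ‖p‖ ≤ B := hB p ⟨quasi_nonneg p, hp⟩
  have hp0 := (norm_le_pi_norm p 0).trans hpB
  have hp1 := (norm_le_pi_norm p 1).trans hpB
  have hdil : ‖dil r p‖ ≤ r * B := by
    rw [pi_norm_le_iff_of_nonneg (by positivity)]
    intro i
    fin_cases i
    · simp only [Fin.zero_eta, dil_apply_zero, norm_mul, norm_pow, Complex.norm_real,
        Real.norm_eq_abs, abs_of_pos hr0]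
      have : r ^ 2 ≤ r := by nlinarith
      gcongr
    · simp only [Fin.mk_one, dil_apply_one, norm_mul, Complex.norm_real,
        Real.norm_eq_abs, abs_of_pos hr0]
      gcongr
  have hlt : r * B < δ := by rwa [lt_div_iff₀ hB0] at hr2
  have hR := ho (y := dil r p) (by rw [dist_zero_right]; exact hdil.trans_lt hlt)
  set R := φ (dil r p) - φ 0 - fderiv ℝ φ 0 (dil r p) with hRdef
  have hr' : (r : ℂ) ≠ 0 := by exact_mod_cast hr0.ne'
  have hw : wirtinger 1 φ 0 = holPart 1 (fderiv ℝ φ 0) := rfl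
  have hkey : (r : ℂ)⁻¹ * (φ (dil r p) - (φ 0 + r * wirtinger 1 φ 0 * p 1)) -
        dbr 1 φ 0 * (starRingEnd ℂ) (p 1) =
      (r : ℂ)⁻¹ * R + r * (holPart 0 (fderiv ℝ φ 0) * p 0 +
        barPart 0 (fderiv ℝ φ 0) * (starRingEnd ℂ) (p 0)) := by
    have : φ (dil r p) = R + φ 0 + fderiv ℝ φ 0 (dil r p) := by rw [hRdef]; ring
    rw [this, apply_eq_parts, hw, dbr]
    simp only [dil_apply_zero, dil_apply_one, map_mul, map_pow, Complex.conj_ofReal]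
    field_simp
    ring
  rw [hkey]
  have b1 : ‖(r : ℂ)⁻¹ * R‖ ≤ ε / 2 := by
    rw [norm_mul, norm_inv, Complex.norm_real, Real.norm_eq_abs, abs_of_pos hr0,
      inv_mul_le_iff₀ hr0]
    calc ‖R‖ ≤ ε / (2 * B) * ‖dil r p‖ := hR
      _ ≤ ε / (2 * B) * (r * B) := by gcongr
      _ = r * (ε / 2) := by field_simp
  have b2 : ‖(r : ℂ) * (holPart 0 (fderiv ℝ φ 0) * p 0 +
      barPart 0 (fderiv ℝ φ 0) * (starRingEnd ℂ) (p 0))‖ ≤ ε / 2 := by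
    rw [norm_mul, Complex.norm_real, Real.norm_eq_abs, abs_of_pos hr0]
    have h1 : ‖holPart 0 (fderiv ℝ φ 0) * p 0 +
        barPart 0 (fderiv ℝ φ 0) * (starRingEnd ℂ) (p 0)‖ ≤ (D + 1) * B := by
      refine (norm_add_le _ _).trans ?_
      rw [norm_mul, norm_mul, RCLike.norm_conj]
      calc _ ≤ ‖holPart 0 (fderiv ℝ φ 0)‖ * B + ‖barPart 0 (fderiv ℝ φ 0)‖ * B := by gcongr
        _ ≤ (D + 1) * B := by rw [hD]; nlinarith
    rw [lt_div_iff₀ (by positivity)] at hr3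
    calc _ ≤ r * ((D + 1) * B) := by gcongr
      _ ≤ ε / 2 := by linarith
  linarith [norm_add_le ((r : ℂ)⁻¹ * R) ((r : ℂ) * (holPart 0 (fderiv ℝ φ 0) * p 0 +
      barPart 0 (fderiv ℝ φ 0) * (starRingEnd ℂ) (p 0)))]

/-! ### The rotational symmetry of the limit -/

lemma barPart_comp_rot (l : C2 →L[ℝ] ℂ) :
    barPart 0 (l.comp rot) = -barPart 0 l ∧
      barPart 1 (l.comp rot) = -Complex.I * barPart 1 l := by
  have e0 : ∀ c : ℂ, rot (Pi.single 0 c) = -(Pi.single 0 c : C2) := fun c => by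
    apply C2_ext <;> simp
  have e1 : rot (Pi.single 1 1) = (Pi.single 1 Complex.I : C2) := by
    apply C2_ext <;> simp
  have e2 : rot (Pi.single 1 Complex.I) = -(Pi.single 1 1 : C2) := by
    apply C2_ext <;> simp
  simp only [barPart, ContinuousLinearMap.comp_apply, e0, e1, e2, map_neg]
  constructor
  · ring
  · linear_combination (l (Pi.single 1 Complex.I)) / 2 * Complex.I_sq

lemma dbr_comp_rot {f : C2 → ℂ} {w : C2} (hf : DifferentiableAt ℝ f (rot w)) :
    dbr 0 (fun w => f (rot w)) w = -dbr 0 f (rot w) ∧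
      dbr 1 (fun w => f (rot w)) w = -Complex.I * dbr 1 f (rot w) := by
  have h : fderiv ℝ (fun w => f (rot w)) w = (fderiv ℝ f (rot w)).comp rot :=
    (hf.hasFDerivAt.comp w rot.hasFDerivAt).fderiv
  simp only [dbr, h]
  exact barPart_comp_rot _

lemma dil_rot (t : ℝ) (w : C2) : dil t (rot w) = rot (dil t w) := by
  apply C2_ext <;> simp
  ring

/-- Integrals of odd forms against `v̄` vanish by symmetry. -/
lemma IsGauge.levelIntegral_conj_of_rot {m : C2 → ℝ} {c C : ℝ} (hm : IsGauge m c C)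
    (hrot : ∀ w, m (rot w) = m w) {H : Fin 2 → C2 → ℂ}
    (hH : ∀ p ≠ 0, m p = 1 → ∀ i, DifferentiableAt ℝ (H i) p)
    (hodd : ∀ i w, H i (rot w) = -H i w) :
    levelIntegral m (fun w => (starRingEnd ℂ) (w 1) * wedgeCoeff H 0 w)
      (fun w => (starRingEnd ℂ) (w 1) * wedgeCoeff H 1 w) = 0 := by
  set F := levelDensity m (fun w => (starRingEnd ℂ) (w 1) * wedgeCoeff H 0 w)
      (fun w => (starRingEnd ℂ) (w 1) * wedgeCoeff H 1 w) with hF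
  have hg : ∀ w, gproj m (rot w) = rot (gproj m w) := fun w => by
    rw [gproj, gproj, hrot, dil_rot]
  have hmd : ∀ w ≠ 0, dbr 0 (fun z => (m z : ℂ)) (rot w) = -dbr 0 (fun z => (m z : ℂ)) w ∧
      dbr 1 (fun z => (m z : ℂ)) (rot w) = Complex.I * dbr 1 (fun z => (m z : ℂ)) w := by
    intro w hw
    have h1 := dbr_comp_rot (hm.diff_ofReal (rot_ne_zero hw))
    simp only [hrot] at h1
    constructor
    · rw [h1.1]; ring
    · rw [h1.2]
      linear_combination dbr 1 (fun z => (m z : ℂ)) (rot w) * Complex.I_sq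
  have hHd : ∀ p ≠ 0, m p = 1 → ∀ i, dbr 0 (H i) (rot p) = dbr 0 (H i) p ∧
      dbr 1 (H i) (rot p) = -Complex.I * dbr 1 (H i) p := by
    intro p hp0 hp i
    have h1 := dbr_comp_rot (hH (rot p) (rot_ne_zero hp0) (by rw [hrot, hp]) i)
    simp only [hodd, dbr_neg] at h1
    constructor
    · linear_combination h1.1
    · linear_combination -Complex.I * h1.2 + dbr 1 (H i) (rot p) * Complex.I_sq
  -- The factor v̄ contributes −i. Each of the products P ∂m/∂v̄ and Q ∂m/∂ū, with P and Q the
  -- coefficients of η ∧ ∂̄η, contributes another −i.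
  have hFrot : ∀ w ≠ 0, F (rot w) = -F w := by
    intro w hw
    have hp0 := hm.gproj_ne_zero hw
    have hp := hm.gproj_eq_one hw
    simp only [hF, levelDensity, hg, hrot, (hmd w hw).1, (hmd w hw).2, wedgeCoeff, hodd,
      (hHd _ hp0 hp _).1, (hHd _ hp0 hp _).2, rot_apply_one, map_mul, Complex.conj_I]
    ring_nf
    simp only [Complex.I_sq]
    ring
  have h1 : ∫ w, F w = -∫ w, F w := by
    rw [← integral_neg]
    conv_lhs => rw [← integral_comp_rot]
    refine integral_congr_ae ?_
    have hne : ∀ᵐ w : C2, w ≠ 0 := by simp [ae_iff]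
    filter_upwards [hne] with w hw using hFrot w hw
  rw [levelIntegral, self_eq_neg.1 h1, mul_zero]

section

variable {a : ℂ} {g : C2 → Matrix (Fin 2) (Fin 2) ℂ} {s : ℝ}

lemma dil_zero (w : C2) : dil 0 w = 0 := by
  apply C2_ext <;> simp

/-- At r = 0 the metric is constantly g(0), and both coefficients au and −v² of X_0 change sign
under `rot`. Hence g(0) need not be invariant. -/
lemma scovec_zero_rot (i : Fin 2) (w : C2) : scovec a g i 0 (rot w) = -scovec a g i 0 w := by
  simp only [scovec, dil_zero, Fin.sum_univ_two, sfield_zero, sfield_one, rot_apply_zero,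
    rot_apply_one, map_mul, map_neg, map_pow, Complex.conj_I]
  ring_nf
  simp only [Complex.I_sq]
  simp

lemma snorm_zero_rot (w : C2) : snorm a g 0 (rot w) = snorm a g 0 w := by
  simp only [snorm, sherm, scovec_zero_rot]
  congr 1
  simp only [Fin.sum_univ_two, sfield_zero, sfield_one, rot_apply_zero, rot_apply_one, mul_pow,
    Complex.I_sq]
  simp

lemma sform_zero_rot (i : Fin 2) (w : C2) : sform a g 0 i (rot w) = -sform a g 0 i w := by
  rw [sform, sform, scovec_zero_rot, snorm_zero_rot, neg_div]

lemma gaugeOf_zero_rot (w : C2) : gaugeOf a g s 0 (rot w) = gaugeOf a g s 0 w := by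
  have : IsScale a g s 0 (rot w) = IsScale a g s 0 w := by
    funext t
    simp only [IsScale, zero_mul, dil_zero, snorm_zero_rot]
  unfold gaugeOf
  rw [this]

end

/-! ### The limit of the level integrals -/

variable {a : ℂ} {g : C2 → Matrix (Fin 2) (Fin 2) ℂ} {s c C : ℝ}

namespace MetricScale

lemma level_regular (h : MetricScale a g s c C) {r : ℝ} (hr : r ^ 4 < c * s ^ 4) {p : C2}
    (hp0 : p ≠ 0) (hp : gaugeOf a g s r p = 1) (i : Fin 2) :
    ContDiffAt ℝ ∞ (sform a g r i) p :=
  h.contDiffAt_sform_snd (h.snorm_eq_one hr hp0 hp).1 hp0 i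

lemma level_dual (h : MetricScale a g s c C) {r : ℝ} (hr : r ^ 4 < c * s ^ 4) {p : C2}
    (hp0 : p ≠ 0) (hp : gaugeOf a g s r p = 1) :
    ∀ᶠ w in 𝓝 p, ∑ i, sform a g r i w * sfield a r w i = 1 := by
  have h1 : ContinuousAt (fun w => quasi (dil r w)) p :=
    (continuous_quasi.comp (dil r).continuous).continuousAt
  filter_upwards [h1.eventually (gt_mem_nhds (h.snorm_eq_one hr hp0 hp).1),
    eventually_ne_nhds hp0] with w hw hw0
  exact h.sum_sform_mul_sfield hw hw0

/-- Joint continuity of the density of the rescaled form. -/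
lemma continuousAt_density (h : MetricScale a g s c C) {q : ℝ × C2} (hr : q.1 ^ 4 < c * s ^ 4)
    (hw : q.2 ≠ 0) : ContinuousAt (fun q : ℝ × C2 => levelDensity (gaugeOf a g s q.1)
      (wedgeCoeff (sform a g q.1) 0) (wedgeCoeff (sform a g q.1) 1) q.2) q := by
  have hm := h.isGauge hr
  have m0 := h.contDiffAt_gaugeOf hr hw
  have m1 : ContDiffAt ℝ ∞ (fun q : ℝ × C2 => (gaugeOf a g s q.1 q.2 : ℂ)) q :=
    Complex.ofRealCLM.contDiff.contDiffAt.comp q m0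
  have hpos := (hm.pos _ hw).ne'
  have hπ : ContinuousAt (fun q : ℝ × C2 => (q.1, gproj (gaugeOf a g s q.1) q.2)) q :=
    continuousAt_fst.prodMk ((m0.inv hpos).dil contDiffAt_snd).continuousAt
  have hwc : ∀ k, ContinuousAt (fun q : ℝ × C2 =>
      wedgeCoeff (sform a g q.1) k (gproj (gaugeOf a g s q.1) q.2)) q := by
    intro k
    have hp0 := hm.gproj_ne_zero hw
    have hq := (h.snorm_eq_one hr hp0 (hm.gproj_eq_one hw)).1
    have hs := fun i => h.contDiffAt_sform (q := (q.1, gproj (gaugeOf a g s q.1) q.2)) hq hp0 i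
    have hd := fun i => contDiffAt_dbr_snd (hs i) k
    exact ContinuousAt.comp (g := fun q : ℝ × C2 => wedgeCoeff (sform a g q.1) k q.2)
      (f := fun q : ℝ × C2 => (q.1, gproj (gaugeOf a g s q.1) q.2))
      (((hs 1).mul (hd 0)).sub ((hs 0).mul (hd 1))).continuousAt hπ
  have hcut : ContinuousAt (fun q : ℝ × C2 => (cutoff (gaugeOf a g s q.1 q.2) : ℂ)) q :=
    (Complex.continuous_ofReal.comp contDiff_cutoff.continuous).continuousAt.comp m0.continuousAt
  exact (hcut.mul ((m1.continuousAt.inv₀ (by exact_mod_cast hpos)).pow 5)).mul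
    (((hwc 0).mul (contDiffAt_dbr_snd m1 1).continuousAt).sub
      ((m1.continuousAt.mul (hwc 1)).mul (contDiffAt_dbr_snd m1 0).continuousAt))

lemma tendsto_density (h : MetricScale a g s c C) (h0 : (0 : ℝ) ^ 4 < c * s ^ 4) {w : C2}
    (hw : w ≠ 0) : Tendsto (fun r => levelDensity (gaugeOf a g s r)
      (wedgeCoeff (sform a g r) 0) (wedgeCoeff (sform a g r) 1) w) (𝓝 0)
      (𝓝 (levelDensity (gaugeOf a g s 0)
        (wedgeCoeff (sform a g 0) 0) (wedgeCoeff (sform a g 0) 1) w)) :=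
  ContinuousAt.comp (f := fun r : ℝ => (r, w)) (x := (0 : ℝ))
    (g := fun q : ℝ × C2 => levelDensity (gaugeOf a g s q.1)
      (wedgeCoeff (sform a g q.1) 0) (wedgeCoeff (sform a g q.1) 1) q.2)
    (h.continuousAt_density (q := ((0 : ℝ), w)) h0 hw) (by fun_prop)

lemma tendsto_gproj (h : MetricScale a g s c C) (h0 : (0 : ℝ) ^ 4 < c * s ^ 4) {w : C2}
    (hw : w ≠ 0) : Tendsto (fun r => gproj (gaugeOf a g s r) w) (𝓝 0)
      (𝓝 (gproj (gaugeOf a g s 0) w)) :=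
  ContinuousAt.comp (f := fun r : ℝ => (r, w)) (x := (0 : ℝ))
    (g := fun q : ℝ × C2 => gproj (gaugeOf a g s q.1) q.2)
    (((h.contDiffAt_gaugeOf (q := ((0 : ℝ), w)) h0 hw).inv
      ((h.isGauge h0).pos w hw).ne').dil contDiffAt_snd).continuousAt (by fun_prop)

lemma levelDensity_mul (m : C2 → ℝ) (f P Q : C2 → ℂ) (w : C2) :
    levelDensity m (fun p => f p * P p) (fun p => f p * Q p) w =
      f (gproj m w) * levelDensity m P Q w := by
  simp only [levelDensity]; ring

lemma quasi_le_of_gaugeOf (h : MetricScale a g s c C) {r : ℝ} (hr : r ^ 4 < c * s ^ 4) {p : C2}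
    (hp : gaugeOf a g s r p = 1) : quasi p ≤ 1 / c := by
  have := (h.isGauge hr).lower p
  rw [hp] at this
  rw [le_div_iff₀ h.c_pos]
  linarith

/-- The level integral of the remainder tends to zero. -/
lemma tendsto_remainder (h : MetricScale a g s c C) {φ : C2 → ℂ}
    (hφ : ∀ w, quasi w < s ^ 4 → ContDiffAt ℝ ∞ φ w) :
    Tendsto (fun r : ℝ => levelIntegral (gaugeOf a g s r)
      (fun p => ((r : ℂ)⁻¹ * (φ (dil r p) - (φ 0 + r * wirtinger 1 φ 0 * p 1))) *
        wedgeCoeff (sform a g r) 0 p)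
      (fun p => ((r : ℂ)⁻¹ * (φ (dil r p) - (φ 0 + r * wirtinger 1 φ 0 * p 1))) *
        wedgeCoeff (sform a g r) 1 p)) (𝓝[>] 0) (𝓝 0) := by
  have hc := h.c_pos
  have hs4 := pow_pos h.s_pos 4
  have h04 : (0 : ℝ) ^ 4 < c * s ^ 4 := by
    rw [zero_pow (by norm_num)]; positivity
  have hφ0 : DifferentiableAt ℝ φ 0 :=
    (hφ 0 (by rw [quasi_zero]; exact hs4)).differentiableAt (by simp)
  obtain ⟨r₁, hr₁, hr₁4⟩ : ∃ r₁ > 0, r₁ ^ 4 < c * s ^ 4 := by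
    have hev : ∀ᶠ r : ℝ in 𝓝[>] 0, r ^ 4 < c * s ^ 4 :=
      ((continuous_pow (M := ℝ) 4).continuousAt.eventually (gt_mem_nhds h04)).filter_mono
        inf_le_left
    obtain ⟨r, h1, h2⟩ := (hev.and self_mem_nhdsWithin).exists
    exact ⟨r, h2, h1⟩
  have hr4 : ∀ r ∈ Icc 0 r₁, r ^ 4 < c * s ^ 4 := fun r hr =>
    (pow_le_pow_left₀ hr.1 hr.2 4).trans_lt hr₁4
  have hsmall : ∀ᶠ r : ℝ in 𝓝[>] 0, r ∈ Ioc 0 r₁ := by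
    filter_upwards [self_mem_nhdsWithin, mem_nhdsWithin_of_mem_nhds (Iic_mem_nhds hr₁)]
      with r h1 h2 using ⟨h1, h2⟩
  set ker : ℝ → C2 → ℂ := fun r => levelDensity (gaugeOf a g s r)
    (wedgeCoeff (sform a g r) 0) (wedgeCoeff (sform a g r) 1) with hker
  set ψ : ℝ → C2 → ℂ := fun r p =>
    (r : ℂ)⁻¹ * (φ (dil r p) - (φ 0 + r * wirtinger 1 φ 0 * p 1)) with hψ
  set L : C2 → ℂ := fun p => dbr 1 φ 0 * (starRingEnd ℂ) (p 1) with hL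
  set A : Set C2 := {w | quasi w ∈ Icc (1 / C) (81 / c)} with hA
  have hAne : ∀ w ∈ A, w ≠ 0 := by
    rintro w hw rfl
    have := hw.1
    rw [quasi_zero] at this
    have := one_div_pos.2 h.C_pos
    linarith
  -- Joint continuity up to r = 0 gives a bound uniform in r, which is the dominating constant.
  obtain ⟨M, hM⟩ := (isCompact_Icc.prod (isCompact_quasi_Icc (1 / C) (81 / c)) :
    IsCompact (Icc 0 r₁ ×ˢ A)).exists_bound_of_continuousOn
    (f := fun q : ℝ × C2 => ker q.1 q.2) fun q hq =>
      (h.continuousAt_density (hr4 _ hq.1) (hAne _ hq.2)).continuousWithinAt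
  have hker0 : ∀ r ∈ Icc 0 r₁, ∀ w ∉ A, ker r w = 0 := by
    intro r hr w hw
    by_cases h1 : quasi w < 1 / C
    · exact (h.isGauge (hr4 r hr)).levelDensity_eq_zero_of_lt _ _ h1
    · refine (h.isGauge (hr4 r hr)).levelDensity_eq_zero_of_gt _ _ ?_
      by_contra! h2
      exact hw ⟨not_lt.1 h1, h2⟩
  obtain ⟨B, hB0, hB⟩ := (isCompact_quasi_Icc 0 (1 / c)).isBounded.exists_pos_norm_le
  have hLB : ∀ p, quasi p ≤ 1 / c → ‖L p‖ ≤ ‖dbr 1 φ 0‖ * B := by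
    intro p hp
    rw [hL, norm_mul, RCLike.norm_conj]
    gcongr
    exact (norm_le_pi_norm p 1).trans (hB p ⟨quasi_nonneg p, hp⟩)
  have hπ1 : ∀ r ∈ Icc 0 r₁, ∀ w ≠ 0, quasi (gproj (gaugeOf a g s r) w) ≤ 1 / c :=
    fun r hr w hw => h.quasi_le_of_gaugeOf (hr4 r hr) ((h.isGauge (hr4 r hr)).gproj_eq_one hw)
  have hne : ∀ᵐ w : C2, w ≠ 0 := by simp [ae_iff]
  have hlim : Tendsto (fun r => ∫ w, levelDensity (gaugeOf a g s r)
      (fun p => ψ r p * wedgeCoeff (sform a g r) 0 p)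
      (fun p => ψ r p * wedgeCoeff (sform a g r) 1 p) w) (𝓝[>] 0)
      (𝓝 (∫ w, L (gproj (gaugeOf a g s 0) w) * ker 0 w)) := by
    refine tendsto_integral_filter_of_dominated_convergence
      (A.indicator fun _ => (1 + ‖dbr 1 φ 0‖ * B) * |M|) ?_ ?_ ?_ ?_
    · filter_upwards [hsmall] with r hr
      have hr' : r ∈ Icc 0 r₁ := ⟨hr.1.le, hr.2⟩
      have hψc : ∀ p ≠ 0, gaugeOf a g s r p = 1 → ContinuousAt (ψ r) p := by
        intro p hp0 hp
        have h1 : ContinuousAt (fun p => φ (dil r p)) p :=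
          ContinuousAt.comp (hφ _ (h.snorm_eq_one (hr4 r hr') hp0 hp).1).continuousAt
            (dil r).continuous.continuousAt
        exact continuousAt_const.mul (h1.sub (continuousAt_const.add
          (continuousAt_const.mul (contDiff_coord 1).continuous.continuousAt)))
      have hwc : ∀ k, ∀ p ≠ 0, gaugeOf a g s r p = 1 →
          ContinuousAt (wedgeCoeff (sform a g r) k) p := fun k p hp0 hp =>
        (contDiffAt_wedgeCoeff (h.level_regular (hr4 r hr') hp0 hp) k).continuousAt
      exact ((h.isGauge (hr4 r hr')).integrable_levelDensity
        (fun p hp0 hp => (hψc p hp0 hp).mul (hwc 0 p hp0 hp))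
        (fun p hp0 hp => (hψc p hp0 hp).mul (hwc 1 p hp0 hp))).aestronglyMeasurable
    · filter_upwards [hsmall, eventually_remainder_le hφ0 (1 / c) one_pos] with r hr hrem
      have hr' : r ∈ Icc 0 r₁ := ⟨hr.1.le, hr.2⟩
      filter_upwards [hne] with w hw
      rw [levelDensity_mul]
      by_cases hwA : w ∈ A
      · rw [indicator_of_mem hwA, norm_mul]
        have h1 := hrem _ (hπ1 r hr' w hw)
        have h2 := hLB _ (hπ1 r hr' w hw)
        -- ψ is within 1 of its limit L, and L is bounded on the region containing all level sets.
        have h3 : ‖ψ r (gproj (gaugeOf a g s r) w)‖ ≤ 1 + ‖dbr 1 φ 0‖ * B := by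
          have := norm_add_le (ψ r (gproj (gaugeOf a g s r) w) - L (gproj (gaugeOf a g s r) w))
            (L (gproj (gaugeOf a g s r) w))
          rw [sub_add_cancel] at this
          exact this.trans (add_le_add h1 h2)
        have h4 : ‖ker r w‖ ≤ |M| := (hM (r, w) ⟨hr', hwA⟩).trans (le_abs_self M)
        exact mul_le_mul h3 h4 (norm_nonneg _) (by positivity)
      · rw [indicator_of_notMem hwA]
        have := hker0 r hr' w hwA
        simp only [hker] at this
        rw [this, mul_zero, norm_zero]
    · have hAm : MeasurableSet A := (isCompact_quasi_Icc _ _).measurableSet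
      exact (integrableOn_const (isCompact_quasi_Icc _ _).measure_lt_top.ne).integrable_indicator
        hAm
    · filter_upwards [hne] with w hw
      simp only [levelDensity_mul]
      have t1 : Tendsto (fun r => ker r w) (𝓝[>] 0) (𝓝 (ker 0 w)) :=
        (h.tendsto_density h04 hw).mono_left inf_le_left
      have t2 : Tendsto (fun r => L (gproj (gaugeOf a g s r) w)) (𝓝[>] 0)
          (𝓝 (L (gproj (gaugeOf a g s 0) w))) := by
        have hLc : Continuous L := continuous_const.mul (contDiff_conj_coord 1).continuous
        exact (hLc.tendsto _).comp ((h.tendsto_gproj h04 hw).mono_left inf_le_left)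
      have t3 : Tendsto (fun r => ψ r (gproj (gaugeOf a g s r) w) -
          L (gproj (gaugeOf a g s r) w)) (𝓝[>] 0) (𝓝 0) := by
        rw [Metric.tendsto_nhds]
        intro ε hε
        filter_upwards [hsmall, eventually_remainder_le hφ0 (1 / c) (half_pos hε)] with r hr hrem
        rw [dist_zero_right]
        exact (hrem _ (hπ1 r ⟨hr.1.le, hr.2⟩ w hw)).trans_lt (half_lt_self hε)
      have t4 := (t3.add t2).mul t1
      simp only [sub_add_cancel, zero_add] at t4
      exact t4
  -- The limit is ∂φ/∂v̄(0) times an integral of v̄ against η_0 ∧ ∂̄η_0, which the rotation kills.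
  have hzero : ∫ w, L (gproj (gaugeOf a g s 0) w) * ker 0 w = 0 := by
    have h1 := (h.isGauge h04).levelIntegral_conj_of_rot gaugeOf_zero_rot
      (H := sform a g 0)
      (fun p hp0 hp i => (h.level_regular h04 hp0 hp i).differentiableAt (by simp))
      sform_zero_rot
    rw [levelIntegral, mul_eq_zero] at h1
    have h2 := h1.resolve_left (by norm_num)
    simp only [levelDensity_mul (f := fun p => (starRingEnd ℂ) (p 1))] at h2
    simp only [hL, mul_assoc, integral_const_mul]
    rw [h2, mul_zero]
  rw [hzero] at hlim
  have := hlim.const_mul (-4)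
  rw [mul_zero] at this
  exact this

/-- The rescaled boundary integral. -/
lemma tendsto_levelIntegral (h : MetricScale a g s c C) {φ : C2 → ℂ}
    (hφ : ∀ w, quasi w < s ^ 4 → ContDiffAt ℝ ∞ φ w) :
    Tendsto (fun r : ℝ => levelIntegral (gaugeOf a g s r)
      (fun p => (r : ℂ) ^ 5 * (φ (dil r p) * wedgeCoeff (etaCoeff a g) 0 (dil r p)))
      (fun p => (r : ℂ) ^ 4 * (φ (dil r p) * wedgeCoeff (etaCoeff a g) 1 (dil r p)))) (𝓝[>] 0)
      (𝓝 (4 * (Real.pi : ℂ) ^ 2 / a * wirtinger 1 φ 0 - 4 * (Real.pi : ℂ) ^ 2 / a ^ 2 * φ 0)) := by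
  have hc := h.c_pos
  have hs4 := pow_pos h.s_pos 4
  have h04 : (0 : ℝ) ^ 4 < c * s ^ 4 := by
    rw [zero_pow (by norm_num)]; positivity
  have hev : ∀ᶠ r : ℝ in 𝓝[>] 0, r ^ 4 < c * s ^ 4 :=
    ((continuous_pow (M := ℝ) 4).continuousAt.eventually (gt_mem_nhds h04)).filter_mono
      inf_le_left
  have h1 := (h.tendsto_remainder hφ).const_add
    (4 * (Real.pi : ℂ) ^ 2 * (wirtinger 1 φ 0 / a - φ 0 / a ^ 2))
  have e : 4 * (Real.pi : ℂ) ^ 2 * (wirtinger 1 φ 0 / a - φ 0 / a ^ 2) + 0 =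
      4 * (Real.pi : ℂ) ^ 2 / a * wirtinger 1 φ 0 - 4 * (Real.pi : ℂ) ^ 2 / a ^ 2 * φ 0 := by
    ring
  rw [e] at h1
  refine h1.congr' ?_
  filter_upwards [hev, self_mem_nhdsWithin] with r hr (hr0 : 0 < r)
  have hr' : (r : ℂ) ≠ 0 := by exact_mod_cast hr0.ne'
  have hm := h.isGauge hr
  -- For the affine part no limit is needed: its integral is exactly r times the claimed value, and
  -- r cancels the r⁻¹ of the rescaling.
  have haff := hm.levelIntegral_affine h.ha (H := sform a g r)
    (fun p hp0 hp => h.level_regular hr hp0 hp) (fun p hp0 hp => h.level_dual hr hp0 hp)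
    (fun p hp0 hp => h.add_ne_zero (h.snorm_eq_one hr hp0 hp).1) (φ 0) (wirtinger 1 φ 0)
  have haff' := congrArg (fun x => (r : ℂ)⁻¹ * x) haff
  simp only [← levelIntegral_const_mul] at haff'
  rw [← mul_assoc, inv_mul_cancel₀ hr', one_mul] at haff'
  have hwc : ∀ k, ∀ p ≠ 0, gaugeOf a g s r p = 1 →
      ContinuousAt (wedgeCoeff (sform a g r) k) p := fun k p hp0 hp =>
    (contDiffAt_wedgeCoeff (h.level_regular hr hp0 hp) k).continuousAt
  have hlin : ∀ p : C2, ContinuousAt (fun p : C2 => φ 0 + r * wirtinger 1 φ 0 * p 1) p :=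
    fun p => continuousAt_const.add
      (continuousAt_const.mul (contDiff_coord 1).continuous.continuousAt)
  have hφc : ∀ p ≠ 0, gaugeOf a g s r p = 1 → ContinuousAt (fun p => φ (dil r p)) p :=
    fun p hp0 hp => ContinuousAt.comp (hφ _ (h.snorm_eq_one hr hp0 hp).1).continuousAt
      (dil r).continuous.continuousAt
  have hA : ∀ k, ∀ p ≠ 0, gaugeOf a g s r p = 1 → ContinuousAt (fun p : C2 => (r : ℂ)⁻¹ *
      ((φ 0 + r * wirtinger 1 φ 0 * p 1) * wedgeCoeff (sform a g r) k p)) p :=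
    fun k p hp0 hp => continuousAt_const.mul ((hlin p).mul (hwc k p hp0 hp))
  have hB : ∀ k, ∀ p ≠ 0, gaugeOf a g s r p = 1 → ContinuousAt (fun p : C2 =>
      ((r : ℂ)⁻¹ * (φ (dil r p) - (φ 0 + r * wirtinger 1 φ 0 * p 1))) *
        wedgeCoeff (sform a g r) k p) p :=
    fun k p hp0 hp => (continuousAt_const.mul ((hφc p hp0 hp).sub (hlin p))).mul (hwc k p hp0 hp)
  rw [← haff', ← hm.levelIntegral_add (hA 0) (hA 1) (hB 0) (hB 1)]
  refine hm.levelIntegral_congr (fun p hp0 hp => ?_) (fun p hp0 hp => ?_)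
  · have := (h.wedgeCoeff_etaCoeff_dil hr0.ne' (h.snorm_eq_one hr hp0 hp).1 hp0).1
    linear_combination -φ (dil r p) * this
  · have := (h.wedgeCoeff_etaCoeff_dil hr0.ne' (h.snorm_eq_one hr hp0 hp).1 hp0).2
    linear_combination -φ (dil r p) * this

/-- The boundary integral over a small distorted ball. -/
lemma isBoundaryIntegral_iff (h : MetricScale a g s c C) {φ : C2 → ℂ}
    (hφ : ∀ w, quasi w < s ^ 4 → ContDiffAt ℝ ∞ φ w) {r : ℝ} (hr0 : 0 < r)
    (hr : r ^ 4 < c * s ^ 4) (J : ℂ) :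
    IsBoundaryIntegral {w | gaugeOf a g s r w ≤ r} (residueForm a g φ) J ↔
      J = levelIntegral (gaugeOf a g s r)
        (fun p => (r : ℂ) ^ 5 * (φ (dil r p) * wedgeCoeff (etaCoeff a g) 0 (dil r p)))
        (fun p => (r : ℂ) ^ 4 * (φ (dil r p) * wedgeCoeff (etaCoeff a g) 1 (dil r p))) := by
  have hm := h.isGauge hr
  have hreg : ∀ p, gaugeOf a g s r p = r → quasi p < s ^ 4 ∧ p ≠ 0 := by
    intro p hp
    have hp0 : p ≠ 0 := by
      rintro rfl
      rw [gaugeOf_zero] at hp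
      exact hr0.ne hp
    refine ⟨?_, hp0⟩
    have h1 : gaugeOf a g s r (dil r⁻¹ p) = 1 := by
      rw [hm.hom _ (inv_pos.2 hr0), hp, inv_mul_cancel₀ hr0.ne']
    have h2 := (h.snorm_eq_one hr (dil_ne_zero (inv_ne_zero hr0.ne') hp0) h1).1
    rwa [dil_dil, mul_inv_cancel₀ hr0.ne', dil_one] at h2
  have hcont : ∀ k p, gaugeOf a g s r p = r →
      ContinuousAt (fun p => φ p * wedgeCoeff (etaCoeff a g) k p) p := fun k p hp =>
    (hφ p (hreg p hp).1).continuousAt.mul (contDiffAt_wedgeCoeff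
      (h.contDiffAt_etaCoeff (hreg p hp).1 (hreg p hp).2) k).continuousAt
  have key : ∀ J, IsBoundaryIntegral {w | gaugeOf a g s r w ≤ r} (residueForm a g φ) J → J = _ :=
    fun J hJ => hm.boundaryIntegral_eq hr0 (hcont 0) (hcont 1)
      (fun p hp v => h.residueForm_eq φ (hreg p hp).1 (hreg p hp).2 v) hJ
  -- Every boundary integral equals the level integral and at least one exists, which gives the
  -- converse.
  refine ⟨key J, fun hJ => ?_⟩
  obtain ⟨J', hJ'⟩ := hm.exists_boundaryIntegral hr0 (residueForm a g φ)
  rw [hJ, ← key J' hJ']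
  exact hJ'

end MetricScale

lemma exists_quasi_subset {K : Set C2} (hK : K ∈ 𝓝 (0 : C2)) {b : ℝ} (hb : 0 < b) :
    ∃ s > 0, s ≤ b ∧ ∀ w, quasi w < s ^ 4 → w ∈ K := by
  obtain ⟨ε, hε, hball⟩ := Metric.mem_nhds_iff.1 hK
  have hs : 0 < min b (min 1 (ε / 2)) := by positivity
  refine ⟨_, hs, min_le_left _ _, fun w hw => hball ?_⟩
  set s := min b (min 1 (ε / 2))
  have h1 : s ≤ 1 := (min_le_right _ _).trans (min_le_left _ _)
  have h2 : s ≤ ε / 2 := (min_le_right _ _).trans (min_le_right _ _)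
  obtain ⟨h3, h4⟩ := norm_le_of_quasi hs.le hw.le
  rw [mem_ball_zero_iff, pi_norm_lt_iff hε]
  intro i
  fin_cases i
  · refine h3.trans_lt ?_
    nlinarith
  · exact h4.trans_lt (by linarith)

theorem exists_limit (ha : a ≠ 0) {U : Set C2} (hU : IsOpen U) (hg : IsKahlerMetricOn g U)
    {φ : C2 → ℂ} (hφ : ContDiffOn ℝ ∞ φ U) {K : Set C2} (hK : IsCompact K)
    (hK0 : K ∈ 𝓝 (0 : C2)) (hKU : K ⊆ U) :
    ∃ I : ℝ → ℂ,
      (∀ᶠ r : ℝ in 𝓝[>] 0, ∀ J : ℂ,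
        IsBoundaryIntegral (distortedBall a g K r) (residueForm a g φ) J ↔ J = I r) ∧
      Tendsto I (𝓝[>] 0)
        (𝓝 (4 * (Real.pi : ℂ) ^ 2 / a * wirtinger 1 φ 0 -
          4 * (Real.pi : ℂ) ^ 2 / a ^ 2 * φ 0)) := by
  obtain ⟨s₀, hs₀, hle, hsub₀⟩ := exists_quasi_subset hK0 (norm_pos_iff.2 ha)
  have hgs : ∀ w ∈ U, ∀ i j, ContDiffAt ℝ ∞ (fun z => g z i j) w := fun w hw i j =>
    (hg.smooth i j).contDiffAt (hU.mem_nhds hw)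
  have hnear : MetricNear a g s₀ :=
    ⟨ha, hs₀, fun w hw => hgs w (hKU (hsub₀ w hw)), fun w hw => hg.posDef w (hKU (hsub₀ w hw)),
      hle⟩
  obtain ⟨s, c, C, hss, h⟩ := hnear.exists_scale
  have hsub : ∀ w, quasi w < s ^ 4 → w ∈ K := fun w hw =>
    hsub₀ w (hw.trans_le (pow_le_pow_left₀ h.s_pos.le hss 4))
  have hφ' : ∀ w, quasi w < s ^ 4 → ContDiffAt ℝ ∞ φ w := fun w hw =>
    hφ.contDiffAt (hU.mem_nhds (hKU (hsub w hw)))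
  have hfield : ∀ i, Continuous (fun w : C2 => field a w i) := fun i => by
    have e : (fun w : C2 => field a w i) = fun w => sfield a 1 w i := funext fun w => by
      simpa using field_dil a 1 w i
    rw [e]
    exact continuous_iff_continuousAt.2 fun w => ContinuousAt.comp
      (g := fun q : ℝ × C2 => sfield a q.1 q.2 i) (f := fun w => ((1 : ℝ), w))
      (MetricNear.contDiffAt_sfield a i (1, w)).continuousAt (by fun_prop)
  have hcont : ContinuousOn (fieldNormSq a g) K := fun w hw => by
    refine ContinuousAt.continuousWithinAt (Complex.continuous_re.continuousAt.comp ?_)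
    exact tendsto_finsetSum _ fun i _ => tendsto_finsetSum _ fun j _ =>
      ((hgs w (hKU hw) i j).continuousAt.mul (hfield i).continuousAt).mul
        (hfield j).star.continuousAt
  have hpos : ∀ w ∈ K, w ≠ 0 → 0 < fieldNormSq a g w := fun w hw hw0 => by
    have e := fieldNormSq_dil (a := a) (g := g) 1 w
    rw [dil_one, one_pow, one_mul] at e
    rw [e]
    refine (Complex.pos_iff.1 (sherm_pos_of_posDef (by rw [dil_one]; exact hg.posDef w (hKU hw))
      fun h0 => hw0 ?_)).1
    have e0 := congrFun h0 0
    have e1 := congrFun h0 1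
    simp only [sfield_zero, sfield_one, Pi.zero_apply, neg_eq_zero] at e0 e1
    have e2 : w 1 = 0 := pow_eq_zero_iff two_ne_zero |>.1 e1
    rw [e2, mul_zero, add_zero, mul_eq_zero] at e0
    exact C2_ext (e0.resolve_right ha) e2
  refine ⟨_, ?_, h.tendsto_levelIntegral hφ'⟩
  have hev : ∀ᶠ r : ℝ in 𝓝[>] 0, r ^ 4 < c * s ^ 4 := by
    have h04 : (0 : ℝ) ^ 4 < c * s ^ 4 := by
      rw [zero_pow (by norm_num)]
      exact mul_pos h.c_pos (pow_pos h.s_pos 4)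
    exact ((continuous_pow (M := ℝ) 4).continuousAt.eventually (gt_mem_nhds h04)).filter_mono
      inf_le_left
  filter_upwards [hev, h.distortedBall_eq hK hsub hcont hpos, self_mem_nhdsWithin]
    with r hr hball (hr0 : 0 < r) J
  rw [hball]
  exact h.isBoundaryIntegral_iff hφ' hr0 hr J

end DegenerateResidue

end

theorem lemma3p5 (a : ℂ) (ha : a ≠ 0)
    (U : Set (Fin 2 → ℂ)) (hU : IsOpen U) (h0U : (0 : Fin 2 → ℂ) ∈ U)
    (g : (Fin 2 → ℂ) → Matrix (Fin 2) (Fin 2) ℂ)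
    (hg : DegenerateResidue.IsKahlerMetricOn g U)
    (φ : (Fin 2 → ℂ) → ℂ) (hφ : ContDiffOn ℝ ∞ φ U)
    (K : Set (Fin 2 → ℂ)) (hK : IsCompact K) (hK0 : K ∈ 𝓝 (0 : Fin 2 → ℂ)) (hKU : K ⊆ U) :
    ∃ I : ℝ → ℂ,
      (∀ᶠ r : ℝ in 𝓝[>] 0, ∀ J : ℂ,
        DegenerateResidue.IsBoundaryIntegral (DegenerateResidue.distortedBall a g K r)
          (DegenerateResidue.residueForm a g φ) J ↔ J = I r) ∧
      Filter.Tendsto I (𝓝[>] 0)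
        (𝓝 (4 * (Real.pi : ℂ) ^ 2 / a * DegenerateResidue.wirtinger 1 φ 0 -
          4 * (Real.pi : ℂ) ^ 2 / a ^ 2 * φ 0)) := by
  exact DegenerateResidue.exists_limit ha hU hg hφ hK hK0 hKU
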